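/- Let $n\ge 1$ and let $K\subset\mathbb{R}^n$ be a convex body (compact, convex, with non-empty interior) that is symmetric ($K=-K$), has volume $|K|=1$, and is of class $C^2_+$, i.e. its boundary $\partial K$ is $C^2$ with everywhere strictly positive Gauss curvature $\kappa$. For a set $C\subset\mathbb{R}^n$ let $h_C(u)=\sup_{x\in C}\langle x,u\rangle$ be its support function and $C^\circ=\{y:\langle x,y\rangle\le 1\ \text{for all }x\in C\}$ its polar. For real $p\ge 1$ let $Z_p(K)$ be the $L_p$ centroid body of $K$, that is, the convex body with support function $$h_{Z_p(K)}(\theta)=\Big(\int_K|\langle x,\theta\rangle|^p\,dx\Big)^{1/p},$$ and write $Z_p^\circ(K)$ for its polar. Let $N(x)$ be the outer unit normal of $K$ at $x\in\partial K$, $\mu$ the surface area measure on $\partial K$, $\sigma$ the (unnormalized) surface measure on the unit sphere $S^{n-1}$, and $f_K(u)$ the reciprocal of the Gauss curvature at the point of $\partial K$ with outer unit normal $u$. Then all volumes and integrals below are finite, and (i) $$\lim_{p\to\infty}\frac{p}{\log p}\big(|Z_p^\circ(K)|-|K^\circ|\big)=\frac{n(n+1)}{2}\,|K^\circ|;$$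 (ii) $$\lim_{p\to\infty}p\Big(|Z_p^\circ(K)|-|K^\circ|-\frac{n(n+1)}{2p}\log p\;|Z_p^\circ(K)|\Big)=\lim_{p\to\infty}p\Big(|Z_p^\circ(K)|-|K^\circ|-\frac{n(n+1)}{2p}\log p\;|K^\circ|\Big)$$ $$=-\frac12\int_{S^{n-1}}h_K(u)^{-n}\log\!\big(2^{n+1}\pi^{n-1}h_K(u)^{n+1}f_K(u)\big)\,d\sigma(u)=\frac12\int_{\partial K}\frac{\kappa(x)}{\langle x,N(x)\rangle^n}\log\!\Big(\frac{\kappa(x)}{2^{n+1}\pi^{n-1}\langle x,N(x)\rangle^{n+1}}\Big)\,d\mu(x),$$ where both limits exist. -/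

import Mathlib

open MeasureTheory Filter Topology Set
open scoped RealInnerProductSpace

noncomputable section

namespace CentroidBody

variable {n : ℕ}

/-- The support function `h_K(u) = max {⟨x, u⟩ : x ∈ K}`. -/
def supportFn (K : Set (EuclideanSpace ℝ (Fin n))) (u : EuclideanSpace ℝ (Fin n)) : ℝ :=
  sSup ((fun x => ⟪x, u⟫) '' K)

/-- The polar body `K° = {y : ⟨x, y⟩ ≤ 1 for all x ∈ K}`. -/
def polarBody (K : Set (EuclideanSpace ℝ (Fin n))) : Set (EuclideanSpace ℝ (Fin n)) :=
  {y | ∀ x ∈ K, ⟪x, y⟫ ≤ 1}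

/-- The function `θ ↦ (∫_K |⟨x, θ⟩|^p dx)^(1/p)`. -/
def moment (p : ℝ) (K : Set (EuclideanSpace ℝ (Fin n))) (θ : EuclideanSpace ℝ (Fin n)) : ℝ :=
  (∫ x in K, |⟪x, θ⟫| ^ p) ^ (1 / p)

/-- The `L_p` centroid body `Z_p(K)`: the convex body whose support function is
`θ ↦ (∫_K |⟨x, θ⟩|^p dx)^(1/p)`, given as the intersection of the half-spaces which that function
prescribes. For `p ≥ 1` it does have this support function, see `supportFn_Zp`. -/
def Zp (p : ℝ) (K : Set (EuclideanSpace ℝ (Fin n))) : Set (EuclideanSpace ℝ (Fin n)) :=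
  {x | ∀ θ, ⟪x, θ⟫ ≤ moment p K θ}

/-- The outer unit normal `N_K(x)` at a boundary point `x`: the unit vector `u` such that `K` lies
in the half-space `{y : ⟨y, u⟩ ≤ ⟨x, u⟩}` (unique when the boundary is smooth). -/
def outerNormal (K : Set (EuclideanSpace ℝ (Fin n))) (x : EuclideanSpace ℝ (Fin n)) :
    EuclideanSpace ℝ (Fin n) :=
  Classical.epsilon fun u => ‖u‖ = 1 ∧ ∀ y ∈ K, ⟪y, u⟫ ≤ ⟪x, u⟫

/-- The Weingarten map at `x`: the differential of the Gauss map `N_K : ∂K → S^{n-1}`, as an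
endomorphism of the tangent space `N_K(x)^⊥` (the projection is the identity on its range). -/
def weingarten (K : Set (EuclideanSpace ℝ (Fin n))) (x : EuclideanSpace ℝ (Fin n)) :
    ((ℝ ∙ outerNormal K x)ᗮ : Submodule ℝ (EuclideanSpace ℝ (Fin n))) →ₗ[ℝ]
      ((ℝ ∙ outerNormal K x)ᗮ : Submodule ℝ (EuclideanSpace ℝ (Fin n))) :=
  ((ℝ ∙ outerNormal K x)ᗮ.orthogonalProjectionOnto ∘L
    fderivWithin ℝ (outerNormal K) (frontier K) x ∘L (ℝ ∙ outerNormal K x)ᗮ.subtypeL :)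

/-- The Gauss curvature `κ_K(x)`. -/
def gaussCurvature (K : Set (EuclideanSpace ℝ (Fin n))) (x : EuclideanSpace ℝ (Fin n)) : ℝ :=
  LinearMap.det (weingarten K x)

/-- The boundary of `K` is of class `C^2`: near each of its boundary points, `K` is a sublevel set
`{φ ≤ 0}` of a `C^2` function with non-vanishing differential. -/
def HasC2Boundary (K : Set (EuclideanSpace ℝ (Fin n))) : Prop :=
  ∀ x ∈ frontier K, ∃ (U : Set (EuclideanSpace ℝ (Fin n))) (φ : EuclideanSpace ℝ (Fin n) → ℝ),
    IsOpen U ∧ x ∈ U ∧ ContDiffOn ℝ 2 φ U ∧ fderiv ℝ φ x ≠ 0 ∧ K ∩ U = {y ∈ U | φ y ≤ 0}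

/-- `K ∈ C^2_+`: the boundary is `C^2` with everywhere strictly positive Gauss curvature. -/
structure IsC2Plus (K : Set (EuclideanSpace ℝ (Fin n))) : Prop where
  c2 : HasC2Boundary K
  curvature_pos : ∀ x ∈ frontier K, 0 < gaussCurvature K x

/-- The curvature function `f_K(u)`: the reciprocal of the Gauss curvature at the boundary point
that has outer unit normal `u`. -/
def curvatureFn (K : Set (EuclideanSpace ℝ (Fin n))) (u : EuclideanSpace ℝ (Fin n)) : ℝ :=
  (gaussCurvature K (Function.invFunOn (outerNormal K) (frontier K) u))⁻¹

/-- The surface area measure `μ_K`: the `(n-1)`-dimensional Hausdorff measure on `∂K`, in the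
normalization that agrees with Lebesgue measure on Euclidean `(n-1)`-space. -/
def surfaceMeasure (K : Set (EuclideanSpace ℝ (Fin n))) : Measure (EuclideanSpace ℝ (Fin n)) :=
  (Measure.euclideanHausdorffMeasure (n - 1)).restrict (frontier K)

/-- The rotation invariant surface measure `σ` on `S^{n-1}`, of total mass `n |B_2^n|`. -/
def sphereMeasure (n : ℕ) : Measure (Metric.sphere (0 : EuclideanSpace ℝ (Fin n)) 1) :=
  (volume : Measure (EuclideanSpace ℝ (Fin n))).toSphere

/-- `u ↦ h_K(u)^{-n} log (2^{n+1} π^{n-1} h_K(u)^{n+1} f_K(u))`. -/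
def sphereIntegrand (K : Set (EuclideanSpace ℝ (Fin n))) (u : EuclideanSpace ℝ (Fin n)) : ℝ :=
  (supportFn K u ^ n)⁻¹ *
    Real.log (2 ^ (n + 1) * Real.pi ^ (n - 1) * supportFn K u ^ (n + 1) * curvatureFn K u)

/-- `x ↦ κ(x) / ⟨x, N(x)⟩^n * log (κ(x) / (2^{n+1} π^{n-1} ⟨x, N(x)⟩^{n+1}))`. -/
def boundaryIntegrand (K : Set (EuclideanSpace ℝ (Fin n))) (x : EuclideanSpace ℝ (Fin n)) : ℝ :=
  gaussCurvature K x / ⟪x, outerNormal K x⟫ ^ n *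
    Real.log (gaussCurvature K x /
      (2 ^ (n + 1) * Real.pi ^ (n - 1) * ⟪x, outerNormal K x⟫ ^ (n + 1)))

lemma moment_eq_lpNorm {p : ℝ} (hp : 1 ≤ p) (K : Set (EuclideanSpace ℝ (Fin n)))
    (hK : IsCompact K) (θ : EuclideanSpace ℝ (Fin n)) :
    MemLp (fun x => ⟪x, θ⟫) (ENNReal.ofReal p) (volume.restrict K) ∧
    moment p K θ = (eLpNorm (fun x => ⟪x, θ⟫) (ENNReal.ofReal p) (volume.restrict K)).toReal := by
  have hp0 : 0 < p := by linarith
  have hfin : IsFiniteMeasure (volume.restrict K) :=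
    isFiniteMeasure_restrict.2 hK.measure_lt_top.ne
  have hc : Continuous fun x : EuclideanSpace ℝ (Fin n) => ⟪x, θ⟫ := by fun_prop
  have hm : MemLp (fun x => ⟪x, θ⟫) (ENNReal.ofReal p) (volume.restrict K) := by
    obtain ⟨C, hC⟩ := hK.exists_bound_of_continuousOn hc.continuousOn
    exact MemLp.of_bound hc.aestronglyMeasurable C
      ((ae_restrict_iff' hK.measurableSet).2 (Eventually.of_forall hC))
  refine ⟨hm, ?_⟩
  rw [hm.eLpNorm_eq_integral_rpow_norm (by simpa using hp0) ENNReal.ofReal_ne_top,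
    ENNReal.toReal_ofReal hp0.le, ENNReal.toReal_ofReal (by positivity)]
  simp [moment, Real.norm_eq_abs]

lemma moment_add_le {p : ℝ} (hp : 1 ≤ p) (K : Set (EuclideanSpace ℝ (Fin n)))
    (hK : IsCompact K) (θ η : EuclideanSpace ℝ (Fin n)) :
    moment p K (θ + η) ≤ moment p K θ + moment p K η := by
  obtain ⟨h1, e1⟩ := moment_eq_lpNorm hp K hK θ
  obtain ⟨h2, e2⟩ := moment_eq_lpNorm hp K hK η
  rw [(moment_eq_lpNorm hp K hK (θ + η)).2, e1, e2,
    ← ENNReal.toReal_add h1.eLpNorm_ne_top h2.eLpNorm_ne_top]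
  refine ENNReal.toReal_mono (ENNReal.add_ne_top.2 ⟨h1.eLpNorm_ne_top, h2.eLpNorm_ne_top⟩) ?_
  simp_rw [inner_add_right]
  exact eLpNorm_add_le h1.1 h2.1 (by simpa using hp)

lemma moment_smul {p : ℝ} (hp : 1 ≤ p) (K : Set (EuclideanSpace ℝ (Fin n)))
    (c : ℝ) (θ : EuclideanSpace ℝ (Fin n)) :
    moment p K (c • θ) = |c| * moment p K θ := by
  have hp0 : p ≠ 0 := by linarith
  unfold moment
  simp_rw [inner_smul_right, abs_mul, Real.mul_rpow (abs_nonneg c) (abs_nonneg _)]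
  rw [integral_const_mul, Real.mul_rpow (by positivity) (by positivity), one_div,
    Real.rpow_rpow_inv (abs_nonneg c) hp0]

/-- `Z_p(K)` has the support function `θ ↦ (∫_K |⟨x, θ⟩|^p dx)^(1/p)`. -/
theorem supportFn_Zp {p : ℝ} (hp : 1 ≤ p) (K : Set (EuclideanSpace ℝ (Fin n)))
    (hK : IsCompact K) (θ : EuclideanSpace ℝ (Fin n)) :
    supportFn (Zp p K) θ = (∫ x in K, |⟪x, θ⟫| ^ p) ^ (1 / p) := by
  change _ = moment p K θ
  have h0 : 0 ≤ moment p K θ := by unfold moment; positivity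
  have hz : moment p K 0 = 0 := by simpa using moment_smul hp K 0 0
  suffices h : ∃ x ∈ Zp p K, ⟪x, θ⟫ = moment p K θ by
    obtain ⟨x, hx, e⟩ := h
    refine IsGreatest.csSup_eq ⟨⟨x, hx, e⟩, ?_⟩
    rintro _ ⟨y, hy, rfl⟩
    exact hy θ
  obtain ⟨g, hg, hgN⟩ := exists_extension_of_le_sublinear
    (LinearPMap.mkSpanSingleton' θ (moment p K θ) (by
      intro c hc
      rcases smul_eq_zero.1 hc with h | h
      · simp [h]
      · simp [h, hz]))
    (moment p K) (fun c hc x => by rw [moment_smul hp, abs_of_pos hc])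
    (moment_add_le hp K hK) (by
      rintro ⟨x, hx⟩
      obtain ⟨c, rfl⟩ := Submodule.mem_span_singleton.1 hx
      rw [LinearPMap.mkSpanSingleton'_apply, moment_smul hp, smul_eq_mul]
      exact mul_le_mul_of_nonneg_right (le_abs_self c) h0)
  refine ⟨(InnerProductSpace.toDual ℝ _).symm (LinearMap.toContinuousLinearMap g), ?_, ?_⟩
  · intro η
    simpa using hgN η
  · have h := (hg ⟨θ, Submodule.mem_span_singleton_self θ⟩).trans
      (LinearPMap.mkSpanSingleton'_apply_self _ _ _ _)
    simpa using h

end CentroidBody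

end

open CentroidBody

/-!
In polar coordinates `|C°| = (1/n) ∫ h_C⁻ⁿ dσ`, so both volumes are integrals over the sphere and
the theorem follows, by dominated convergence, from an expansion of `h_{Z_p(K)}(u)` as `p → ∞` with
bounds uniform in `u`. The moments `∫_K |⟪x, u⟫| ^ p dx` concentrate at the two points of `∂K` with
normals `±u`. Near such a point `K` is a paraboloid to second order, and under the rescaling
`(z, s) ↦ (z / √p, s / p)` Laplace's method yields a Gaussian integral over the tangent hyperplane,
whose determinant is the Gauss curvature.

The formula over `∂K` holds because the Gauss map carries `κ μ` to `σ`. Both measures are compared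
near a boundary point with the volume of the projection to the tangent hyperplane: the Gauss map is
there close to a linear map of determinant `κ`, and `σ` is read off from the volume of a thin
spherical shell, so no area formula for hypersurfaces is needed.
-/

noncomputable section

namespace CentroidBody

section Taylor

variable {E : Type*} [NormedAddCommGroup E] [NormedSpace ℝ E]

theorem isLittleO_taylor_two {φ : E → ℝ} {x₀ : E} {B : E →L[ℝ] E →L[ℝ] ℝ}
    (hφ : ∀ᶠ x in 𝓝 x₀, DifferentiableAt ℝ φ x) (hB : HasStrictFDerivAt (fderiv ℝ φ) B x₀) :
    (fun p : E × E => φ p.1 - φ p.2 - fderiv ℝ φ p.2 (p.1 - p.2)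
      - 1 / 2 * B (p.1 - p.2) (p.1 - p.2)) =o[𝓝 (x₀, x₀)] fun p => ‖p.1 - p.2‖ ^ 2 := by
  have hsymm : ∀ v w, B v w = B w v :=
    second_derivative_symmetric_of_eventually (hφ.mono fun x hx => hx.hasFDerivAt) hB.hasFDerivAt
  refine Asymptotics.isLittleO_iff.2 fun ε hε => ?_
  obtain ⟨r, hr, hball⟩ := Metric.eventually_nhds_iff_ball.1
    ((hB.isLittleO.bound hε).and (hφ.prod_inl_nhds x₀))
  filter_upwards [Metric.ball_mem_nhds (x₀, x₀) hr] with ⟨y, x⟩ hyx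
  simp only [← ball_prod_same, mem_prod] at hyx hball
  have hder : ∀ z ∈ segment ℝ x y, HasFDerivWithinAt
      (fun z => φ z - φ x - fderiv ℝ φ x (z - x) - 1 / 2 * B (z - x) (z - x))
      (fderiv ℝ φ z - fderiv ℝ φ x - B (z - x)) (segment ℝ x y) z := by
    intro z hz
    have hsub : HasFDerivAt (fun z => z - x) (.id ℝ E) z := (hasFDerivAt_id z).sub_const x
    have hquad := (B.hasFDerivAt.comp z hsub).clm_apply hsub
    have hφz := (hball (z, x) ⟨(convex_ball x₀ r).segment_subset hyx.2 hyx.1 hz, hyx.2⟩).2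
    refine (((hφz.hasFDerivAt.sub_const (φ x)).sub
      ((fderiv ℝ φ x).hasFDerivAt.comp z hsub)).sub
        (hquad.const_mul (1 / 2))).hasFDerivWithinAt.congr_fderiv ?_
    ext v
    simp [hsymm v]
    ring
  have hbound : ∀ z ∈ segment ℝ x y,
      ‖fderiv ℝ φ z - fderiv ℝ φ x - B (z - x)‖ ≤ ε * ‖y - x‖ := fun z hz =>
    (hball (z, x) ⟨(convex_ball x₀ r).segment_subset hyx.2 hyx.1 hz, hyx.2⟩).1.trans
      (by gcongr; exact norm_sub_le_of_mem_segment hz)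
  have hdiff := (convex_segment x y).norm_image_sub_le_of_norm_hasFDerivWithin_le hder hbound
    (left_mem_segment ℝ x y) (right_mem_segment ℝ x y)
  simpa [mul_assoc, pow_two] using hdiff

end Taylor

section Split

variable {E : Type*} [NormedAddCommGroup E] [InnerProductSpace ℝ E]

/-- The coordinates `(z, s) ↦ z - s u` on a Euclidean space given by a unit vector `u`. -/
def splitEquiv (u : E) (hu : ‖u‖ = 1) : ((ℝ ∙ u)ᗮ × ℝ) ≃ₗ[ℝ] E where
  toFun q := (q.1 : E) - q.2 • u
  map_add' p q := by simp only [Prod.fst_add, Prod.snd_add, Submodule.coe_add]; module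
  map_smul' c q := by
    simp only [Prod.smul_fst, Prod.smul_snd, Submodule.coe_smul, RingHom.id_apply, smul_eq_mul]
    module
  invFun v := ((ℝ ∙ u)ᗮ.orthogonalProjectionOnto v, -⟪u, v⟫)
  left_inv q := by
    have h : ⟪u, (q.1 : E)⟫ = 0 := Submodule.mem_orthogonal_singleton_iff_inner_right.1 q.1.2
    have hproj : (ℝ ∙ u)ᗮ.orthogonalProjectionOnto u = 0 :=
      Submodule.orthogonalProjectionOnto_orthogonalComplement_singleton_eq_zero u
    ext1
    · simp [hproj]
    · simp [inner_sub_right, inner_smul_right, h, hu]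
  right_inv v := by
    have := Submodule.starProjection_add_starProjection_orthogonal (K := ℝ ∙ u) v
    rw [Submodule.starProjection_unit_singleton ℝ hu] at this
    simp only [neg_smul, sub_neg_eq_add]
    rw [add_comm]
    exact this

@[simp]
theorem splitEquiv_apply (u : E) (hu : ‖u‖ = 1) (q : (ℝ ∙ u)ᗮ × ℝ) :
    splitEquiv u hu q = (q.1 : E) - q.2 • u := rfl

theorem norm_sq_splitEquiv (u : E) (hu : ‖u‖ = 1) (q : (ℝ ∙ u)ᗮ × ℝ) :
    ‖splitEquiv u hu q‖ ^ 2 = ‖q.1‖ ^ 2 + q.2 ^ 2 := by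
  have h : ⟪(q.1 : E), u⟫ = 0 := Submodule.mem_orthogonal_singleton_iff_inner_left.1 q.1.2
  rw [splitEquiv_apply, norm_sub_sq_real, inner_smul_right, h, norm_smul, hu]
  simp

theorem inner_splitEquiv (u : E) (hu : ‖u‖ = 1) (q : (ℝ ∙ u)ᗮ × ℝ) :
    ⟪splitEquiv u hu q, u⟫ = -q.2 := by
  have h : ⟪(q.1 : E), u⟫ = 0 := Submodule.mem_orthogonal_singleton_iff_inner_left.1 q.1.2
  rw [splitEquiv_apply, inner_sub_left, inner_smul_left, h]
  simp [hu]

variable [FiniteDimensional ℝ E]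

theorem continuous_splitEquiv (u : E) (hu : ‖u‖ = 1) : Continuous (splitEquiv u hu) :=
  (splitEquiv u hu).toContinuousLinearEquiv.continuous

theorem finrank_orthogonal_unit (u : E) (hu : ‖u‖ = 1) :
    Module.finrank ℝ (ℝ ∙ u)ᗮ + 1 = Module.finrank ℝ E := by
  have hu0 : u ≠ 0 := by rintro rfl; simp at hu
  have hadd := Submodule.finrank_add_finrank_orthogonal (ℝ ∙ u)
  rw [finrank_span_singleton hu0] at hadd
  omega

theorem det_eq_det_compression (u : E) (hu : ‖u‖ = 1) (L : E →ₗ[ℝ] E)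
    (T : (ℝ ∙ u)ᗮ →ₗ[ℝ] (ℝ ∙ u)ᗮ) (hT : ∀ z : (ℝ ∙ u)ᗮ, L z = T z) (hL : L u = u) :
    LinearMap.det L = LinearMap.det T := by
  have h : L = (splitEquiv u hu : ((ℝ ∙ u)ᗮ × ℝ) →ₗ[ℝ] E) ∘ₗ
      (LinearMap.prodMap T LinearMap.id) ∘ₗ ((splitEquiv u hu).symm : E →ₗ[ℝ] _) := by
    ext1 v
    obtain ⟨q, rfl⟩ := (splitEquiv u hu).surjective v
    have hs : (splitEquiv u hu).symm ((q.1 : E) - q.2 • u) = q :=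
      (splitEquiv u hu).symm_apply_apply q
    rw [splitEquiv_apply, LinearMap.comp_apply, LinearMap.comp_apply, LinearEquiv.coe_coe,
      LinearEquiv.coe_coe, hs, map_sub, map_smul, hT, hL]
    simp
  rw [h, LinearMap.det_conj, LinearMap.det_prodMap]
  simp

theorem measurePreserving_splitEquiv [MeasurableSpace E] [BorelSpace E] (u : E) (hu : ‖u‖ = 1) :
    MeasurePreserving (splitEquiv u hu) volume volume := by
  have hneg : MeasurePreserving (Prod.map (id : (ℝ ∙ u)ᗮ → (ℝ ∙ u)ᗮ) (fun s : ℝ => -s))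
      volume volume :=
    (MeasurePreserving.id volume).prod (Measure.measurePreserving_neg volume)
  have hspan : MeasurePreserving (Prod.map (id : (ℝ ∙ u)ᗮ → (ℝ ∙ u)ᗮ)
      (LinearIsometryEquiv.toSpanUnitSingleton u hu)) volume volume :=
    (MeasurePreserving.id volume).prod
      (LinearIsometryEquiv.toSpanUnitSingleton u hu).measurePreserving
  have hswap : MeasurePreserving (Prod.swap : (ℝ ∙ u)ᗮ × (ℝ ∙ u) → (ℝ ∙ u) × (ℝ ∙ u)ᗮ)
      volume volume := Measure.measurePreserving_swap
  have htoLp := WithLp.volume_preserving_toLp (ℝ ∙ u) (ℝ ∙ u)ᗮ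
  have hdecomp := (ℝ ∙ u).orthogonalDecomposition.symm.measurePreserving
  have hcomp := hdecomp.comp (htoLp.comp (hswap.comp (hspan.comp hneg)))
  refine (congrArg (fun f => MeasurePreserving f volume volume) (funext fun q => ?_)).mpr hcomp
  simp only [splitEquiv_apply, Function.comp_apply,
    Submodule.orthogonalDecomposition_symm_apply]
  rw [sub_eq_neg_add]
  simp

theorem measurableEmbedding_splitEquiv [MeasurableSpace E] [BorelSpace E] (u : E) (hu : ‖u‖ = 1) :
    MeasurableEmbedding (splitEquiv u hu) :=
  (splitEquiv u hu).toContinuousLinearEquiv.toHomeomorph.measurableEmbedding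

end Split

section Gaussian

theorem inner_apply_self_eq_sum_eigenvalues {F : Type*} [NormedAddCommGroup F]
    [InnerProductSpace ℝ F] [FiniteDimensional ℝ F] {T : F →ₗ[ℝ] F} (hT : T.IsSymmetric) {d : ℕ}
    (hd : Module.finrank ℝ F = d) (v : F) :
    ⟪T v, v⟫ = ∑ i, hT.eigenvalues hd i * (hT.eigenvectorBasis hd).repr v i ^ 2 := by
  rw [← (hT.eigenvectorBasis hd).repr.inner_map_map, PiLp.inner_apply]
  refine Finset.sum_congr rfl fun i _ => ?_
  rw [hT.eigenvectorBasis_apply_self_apply hd v i]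
  simp
  ring

theorem integral_exp_neg_sum_mul_sq {ι : Type*} [Fintype ι] (b : ι → ℝ) :
    ∫ y : EuclideanSpace ℝ ι, Real.exp (-∑ i, b i * y i ^ 2) = ∏ i, √(Real.pi / b i) := by
  simp_rw [← integral_gaussian, ← Finset.sum_neg_distrib, ← neg_mul, Real.exp_sum]
  rw [← integral_fintype_prod_volume_eq_prod,
    ← (PiLp.volume_preserving_ofLp ι).integral_comp
      (MeasurableEquiv.toLp 2 _).symm.measurableEmbedding]

variable {F : Type*} [NormedAddCommGroup F] [InnerProductSpace ℝ F] [FiniteDimensional ℝ F]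
  [MeasurableSpace F] [BorelSpace F]

theorem integral_exp_neg_inner_apply_self {T : F →ₗ[ℝ] F} (hT : T.IsPositive) :
    ∫ z : F, Real.exp (-⟪T z, z⟫) = √(Real.pi ^ Module.finrank ℝ F / LinearMap.det T) := by
  have hs := hT.isSymmetric
  set e := hs.eigenvectorBasis rfl
  calc ∫ z : F, Real.exp (-⟪T z, z⟫)
      = ∫ z : F, Real.exp (-∑ i, hs.eigenvalues rfl i * e.repr z i ^ 2) := by
        simp_rw [inner_apply_self_eq_sum_eigenvalues hs rfl, e]
    _ = ∏ i, √(Real.pi / hs.eigenvalues rfl i) := by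
        rw [← integral_exp_neg_sum_mul_sq,
          ← e.measurePreserving_repr.integral_comp e.repr.toHomeomorph.measurableEmbedding]
    _ = √(Real.pi ^ Module.finrank ℝ F / LinearMap.det T) := by
        rw [hs.det_eq_prod_eigenvalues rfl, ← Real.sqrt_prod]
        · simp [Finset.prod_div_distrib]
        · exact fun i _ => div_nonneg Real.pi_pos.le (hT.nonneg_eigenvalues rfl i)

theorem integrable_exp_neg_mul_norm_sq {b : ℝ} (hb : 0 < b) :
    Integrable fun z : F => Real.exp (-(b * ‖z‖ ^ 2)) := by
  have := (GaussianFourier.integrable_cexp_neg_mul_sq_norm_add (b := (b : ℂ)) (by simpa using hb) 0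
    (0 : F)).norm
  simpa [Complex.norm_exp, ← Complex.ofReal_pow] using this

end Gaussian

section Epigraph

variable {α : Type*} {q : α → ℝ} {h : ℝ}

theorem indicator_epigraph_comp_shear (w : α × ℝ) :
    indicator {w : α × ℝ | q w.1 ≤ w.2} (fun w => Real.exp (-(w.2 / h))) (w.1, q w.1 + w.2) =
      Real.exp (-(q w.1 / h)) * indicator (Ici 0) (fun s => Real.exp (-h⁻¹ * s)) w.2 := by
  simp only [indicator, mem_ofPred_eq, mem_Ici, le_add_iff_nonneg_right]
  split_ifs
  · rw [← Real.exp_add]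
    ring_nf
  · rw [mul_zero]

variable [MeasurableSpace α] {μ : Measure α}

theorem aestronglyMeasurable_indicator_epigraph (hq : Measurable q) :
    AEStronglyMeasurable (indicator {w : α × ℝ | q w.1 ≤ w.2} fun w => Real.exp (-(w.2 / h)))
      (μ.prod volume) :=
  (Measurable.indicator (by fun_prop)
    (measurableSet_le (by fun_prop) (by fun_prop))).aestronglyMeasurable

variable [SFinite μ]

theorem measurePreserving_shear (hq : Measurable q) :
    MeasurePreserving (fun w : α × ℝ => (w.1, q w.1 + w.2)) (μ.prod volume) (μ.prod volume) :=
  (MeasurePreserving.id μ).skew_product (by fun_prop)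
    (Eventually.of_forall fun z => (measurePreserving_add_left volume (q z)).map_eq)

theorem integrable_indicator_epigraph (hq : Measurable q) (hh : 0 < h)
    (hi : Integrable (fun z => Real.exp (-(q z / h))) μ) :
    Integrable (indicator {w : α × ℝ | q w.1 ≤ w.2} fun w => Real.exp (-(w.2 / h)))
      (μ.prod volume) := by
  rw [← (measurePreserving_shear hq).integrable_comp (aestronglyMeasurable_indicator_epigraph hq)]
  simp only [Function.comp_def, indicator_epigraph_comp_shear]
  refine hi.mul_prod ?_
  rw [integrable_indicator_iff measurableSet_Ici, integrableOn_Ici_iff_integrableOn_Ioi]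
  exact integrableOn_exp_mul_Ioi (by simpa using hh) _

theorem integral_indicator_epigraph (hq : Measurable q) (hh : 0 < h) :
    ∫ w, indicator {w : α × ℝ | q w.1 ≤ w.2} (fun w => Real.exp (-(w.2 / h))) w
      ∂(μ.prod volume) = h * ∫ z, Real.exp (-(q z / h)) ∂μ := by
  have hm := aestronglyMeasurable_indicator_epigraph (μ := μ) (h := h) hq
  rw [← (measurePreserving_shear hq).map_eq] at hm ⊢
  rw [integral_map (by fun_prop) hm]
  simp only [indicator_epigraph_comp_shear]
  rw [integral_prod_mul (fun z => Real.exp (-(q z / h)))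
      (indicator (Ici 0) fun s => Real.exp (-h⁻¹ * s)), integral_indicator measurableSet_Ici,
    integral_Ici_eq_integral_Ioi,
    integral_exp_mul_Ioi (by simpa using hh), mul_comm]
  simp

end Epigraph

section LocalDefiningFunctions

theorem exists_curve_of_hasStrictFDerivAt {E : Type*} [NormedAddCommGroup E] [NormedSpace ℝ E]
    [CompleteSpace E] {f : E → ℝ} {f' : E →L[ℝ] ℝ} {x v : E} (hf : HasStrictFDerivAt f f' x)
    (hf' : f' ≠ 0) (hv : f' v = 0) :
    ∃ γ : ℝ → E, γ 0 = x ∧ HasDerivAt γ v 0 ∧ ∀ᶠ t in 𝓝 0, f (γ t) = f x := by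
  have hr : f'.range = ⊤ := LinearMap.range_eq_top.2 <|
    LinearMap.surjective (f := (f' : E →ₗ[ℝ] ℝ)) fun h => hf' (ContinuousLinearMap.coe_injective h)
  set w : f'.ker := ⟨v, hv⟩
  have hw : HasDerivAt (fun t : ℝ => t • w) w 0 := by
    simpa using (hasDerivAt_id (0 : ℝ)).smul_const w
  refine ⟨fun t => hf.implicitFunction f f' hr (f x) (t • w), ?_, ?_, ?_⟩
  · simp [hf.implicitFunction_apply_image hr]
  · exact (hf.to_implicitFunction hr).hasFDerivAt.comp_hasDerivAt_of_eq 0 hw (by simp)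
  · have hlim : Tendsto (fun t : ℝ => (f x, t • w)) (𝓝 0) (𝓝 (f x, 0)) :=
      tendsto_const_nhds.prodMk_nhds (by simpa using hw.continuousAt.tendsto)
    exact hlim.eventually (hf.map_implicitFunction_eq hr)

variable {E : Type*} [NormedAddCommGroup E] [InnerProductSpace ℝ E]

/-- On the open set `U`, the set `K` is `{φ ≤ 0}` for a `C^2` function without critical points. -/
structure IsLocalDefiningFn (K U : Set E) (φ : E → ℝ) : Prop where
  isOpen : IsOpen U
  contDiffOn : ContDiffOn ℝ 2 φ U
  fderiv_ne : ∀ x ∈ U, fderiv ℝ φ x ≠ 0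
  inter_eq : K ∩ U = {y ∈ U | φ y ≤ 0}

/-- The normalized gradient of `φ`; it extends the Gauss map of a set with local defining function
`φ` off the boundary. -/
def unitGradient [CompleteSpace E] (φ : E → ℝ) (x : E) : E :=
  ‖gradient φ x‖⁻¹ • gradient φ x

namespace IsLocalDefiningFn

variable {K U : Set E} {φ : E → ℝ} {x : E}

theorem contDiffAt (h : IsLocalDefiningFn K U φ) (hx : x ∈ U) : ContDiffAt ℝ 2 φ x :=
  h.contDiffOn.contDiffAt (h.isOpen.mem_nhds hx)

theorem hasStrictFDerivAt (h : IsLocalDefiningFn K U φ) (hx : x ∈ U) :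
    HasStrictFDerivAt φ (fderiv ℝ φ x) x :=
  (h.contDiffAt hx).hasStrictFDerivAt (by norm_num)

theorem hasStrictFDerivAt_fderiv (h : IsLocalDefiningFn K U φ) (hx : x ∈ U) :
    HasStrictFDerivAt (fderiv ℝ φ) (fderiv ℝ (fderiv ℝ φ) x) x :=
  ((h.contDiffAt hx).fderiv_right (m := 1) (by norm_num)).hasStrictFDerivAt (by norm_num)

theorem mem_iff (h : IsLocalDefiningFn K U φ) (hx : x ∈ U) : x ∈ K ↔ φ x ≤ 0 := by
  simpa [hx] using Set.ext_iff.1 h.inter_eq x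

theorem apply_eq_zero (h : IsLocalDefiningFn K U φ) (hc : IsClosed K) (hx : x ∈ U)
    (hxK : x ∈ frontier K) : φ x = 0 := by
  refine le_antisymm ((h.mem_iff hx).1 (hc.frontier_subset hxK)) (not_lt.1 fun hlt => hxK.2 ?_)
  rw [mem_interior_iff_mem_nhds]
  filter_upwards [(h.contDiffAt hx).continuousAt.eventually_lt continuousAt_const hlt,
    h.isOpen.mem_nhds hx] with y hy hyU
  exact (h.mem_iff hyU).2 hy.le

theorem mem_frontier (h : IsLocalDefiningFn K U φ) (hx : x ∈ U) (h0 : φ x = 0) :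
    x ∈ frontier K := by
  refine ⟨subset_closure ((h.mem_iff hx).2 h0.le), fun hint => h.fderiv_ne x hx ?_⟩
  have hmax : IsLocalMax φ x := by
    filter_upwards [mem_interior_iff_mem_nhds.1 hint, h.isOpen.mem_nhds hx] with y hyK hyU
    exact ((h.mem_iff hyU).1 hyK).trans h0.ge
  exact hmax.fderiv_eq_zero

theorem exists_curve [CompleteSpace E] (h : IsLocalDefiningFn K U φ) (hc : IsClosed K) (hx : x ∈ U)
    (hxK : x ∈ frontier K) {v : E} (hv : fderiv ℝ φ x v = 0) :
    ∃ γ : ℝ → E, γ 0 = x ∧ HasDerivAt γ v 0 ∧ ∀ᶠ t in 𝓝 0, γ t ∈ frontier K := by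
  obtain ⟨γ, hγ0, hγ, hφγ⟩ :=
    exists_curve_of_hasStrictFDerivAt (h.hasStrictFDerivAt hx) (h.fderiv_ne x hx) hv
  refine ⟨γ, hγ0, hγ, ?_⟩
  have hγU := hγ.continuousAt.eventually (h.isOpen.mem_nhds (hγ0.symm ▸ hx))
  filter_upwards [hφγ, hγU] with t ht htU
  exact h.mem_frontier htU (ht.trans (h.apply_eq_zero hc hx hxK))

theorem fderiv_sub_nonpos (h : IsLocalDefiningFn K U φ) (hc : IsClosed K) (hK : Convex ℝ K)
    (hx : x ∈ U) (hxK : x ∈ frontier K) {y : E} (hy : y ∈ K) : fderiv ℝ φ x (y - x) ≤ 0 := by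
  have hmax : IsLocalMaxOn φ K x := by
    filter_upwards [mem_nhdsWithin_of_mem_nhds (h.isOpen.mem_nhds hx), self_mem_nhdsWithin]
      with z hzU hzK
    exact ((h.mem_iff hzU).1 hzK).trans (h.apply_eq_zero hc hx hxK).ge
  exact hmax.hasFDerivWithinAt_nonpos (h.hasStrictFDerivAt hx).hasFDerivAt.hasFDerivWithinAt
    (sub_mem_posTangentConeAt_of_segment_subset
      (hK.segment_subset (hc.frontier_subset hxK) hy))

theorem eventually_mem_of_fderiv_neg (h : IsLocalDefiningFn K U φ) (hc : IsClosed K) (hx : x ∈ U)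
    (hxK : x ∈ frontier K) {v : E} (hv : fderiv ℝ φ x v < 0) :
    ∀ᶠ t : ℝ in 𝓝[>] 0, x + t • v ∈ K := by
  have hderiv : HasDerivAt (fun t : ℝ => φ (x + t • v)) (fderiv ℝ φ x v) 0 :=
    (h.hasStrictFDerivAt hx).hasFDerivAt.hasLineDerivAt v
  have hline : ContinuousAt (fun t : ℝ => x + t • v) 0 := by fun_prop
  have hU := hline.eventually (h.isOpen.mem_nhds (by simpa using hx))
  have hneg := eventually_nhdsWithin_sign_eq_of_deriv_neg (hderiv.deriv ▸ hv)
    (by simpa using h.apply_eq_zero hc hx hxK)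
  filter_upwards [nhdsWithin_le_nhds hU, nhdsWithin_le_nhds hneg,
    self_mem_nhdsWithin] with t htU ht (ht0 : 0 < t)
  rw [zero_sub, sign_neg (neg_lt_zero.2 ht0), sign_eq_neg_one_iff] at ht
  exact (h.mem_iff htU).2 ht.le

variable [CompleteSpace E]

theorem gradient_ne (h : IsLocalDefiningFn K U φ) (hx : x ∈ U) : gradient φ x ≠ 0 :=
  fun h0 => h.fderiv_ne x hx (by simpa [gradient] using h0)

theorem norm_gradient_pos (h : IsLocalDefiningFn K U φ) (hx : x ∈ U) : 0 < ‖gradient φ x‖ :=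
  norm_pos_iff.2 (h.gradient_ne hx)

theorem norm_unitGradient (h : IsLocalDefiningFn K U φ) (hx : x ∈ U) : ‖unitGradient φ x‖ = 1 :=
  norm_smul_inv_norm (𝕜 := ℝ) (h.gradient_ne hx)

theorem fderiv_apply (h : IsLocalDefiningFn K U φ) (hx : x ∈ U) (v : E) :
    fderiv ℝ φ x v = ‖gradient φ x‖ * ⟪unitGradient φ x, v⟫ := by
  rw [unitGradient, real_inner_smul_left, mul_inv_cancel_left₀ (h.norm_gradient_pos hx).ne']
  simp [gradient]

theorem fderiv_apply_eq_zero (h : IsLocalDefiningFn K U φ) (hx : x ∈ U) {v : E}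
    (hv : ⟪unitGradient φ x, v⟫ = 0) : fderiv ℝ φ x v = 0 := by
  rw [h.fderiv_apply hx, hv, mul_zero]

theorem contDiffOn_gradient (h : IsLocalDefiningFn K U φ) : ContDiffOn ℝ 1 (gradient φ) U :=
  (InnerProductSpace.toDual ℝ _).symm.contDiff.comp_contDiffOn
    (h.contDiffOn.fderiv_of_isOpen h.isOpen (by norm_num))

theorem contDiffOn_norm_gradient (h : IsLocalDefiningFn K U φ) :
    ContDiffOn ℝ 1 (fun y => ‖gradient φ y‖) U :=
  h.contDiffOn_gradient.norm ℝ fun _ hx => h.gradient_ne hx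

theorem contDiffOn_unitGradient (h : IsLocalDefiningFn K U φ) :
    ContDiffOn ℝ 1 (unitGradient φ) U :=
  (h.contDiffOn_norm_gradient.inv fun _ hx => (h.norm_gradient_pos hx).ne').smul
    h.contDiffOn_gradient

theorem hasStrictFDerivAt_unitGradient (h : IsLocalDefiningFn K U φ) (hx : x ∈ U) :
    HasStrictFDerivAt (unitGradient φ) (fderiv ℝ (unitGradient φ) x) x :=
  (h.contDiffOn_unitGradient.contDiffAt (h.isOpen.mem_nhds hx)).hasStrictFDerivAt (by norm_num)

theorem eq_unitGradient (h : IsLocalDefiningFn K U φ) (hc : IsClosed K) (hx : x ∈ U)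
    (hxK : x ∈ frontier K) {u : E} (hu : ‖u‖ = 1) (hsup : ∀ y ∈ K, ⟪y, u⟫ ≤ ⟪x, u⟫) :
    u = unitGradient φ x := by
  have hN := h.norm_unitGradient hx
  by_contra hne
  have hlt : ⟪unitGradient φ x, u⟫ < 1 :=
    (inner_lt_one_iff_real_of_norm_eq_one hN hu).2 (Ne.symm hne)
  have hneg : fderiv ℝ φ x (u - unitGradient φ x) < 0 := by
    rw [h.fderiv_apply hx, inner_sub_right, real_inner_self_eq_norm_sq, hN]
    exact mul_neg_of_pos_of_neg (h.norm_gradient_pos hx) (by linarith)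
  obtain ⟨t, htK, ht0 : 0 < t⟩ :=
    ((h.eventually_mem_of_fderiv_neg hc hx hxK hneg).and eventually_mem_nhdsWithin).exists
  have hle := hsup _ htK
  rw [inner_add_left, real_inner_smul_left, inner_sub_left, real_inner_self_eq_norm_sq, hu] at hle
  nlinarith

theorem inner_unitGradient_le (h : IsLocalDefiningFn K U φ) (hc : IsClosed K) (hK : Convex ℝ K)
    (hx : x ∈ U) (hxK : x ∈ frontier K) {y : E} (hy : y ∈ K) :
    ⟪y, unitGradient φ x⟫ ≤ ⟪x, unitGradient φ x⟫ := by
  have hle := h.fderiv_sub_nonpos hc hK hx hxK hy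
  rw [h.fderiv_apply hx] at hle
  have := nonpos_of_mul_nonpos_right hle (h.norm_gradient_pos hx)
  rwa [inner_sub_right, sub_nonpos, real_inner_comm, real_inner_comm x] at this

theorem inner_fderiv_unitGradient (h : IsLocalDefiningFn K U φ) (hx : x ∈ U) (v : E) :
    ⟪unitGradient φ x, fderiv ℝ (unitGradient φ) x v⟫ = 0 := by
  have hN := (h.hasStrictFDerivAt_unitGradient hx).hasFDerivAt.hasLineDerivAt v
  have hconst : HasDerivAt (fun t : ℝ => ‖unitGradient φ (x + t • v)‖ ^ 2) 0 0 := by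
    have hline : ContinuousAt (fun t : ℝ => x + t • v) 0 := by fun_prop
    refine (hasDerivAt_const (0 : ℝ) (1 : ℝ)).congr_of_eventuallyEq ?_
    filter_upwards [hline.eventually (h.isOpen.mem_nhds (by simpa using hx))] with t ht
    rw [h.norm_unitGradient ht, one_pow]
  simpa using (HasDerivAt.norm_sq hN).unique hconst

theorem fderiv_fderiv_apply (h : IsLocalDefiningFn K U φ) (hx : x ∈ U) (v : E) {w : E}
    (hw : ⟪unitGradient φ x, w⟫ = 0) :
    fderiv ℝ (fderiv ℝ φ) x v w = ‖gradient φ x‖ * ⟪fderiv ℝ (unitGradient φ) x v, w⟫ := by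
  have hderiv := (ContinuousLinearMap.apply ℝ ℝ w).hasFDerivAt.comp x
    (h.hasStrictFDerivAt_fderiv hx).hasFDerivAt
  have hnorm : DifferentiableAt ℝ (fun y => ‖gradient φ y‖) x :=
    (h.contDiffOn_norm_gradient.contDiffAt (h.isOpen.mem_nhds hx)).differentiableAt (by norm_num)
  have hprod := hnorm.hasFDerivAt.mul
    ((h.hasStrictFDerivAt_unitGradient hx).hasFDerivAt.inner ℝ (hasFDerivAt_const w x))
  have heq : (fun y => fderiv ℝ φ y w) =ᶠ[𝓝 x] fun y => ‖gradient φ y‖ * ⟪unitGradient φ y, w⟫ := by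
    filter_upwards [h.isOpen.mem_nhds hx] with y hy using h.fderiv_apply hy w
  simpa [hw] using congrArg (fun T => T v) (hderiv.unique (hprod.congr_of_eventuallyEq heq))

theorem isLittleO_taylor (h : IsLocalDefiningFn K U φ) (hx : x ∈ U) :
    (fun p : E × E => φ p.1 - φ p.2 - ‖gradient φ p.2‖ * ⟪unitGradient φ p.2, p.1 - p.2⟫
      - 1 / 2 * fderiv ℝ (fderiv ℝ φ) x (p.1 - p.2) (p.1 - p.2))
      =o[𝓝 (x, x)] fun p => ‖p.1 - p.2‖ ^ 2 := by
  have hU := h.isOpen.mem_nhds hx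
  have htaylor := isLittleO_taylor_two
    (by filter_upwards [hU] with y hy using (h.hasStrictFDerivAt hy).differentiableAt)
    (h.hasStrictFDerivAt_fderiv hx)
  refine htaylor.congr' ?_ .rfl
  filter_upwards [continuous_snd.continuousAt.eventually hU] with p hp
  rw [h.fderiv_apply hp]

end IsLocalDefiningFn

end LocalDefiningFunctions

section GaussMap

variable {n : ℕ} {K U : Set (EuclideanSpace ℝ (Fin n))} {φ : EuclideanSpace ℝ (Fin n) → ℝ}
  {x : EuclideanSpace ℝ (Fin n)}

theorem HasC2Boundary.exists_isLocalDefiningFn (hK : HasC2Boundary K) (hx : x ∈ frontier K) :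
    ∃ U φ, x ∈ U ∧ IsLocalDefiningFn K U φ := by
  obtain ⟨U, φ, hU, hxU, hφ, hd, he⟩ := hK x hx
  have hc : ContinuousOn (fderiv ℝ φ) U := hφ.continuousOn_fderiv_of_isOpen hU (by norm_num)
  refine ⟨U ∩ fderiv ℝ φ ⁻¹' {0}ᶜ, φ, ⟨hxU, hd⟩,
    hc.isOpen_inter_preimage hU isOpen_compl_singleton, hφ.mono inter_subset_left,
    fun y hy => hy.2, ?_⟩
  rw [← inter_assoc, he]
  ext y
  simp only [mem_inter_iff, mem_ofPred_eq]
  tauto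

namespace IsLocalDefiningFn

theorem outerNormal_eq (h : IsLocalDefiningFn K U φ) (hc : IsClosed K) (hK : Convex ℝ K)
    (hx : x ∈ U) (hxK : x ∈ frontier K) : outerNormal K x = unitGradient φ x := by
  obtain ⟨hnorm, hsup⟩ :=
    Classical.epsilon_spec (p := fun u => ‖u‖ = 1 ∧ ∀ y ∈ K, ⟪y, u⟫ ≤ ⟪x, u⟫)
      ⟨unitGradient φ x, h.norm_unitGradient hx, fun y => h.inner_unitGradient_le hc hK hx hxK⟩
  exact h.eq_unitGradient hc hx hxK hnorm hsup

theorem hasFDerivWithinAt_outerNormal (h : IsLocalDefiningFn K U φ) (hc : IsClosed K)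
    (hK : Convex ℝ K) (hx : x ∈ U) (hxK : x ∈ frontier K) :
    HasFDerivWithinAt (outerNormal K) (fderiv ℝ (unitGradient φ) x) (frontier K) x := by
  refine (h.hasStrictFDerivAt_unitGradient hx).hasFDerivAt.hasFDerivWithinAt.congr_of_eventuallyEq
    ?_ (h.outerNormal_eq hc hK hx hxK)
  filter_upwards [mem_nhdsWithin_of_mem_nhds (h.isOpen.mem_nhds hx), self_mem_nhdsWithin]
    with y hyU hy
  exact h.outerNormal_eq hc hK hyU hy

-- The frontier is not a set of unique differentiability, but tangential derivatives are unique.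
theorem fderivWithin_outerNormal_apply (h : IsLocalDefiningFn K U φ) (hc : IsClosed K)
    (hK : Convex ℝ K) (hx : x ∈ U) (hxK : x ∈ frontier K) {v : EuclideanSpace ℝ (Fin n)}
    (hv : ⟪unitGradient φ x, v⟫ = 0) :
    fderivWithin ℝ (outerNormal K) (frontier K) x v = fderiv ℝ (unitGradient φ) x v := by
  obtain ⟨γ, hγ0, hγ, hγK⟩ := h.exists_curve hc hx hxK (h.fderiv_apply_eq_zero hx hv)
  have hD := h.hasFDerivWithinAt_outerNormal hc hK hx hxK
  exact (hD.differentiableWithinAt.hasFDerivWithinAt.comp_hasDerivAt_of_eq 0 hγ hγK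
    hγ0.symm).unique (hD.comp_hasDerivAt_of_eq 0 hγ hγK hγ0.symm)

-- The Gauss map of a convex set is monotone, hence so is its differential.
theorem inner_fderiv_unitGradient_nonneg (h : IsLocalDefiningFn K U φ) (hc : IsClosed K)
    (hK : Convex ℝ K) (hx : x ∈ U) (hxK : x ∈ frontier K) {v : EuclideanSpace ℝ (Fin n)}
    (hv : ⟪unitGradient φ x, v⟫ = 0) : 0 ≤ ⟪fderiv ℝ (unitGradient φ) x v, v⟫ := by
  obtain ⟨γ, hγ0, hγ, hγK⟩ := h.exists_curve hc hx hxK (h.fderiv_apply_eq_zero hx hv)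
  have hN := (h.hasStrictFDerivAt_unitGradient hx).hasFDerivAt.comp_hasDerivAt_of_eq 0 hγ hγ0.symm
  have hγU := hγ.continuousAt.eventually (h.isOpen.mem_nhds (hγ0.symm ▸ hx))
  refine ge_of_tendsto (hN.tendsto_slope.inner hγ.tendsto_slope) (nhdsWithin_le_nhds ?_)
  filter_upwards [hγU, hγK] with t htU htK
  have hx_le := h.inner_unitGradient_le hc hK htU htK (hc.frontier_subset hxK)
  have ht_le := h.inner_unitGradient_le hc hK hx hxK (hc.frontier_subset htK)
  have hmono : 0 ≤ ⟪unitGradient φ (γ t) - unitGradient φ x, γ t - x⟫ := by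
    simp only [inner_sub_right, real_inner_comm (γ t), real_inner_comm x]
    linarith
  simp only [slope_def_module, Function.comp_apply, hγ0, real_inner_smul_left,
    real_inner_smul_right, ← mul_assoc]
  exact mul_nonneg (mul_self_nonneg _) hmono

theorem weingarten_apply (h : IsLocalDefiningFn K U φ) (hc : IsClosed K) (hK : Convex ℝ K)
    (hx : x ∈ U) (hxK : x ∈ frontier K) (v : (ℝ ∙ outerNormal K x)ᗮ) :
    (weingarten K x v : EuclideanSpace ℝ (Fin n)) = fderiv ℝ (unitGradient φ) x v := by
  have hN := h.outerNormal_eq hc hK hx hxK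
  have hv : ⟪unitGradient φ x, (v : EuclideanSpace ℝ (Fin n))⟫ = 0 :=
    hN ▸ Submodule.mem_orthogonal_singleton_iff_inner_right.1 v.2
  have hmem : fderiv ℝ (unitGradient φ) x v ∈ (ℝ ∙ outerNormal K x)ᗮ := by
    rw [Submodule.mem_orthogonal_singleton_iff_inner_right]
    exact (congrArg (⟪·, _⟫) hN).trans (h.inner_fderiv_unitGradient hx v)
  change (ℝ ∙ outerNormal K x)ᗮ.starProjection
    (fderivWithin ℝ (outerNormal K) (frontier K) x v) = _
  rw [h.fderivWithin_outerNormal_apply hc hK hx hxK hv]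
  exact Submodule.starProjection_eq_self_iff.2 hmem

theorem inner_weingarten (h : IsLocalDefiningFn K U φ) (hc : IsClosed K) (hK : Convex ℝ K)
    (hx : x ∈ U) (hxK : x ∈ frontier K) (v w : (ℝ ∙ outerNormal K x)ᗮ) :
    fderiv ℝ (fderiv ℝ φ) x v w = ‖gradient φ x‖ * ⟪weingarten K x v, w⟫ := by
  have hw : ⟪unitGradient φ x, (w : EuclideanSpace ℝ (Fin n))⟫ = 0 :=
    h.outerNormal_eq hc hK hx hxK ▸ Submodule.mem_orthogonal_singleton_iff_inner_right.1 w.2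
  rw [h.fderiv_fderiv_apply hx v hw, ← h.weingarten_apply hc hK hx hxK, Submodule.coe_inner]

theorem isSymmetric_weingarten (h : IsLocalDefiningFn K U φ) (hc : IsClosed K)
    (hK : Convex ℝ K) (hx : x ∈ U) (hxK : x ∈ frontier K) : (weingarten K x).IsSymmetric := by
  intro v w
  have hs : IsSymmSndFDerivAt ℝ φ x := (h.contDiffAt hx).isSymmSndFDerivAt (by simp)
  refine mul_left_cancel₀ (h.norm_gradient_pos hx).ne' ?_
  rw [← h.inner_weingarten hc hK hx hxK, real_inner_comm, ← h.inner_weingarten hc hK hx hxK]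
  exact hs.eq _ _

theorem isPositive_weingarten (h : IsLocalDefiningFn K U φ) (hc : IsClosed K)
    (hK : Convex ℝ K) (hx : x ∈ U) (hxK : x ∈ frontier K) : (weingarten K x).IsPositive := by
  refine ⟨h.isSymmetric_weingarten hc hK hx hxK, fun v => ?_⟩
  have hv : ⟪unitGradient φ x, (v : EuclideanSpace ℝ (Fin n))⟫ = 0 :=
    h.outerNormal_eq hc hK hx hxK ▸ Submodule.mem_orthogonal_singleton_iff_inner_right.1 v.2
  simpa [Submodule.coe_inner, h.weingarten_apply hc hK hx hxK] using
    h.inner_fderiv_unitGradient_nonneg hc hK hx hxK hv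

end IsLocalDefiningFn

end GaussMap

section QuadraticForms

variable {E : Type*} [NormedAddCommGroup E] [InnerProductSpace ℝ E]

theorem mul_norm_sq_le_add_mul_abs_inner (B : E →L[ℝ] E →L[ℝ] ℝ) {u : E} (hu : ‖u‖ = 1) {b : ℝ}
    (hb : 0 ≤ b) (hB : ∀ v, ⟪u, v⟫ = 0 → b * ‖v‖ ^ 2 ≤ B v v) (w : E) :
    b * ‖w‖ ^ 2 ≤ B w w + (2 * ‖B‖ + b) * (‖w‖ * |⟪u, w⟫|) := by
  set a := ⟪u, w⟫
  set v := w - a • u with hv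
  have huv : ⟪u, v⟫ = 0 := by
    rw [hv, inner_sub_right, inner_smul_right, real_inner_self_eq_norm_sq, hu]
    simp [a]
  have ha : |a| ≤ ‖w‖ := by simpa [hu] using abs_real_inner_le_norm u w
  have hw : w = v + a • u := by simp [hv]
  have hnorm : ‖w‖ ^ 2 = ‖v‖ ^ 2 + a ^ 2 := by
    rw [hw, norm_add_sq_real, inner_smul_right, real_inner_comm, huv, norm_smul, hu]
    simp
  have hvw : ‖v‖ ≤ ‖w‖ := (sq_le_sq₀ (norm_nonneg _) (norm_nonneg _)).1 (by nlinarith)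
  have hexp : B w w = B v v + a * B v u + a * B u w := by
    nth_rw 1 [hw]
    rw [map_add, add_apply, map_smul, smul_apply, smul_eq_mul]
    nth_rw 1 [hw]
    rw [map_add, map_smul, smul_eq_mul]
  have hvu : |a * B v u| ≤ |a| * (‖B‖ * ‖w‖) := by
    rw [abs_mul]
    gcongr
    exact (B.le_opNorm₂ v u).trans (by rw [hu, mul_one]; gcongr)
  have huw : |a * B u w| ≤ |a| * (‖B‖ * ‖w‖) := by
    rw [abs_mul]
    gcongr
    simpa [hu] using B.le_opNorm₂ u w
  have hasq : a ^ 2 ≤ ‖w‖ * |a| := by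
    rw [← sq_abs, sq]
    gcongr
  have hBv := hB v huv
  rw [hexp]
  nlinarith [neg_le_of_abs_le hvu, neg_le_of_abs_le huw]

theorem exists_pos_mul_norm_sq_le_inner [FiniteDimensional ℝ E] {T : E →ₗ[ℝ] E}
    (hT : T.IsPositive) (hdet : LinearMap.det T ≠ 0) :
    ∃ c > 0, ∀ v, c * ‖v‖ ^ 2 ≤ ⟪T v, v⟫ := by
  have hpos : ∀ i, 0 < hT.isSymmetric.eigenvalues rfl i := fun i =>
    (hT.nonneg_eigenvalues rfl i).lt_of_ne' fun h0 => hdet <| by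
      rw [hT.isSymmetric.det_eq_prod_eigenvalues rfl]
      exact Finset.prod_eq_zero (Finset.mem_univ i) (by simpa using h0)
  have hle : ∀ᶠ c in 𝓝[>] (0 : ℝ), ∀ i, c ≤ hT.isSymmetric.eigenvalues rfl i :=
    nhdsWithin_le_nhds (eventually_all.2 fun i => eventually_le_nhds (hpos i))
  obtain ⟨c, hc, hc0 : 0 < c⟩ := (hle.and self_mem_nhdsWithin).exists
  refine ⟨c, hc0, fun v => ?_⟩
  rw [inner_apply_self_eq_sum_eigenvalues hT.isSymmetric rfl,
    ← (hT.isSymmetric.eigenvectorBasis rfl).sum_sq_norm_inner_right, Finset.mul_sum]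
  refine Finset.sum_le_sum fun i _ => ?_
  rw [OrthonormalBasis.repr_apply_apply, Real.norm_eq_abs, sq_abs]
  gcongr
  exact hc i

end QuadraticForms

section Compactness

theorem exists_pos_forall_of_isCompact {α : Type*} [TopologicalSpace α] {s : Set α}
    (hs : IsCompact s) {P : ℝ → α → Prop}
    (hP : ∀ c c' y, 0 < c' → c' ≤ c → P c y → P c' y)
    (hloc : ∀ x ∈ s, ∃ c > 0, ∀ᶠ y in 𝓝[s] x, P c y) : ∃ c > 0, ∀ y ∈ s, P c y := by
  refine hs.induction_on (p := fun t => ∃ c > 0, ∀ y ∈ t, P c y) ⟨1, one_pos, by simp⟩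
    (fun _ _ hst ⟨c, hc, h⟩ => ⟨c, hc, fun y hy => h y (hst hy)⟩) ?_
    fun x hx => (hloc x hx).elim fun c ⟨hc, h⟩ => ⟨_, h, c, hc, fun y hy => hy⟩
  rintro t t' ⟨c, hc, h⟩ ⟨c', hc', h'⟩
  refine ⟨min c c', lt_min hc hc', fun y hy => hy.elim (fun hy => ?_) fun hy => ?_⟩
  · exact hP _ _ y (lt_min hc hc') (min_le_left _ _) (h y hy)
  · exact hP _ _ y (lt_min hc hc') (min_le_right _ _) (h' y hy)

end Compactness

section ShapeOperator

variable {E : Type*} [NormedAddCommGroup E] [InnerProductSpace ℝ E] [CompleteSpace E]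

/-- The extension of the Weingarten map of `{φ ≤ 0}` at `x` by the identity on the normal line. -/
def shapeOperator (φ : E → ℝ) (x : E) : E →L[ℝ] E :=
  (fderiv ℝ (unitGradient φ) x) ∘L
    (ContinuousLinearMap.id ℝ _ - (innerSL ℝ (unitGradient φ x)).smulRight (unitGradient φ x)) +
    (innerSL ℝ (unitGradient φ x)).smulRight (unitGradient φ x)

theorem shapeOperator_apply (φ : E → ℝ) (x v : E) :
    shapeOperator φ x v =
      fderiv ℝ (unitGradient φ) x (v - ⟪unitGradient φ x, v⟫ • unitGradient φ x) +
        ⟪unitGradient φ x, v⟫ • unitGradient φ x := by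
  simp [shapeOperator]

theorem IsLocalDefiningFn.continuousOn_shapeOperator {K U : Set E} {φ : E → ℝ}
    (h : IsLocalDefiningFn K U φ) : ContinuousOn (shapeOperator φ) U := by
  have hN : ContinuousOn (unitGradient φ) U := h.contDiffOn_unitGradient.continuousOn
  have hproj : ContinuousOn
      (fun y => (innerSL ℝ (unitGradient φ y)).smulRight (unitGradient φ y)) U :=
    ((ContinuousLinearMap.smulRightL ℝ E E).continuous.comp_continuousOn
      ((innerSL ℝ).continuous.comp_continuousOn hN)).clm_apply hN
  exact ((h.contDiffOn_unitGradient.continuousOn_fderiv_of_isOpen h.isOpen le_rfl).clm_comp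
    (continuousOn_const.sub hproj)).add hproj

end ShapeOperator

section TouchingBalls

variable {E : Type*} [NormedAddCommGroup E] [InnerProductSpace ℝ E] [CompleteSpace E]
  {K U : Set E} {φ : E → ℝ} {x : E}

namespace IsLocalDefiningFn

theorem continuousAt_norm_gradient (h : IsLocalDefiningFn K U φ) (hx : x ∈ U) :
    ContinuousAt (fun y => ‖gradient φ y‖) x :=
  h.contDiffOn_norm_gradient.continuousOn.continuousAt (h.isOpen.mem_nhds hx)

theorem continuousAt_unitGradient (h : IsLocalDefiningFn K U φ) (hx : x ∈ U) :
    ContinuousAt (unitGradient φ) x :=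
  (h.hasStrictFDerivAt_unitGradient hx).continuousAt

theorem eventually_abs_taylor_le (h : IsLocalDefiningFn K U φ) (hc : IsClosed K) (hx : x ∈ U)
    {ε : ℝ} (hε : 0 < ε) :
    ∀ᶠ p in 𝓝 (x, x), p.2 ∈ frontier K →
      |φ p.1 + ‖gradient φ p.2‖ * ⟪p.2 - p.1, unitGradient φ p.2⟫
        - 1 / 2 * fderiv ℝ (fderiv ℝ φ) x (p.1 - p.2) (p.1 - p.2)| ≤ ε * ‖p.1 - p.2‖ ^ 2 := by
  filter_upwards [(h.isLittleO_taylor hx).def hε,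
    continuous_snd.continuousAt.eventually (h.isOpen.mem_nhds hx)] with p hp hpU hpK
  rw [h.apply_eq_zero hc hpU hpK, ← neg_sub p.2 p.1, inner_neg_right, neg_sub,
    real_inner_comm, Real.norm_eq_abs, Real.norm_of_nonneg (sq_nonneg _)] at hp
  simpa using hp

theorem exists_eventually_mul_norm_sq_le (h : IsLocalDefiningFn K U φ) (hc : IsClosed K)
    (hK : Convex ℝ K) (hx : x ∈ U) {b : ℝ} (hb : 0 < b)
    (hB : ∀ v, ⟪unitGradient φ x, v⟫ = 0 → b * ‖v‖ ^ 2 ≤ fderiv ℝ (fderiv ℝ φ) x v v) :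
    ∃ c > 0, ∀ᶠ p in 𝓝 (x, x), p.2 ∈ frontier K → p.1 ∈ K →
      c * ‖p.1 - p.2‖ ^ 2 ≤ ⟪p.2 - p.1, unitGradient φ p.2⟫ := by
  set B := fderiv ℝ (fderiv ℝ φ) x
  set M := 2 * ‖B‖ + b
  set G := ‖gradient φ x‖ + 1
  have hN : ContinuousAt (fun p : E × E => M * ‖unitGradient φ x - unitGradient φ p.2‖) (x, x) :=
    ((continuousAt_const.sub ((h.continuousAt_unitGradient hx).comp_of_eq
      continuousAt_snd rfl)).norm).const_mul M
  have hg : ContinuousAt (fun p : E × E => ‖gradient φ p.2‖ + M * ‖p.1 - p.2‖) (x, x) :=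
    ((h.continuousAt_norm_gradient hx).comp_of_eq continuousAt_snd rfl).add (by fun_prop)
  refine ⟨b / (4 * G), by positivity, ?_⟩
  filter_upwards [h.eventually_abs_taylor_le hc hx (show 0 < b / 8 by positivity),
    hN.eventually_lt_const (show _ < b / 4 by simpa using hb),
    hg.eventually_lt_const (show _ < G by simp [G]),
    continuous_fst.continuousAt.eventually (h.isOpen.mem_nhds hx),
    continuous_snd.continuousAt.eventually (h.isOpen.mem_nhds hx)]
    with ⟨z, y⟩ htaylor hN hG hzU hyU hy hz
  dsimp only at *
  set w := z - y
  set s := ⟪y - z, unitGradient φ y⟫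
  have hs : 0 ≤ s := by
    rw [show s = _ from inner_sub_left _ _ _, sub_nonneg]
    exact h.inner_unitGradient_le hc hK hyU hy hz
  have hinner : |⟪unitGradient φ x, w⟫| ≤ s + ‖unitGradient φ x - unitGradient φ y‖ * ‖w‖ := by
    have hsplit : ⟪unitGradient φ x, w⟫ = -s + ⟪unitGradient φ x - unitGradient φ y, w⟫ := by
      rw [inner_sub_left, ← inner_neg_left, neg_sub, real_inner_comm _ (z - y)]
      ring
    rw [hsplit]
    refine (abs_add_le _ _).trans (add_le_add ?_ (abs_real_inner_le_norm _ _))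
    rw [abs_neg, abs_of_nonneg hs]
  have hquad : b * ‖w‖ ^ 2 ≤ B w w + M * ‖w‖ * s + b / 4 * ‖w‖ ^ 2 := calc
    b * ‖w‖ ^ 2 ≤ B w w + M * (‖w‖ * |⟪unitGradient φ x, w⟫|) :=
      mul_norm_sq_le_add_mul_abs_inner B (h.norm_unitGradient hx) hb.le hB w
    _ ≤ B w w + M * (‖w‖ * (s + ‖unitGradient φ x - unitGradient φ y‖ * ‖w‖)) := by gcongr
    _ = B w w + M * ‖w‖ * s + M * ‖unitGradient φ x - unitGradient φ y‖ * ‖w‖ ^ 2 := by ring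
    _ ≤ B w w + M * ‖w‖ * s + b / 4 * ‖w‖ ^ 2 := by gcongr
  have hgs : (‖gradient φ y‖ + M * ‖w‖) * s ≤ G * s := by gcongr
  have hMs : 0 ≤ M * ‖w‖ * s := by positivity
  have hφz := (h.mem_iff hzU).1 hz
  rw [div_mul_eq_mul_div, div_le_iff₀ (by positivity)]
  linarith [(abs_le.1 (htaylor hy)).1]

theorem exists_eventually_mem (h : IsLocalDefiningFn K U φ) (hc : IsClosed K) (hx : x ∈ U) :
    ∃ C > 0, ∀ᶠ p in 𝓝 (x, x), p.2 ∈ frontier K →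
      C * ‖p.1 - p.2‖ ^ 2 ≤ ⟪p.2 - p.1, unitGradient φ p.2⟫ → p.1 ∈ K := by
  set B := fderiv ℝ (fderiv ℝ φ) x
  set g := ‖gradient φ x‖ / 2 with hg
  have hg0 : 0 < g := half_pos (h.norm_gradient_pos hx)
  have hgrad : ContinuousAt (fun p : E × E => ‖gradient φ p.2‖) (x, x) :=
    (h.continuousAt_norm_gradient hx).comp_of_eq continuousAt_snd rfl
  refine ⟨(‖B‖ / 2 + 1) / g, by positivity, ?_⟩
  filter_upwards [h.eventually_abs_taylor_le hc hx one_pos,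
    hgrad.eventually_const_lt (half_lt_self (h.norm_gradient_pos hx)),
    continuous_fst.continuousAt.eventually (h.isOpen.mem_nhds hx)]
    with ⟨z, y⟩ htaylor hgy hzU hy hs
  dsimp only at *
  rw [div_mul_eq_mul_div, div_le_iff₀ hg0] at hs
  have hBw : B (z - y) (z - y) ≤ ‖B‖ * ‖z - y‖ ^ 2 := by
    simpa only [mul_assoc, ← sq] using (le_abs_self _).trans (B.le_opNorm₂ (z - y) (z - y))
  have hs0 : 0 ≤ ⟪y - z, unitGradient φ y⟫ :=
    nonneg_of_mul_nonneg_left (hs.trans' (by positivity)) hg0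
  rw [h.mem_iff hzU]
  nlinarith [(abs_le.1 (htaylor hy)).2]

end IsLocalDefiningFn

end TouchingBalls

section Curvature

variable {n : ℕ} {K U : Set (EuclideanSpace ℝ (Fin n))} {φ : EuclideanSpace ℝ (Fin n) → ℝ}
  {x : EuclideanSpace ℝ (Fin n)}

namespace IsLocalDefiningFn

theorem gaussCurvature_eq_det (h : IsLocalDefiningFn K U φ) (hc : IsClosed K)
    (hK : Convex ℝ K) (hx : x ∈ U) (hxK : x ∈ frontier K) :
    gaussCurvature K x = (shapeOperator φ x).det := by
  have hN := h.outerNormal_eq hc hK hx hxK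
  have hu := h.norm_unitGradient hx
  refine (det_eq_det_compression (outerNormal K x) (hN ▸ hu) _ _ (fun z => ?_) ?_).symm
  · have hz : ⟪unitGradient φ x, (z : EuclideanSpace ℝ (Fin n))⟫ = 0 :=
      hN ▸ Submodule.mem_orthogonal_singleton_iff_inner_right.1 z.2
    simp [h.weingarten_apply hc hK hx hxK, shapeOperator_apply, hz]
  · simp [hN, shapeOperator_apply, hu]

theorem exists_pos_mul_norm_sq_le_fderiv_fderiv (h : IsLocalDefiningFn K U φ) (hc : IsClosed K)
    (hK : Convex ℝ K) (hx : x ∈ U) (hxK : x ∈ frontier K) (hκ : gaussCurvature K x ≠ 0) :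
    ∃ b > 0, ∀ v, ⟪unitGradient φ x, v⟫ = 0 →
      b * ‖v‖ ^ 2 ≤ fderiv ℝ (fderiv ℝ φ) x v v := by
  obtain ⟨b, hb, hW⟩ :=
    exists_pos_mul_norm_sq_le_inner (h.isPositive_weingarten hc hK hx hxK) hκ
  have hg := h.norm_gradient_pos hx
  refine ⟨‖gradient φ x‖ * b, by positivity, fun v hv => ?_⟩
  have hv' : v ∈ (ℝ ∙ outerNormal K x)ᗮ := by
    rwa [Submodule.mem_orthogonal_singleton_iff_inner_right, h.outerNormal_eq hc hK hx hxK]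
  calc ‖gradient φ x‖ * b * ‖v‖ ^ 2 ≤ ‖gradient φ x‖ * ⟪weingarten K x ⟨v, hv'⟩, ⟨v, hv'⟩⟫ := by
        rw [mul_assoc]
        exact mul_le_mul_of_nonneg_left (hW ⟨v, hv'⟩) hg.le
    _ = fderiv ℝ (fderiv ℝ φ) x v v := (h.inner_weingarten hc hK hx hxK ⟨v, hv'⟩ ⟨v, hv'⟩).symm

end IsLocalDefiningFn

namespace HasC2Boundary

theorem continuousOn_gaussCurvature (hC : HasC2Boundary K) (hc : IsClosed K) (hK : Convex ℝ K) :
    ContinuousOn (gaussCurvature K) (frontier K) := by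
  intro x hx
  obtain ⟨U, φ, hxU, h⟩ := hC.exists_isLocalDefiningFn hx
  have hdet : ContinuousWithinAt (fun y => (shapeOperator φ y).det) (frontier K) x :=
    (ContinuousLinearMap.continuous_det.continuousAt.comp
      (h.continuousOn_shapeOperator.continuousAt (h.isOpen.mem_nhds hxU))).continuousWithinAt
  refine hdet.congr_of_eventuallyEq ?_ (h.gaussCurvature_eq_det hc hK hxU hx)
  filter_upwards [mem_nhdsWithin_of_mem_nhds (h.isOpen.mem_nhds hxU), self_mem_nhdsWithin]
    with y hyU hy
  exact h.gaussCurvature_eq_det hc hK hyU hy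

theorem continuousOn_outerNormal (hC : HasC2Boundary K) (hc : IsClosed K) (hK : Convex ℝ K) :
    ContinuousOn (outerNormal K) (frontier K) := by
  intro x hx
  obtain ⟨U, φ, hxU, h⟩ := hC.exists_isLocalDefiningFn hx
  exact (h.hasFDerivWithinAt_outerNormal hc hK hxU hx).continuousWithinAt

theorem norm_outerNormal (hC : HasC2Boundary K) (hc : IsClosed K) (hK : Convex ℝ K)
    (hx : x ∈ frontier K) : ‖outerNormal K x‖ = 1 := by
  obtain ⟨U, φ, hxU, h⟩ := hC.exists_isLocalDefiningFn hx
  rw [h.outerNormal_eq hc hK hxU hx, h.norm_unitGradient hxU]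

theorem inner_outerNormal_le (hC : HasC2Boundary K) (hc : IsClosed K) (hK : Convex ℝ K)
    (hx : x ∈ frontier K) {y : EuclideanSpace ℝ (Fin n)} (hy : y ∈ K) :
    ⟪y, outerNormal K x⟫ ≤ ⟪x, outerNormal K x⟫ := by
  obtain ⟨U, φ, hxU, h⟩ := hC.exists_isLocalDefiningFn hx
  rw [h.outerNormal_eq hc hK hxU hx]
  exact h.inner_unitGradient_le hc hK hxU hx hy

theorem exists_forall_mem_of_norm_sq_le (hC : HasC2Boundary K) (hcomp : IsCompact K)
    (hK : Convex ℝ K) :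
    ∃ ρ > 0, ∀ y ∈ frontier K, ∀ z, ‖z - y‖ ^ 2 ≤ ρ * ⟪y - z, outerNormal K y⟫ → z ∈ K := by
  have hc := hcomp.isClosed
  refine exists_pos_forall_of_isCompact
    (hcomp.of_isClosed_subset isClosed_frontier hc.frontier_subset) ?_ fun x hx => ?_
  · intro ρ ρ' y hρ' hρ h z hz
    refine h z (hz.trans (mul_le_mul_of_nonneg_right hρ ?_))
    exact nonneg_of_mul_nonneg_right ((sq_nonneg _).trans hz) hρ'
  obtain ⟨U, φ, hxU, h⟩ := hC.exists_isLocalDefiningFn hx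
  obtain ⟨C, hC0, hmem⟩ := h.exists_eventually_mem hc hxU
  obtain ⟨r, hr, hball⟩ := Metric.eventually_nhds_iff.1 hmem
  refine ⟨min (r / 2) C⁻¹, by positivity, ?_⟩
  filter_upwards [mem_nhdsWithin_of_mem_nhds (Metric.ball_mem_nhds x (half_pos hr)),
    mem_nhdsWithin_of_mem_nhds (h.isOpen.mem_nhds hxU), self_mem_nhdsWithin] with y hyx hyU hy z hz
  rw [h.outerNormal_eq hc hK hyU hy] at hz
  set s := ⟪y - z, unitGradient φ y⟫
  have hs : s ≤ ‖z - y‖ := by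
    simpa [h.norm_unitGradient hyU, norm_sub_rev] using
      real_inner_le_norm (y - z) (unitGradient φ y)
  have hs0 : 0 ≤ s := nonneg_of_mul_nonneg_right ((sq_nonneg _).trans hz) (by positivity)
  have hzy : ‖z - y‖ ≤ r / 2 := by
    rcases (norm_nonneg (z - y)).eq_or_lt with h0 | h0
    · rw [← h0]
      exact (half_pos hr).le
    refine le_of_mul_le_mul_right ?_ h0
    calc ‖z - y‖ * ‖z - y‖ = ‖z - y‖ ^ 2 := (sq _).symm
      _ ≤ r / 2 * ‖z - y‖ := hz.trans (by gcongr; exact min_le_left _ _)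
  refine @hball (z, y) (max_lt ?_ ((Metric.mem_ball.1 hyx).trans (half_lt_self hr))) hy ?_
  · linarith [dist_triangle z y x, dist_eq_norm z y, Metric.mem_ball.1 hyx]
  · calc C * ‖z - y‖ ^ 2 ≤ C * (C⁻¹ * s) := by
          gcongr
          exact hz.trans (by gcongr; exact min_le_right _ _)
      _ = s := mul_inv_cancel_left₀ hC0.ne' s

end HasC2Boundary

/-- Convex bodies of class `C^2_+` with the origin in their interior. -/
structure IsC2PlusBody (K : Set (EuclideanSpace ℝ (Fin n))) : Prop where
  isCompact : IsCompact K
  convex : Convex ℝ K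
  zero_mem_interior : (0 : EuclideanSpace ℝ (Fin n)) ∈ interior K
  isC2Plus : IsC2Plus K

namespace IsC2PlusBody

theorem isClosed (hK : IsC2PlusBody K) : IsClosed K := hK.isCompact.isClosed

theorem isCompact_frontier (hK : IsC2PlusBody K) : IsCompact (frontier K) :=
  hK.isCompact.of_isClosed_subset isClosed_frontier hK.isClosed.frontier_subset

theorem frontier_subset (hK : IsC2PlusBody K) : frontier K ⊆ K := hK.isClosed.frontier_subset

theorem exists_eventually_mul_norm_sq_le (hK : IsC2PlusBody K) (hx : x ∈ frontier K) :
    ∃ c > 0, ∀ᶠ p in 𝓝 (x, x), p.2 ∈ frontier K → p.1 ∈ K →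
      c * ‖p.1 - p.2‖ ^ 2 ≤ ⟪p.2 - p.1, outerNormal K p.2⟫ := by
  obtain ⟨U, φ, hxU, h⟩ := hK.isC2Plus.c2.exists_isLocalDefiningFn hx
  obtain ⟨b, hb, hB⟩ := h.exists_pos_mul_norm_sq_le_fderiv_fderiv hK.isClosed hK.convex hxU hx
    (hK.isC2Plus.curvature_pos x hx).ne'
  obtain ⟨c, hc, hcK⟩ := h.exists_eventually_mul_norm_sq_le hK.isClosed hK.convex hxU hb hB
  refine ⟨c, hc, ?_⟩
  filter_upwards [hcK, continuous_snd.continuousAt.eventually (h.isOpen.mem_nhds hxU)]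
    with p hp hpU hy
  rw [h.outerNormal_eq hK.isClosed hK.convex hpU hy]
  exact hp hy

-- By convexity the local estimate at `y + t (z - y)` propagates to `z`, at the price of a factor.
theorem exists_forall_mul_norm_sq_le (hK : IsC2PlusBody K) :
    ∃ c > 0, ∀ y ∈ frontier K, ∀ z ∈ K, c * ‖z - y‖ ^ 2 ≤ ⟪y - z, outerNormal K y⟫ := by
  obtain ⟨D, hD⟩ := hK.isCompact.isBounded.exists_norm_le
  refine exists_pos_forall_of_isCompact hK.isCompact_frontier ?_ fun x hx => ?_
  · intro c c' y _ hc h z hz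
    exact (mul_le_mul_of_nonneg_right hc (sq_nonneg _)).trans (h z hz)
  obtain ⟨c, hc, hloc⟩ := hK.exists_eventually_mul_norm_sq_le hx
  obtain ⟨r, hr, hball⟩ := Metric.eventually_nhds_iff.1 hloc
  have hsmall : ∀ᶠ t in 𝓝[>] (0 : ℝ), t ≤ 1 ∧ t * (2 * D) < r / 2 :=
    nhdsWithin_le_nhds ((eventually_le_nhds one_pos).and
      (((continuous_id.mul continuous_const).tendsto' 0 0 (by simp)).eventually_lt_const
        (half_pos hr)))
  obtain ⟨t, ⟨ht1, htD⟩, ht0 : 0 < t⟩ := (hsmall.and self_mem_nhdsWithin).exists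
  refine ⟨c * t, by positivity, ?_⟩
  filter_upwards [mem_nhdsWithin_of_mem_nhds (Metric.ball_mem_nhds x (half_pos hr)),
    self_mem_nhdsWithin] with y hyx hy z hz
  have hyK := hK.frontier_subset hy
  have hdist : ‖t • (z - y)‖ < r / 2 := by
    rw [norm_smul, Real.norm_of_nonneg ht0.le]
    refine htD.trans_le' (mul_le_mul_of_nonneg_left ?_ ht0.le)
    linarith [norm_sub_le z y, hD z hz, hD y hyK]
  have hle := @hball (y + t • (z - y), y) (max_lt ?_ ((Metric.mem_ball.1 hyx).trans
    (half_lt_self hr))) hy (hK.convex.add_smul_sub_mem hyK hz ⟨ht0.le, ht1⟩)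
  · rw [add_sub_cancel_left, norm_smul, Real.norm_of_nonneg ht0.le,
      show y - (y + t • (z - y)) = t • (y - z) by module, real_inner_smul_left] at hle
    refine le_of_mul_le_mul_left (hle.trans' (le_of_eq ?_)) ht0
    ring
  · have htri := dist_triangle (y + t • (z - y)) y x
    rw [dist_eq_norm (y + t • (z - y)) y, add_sub_cancel_left] at htri
    linarith [Metric.mem_ball.1 hyx]

end IsC2PlusBody

end Curvature

section Contact

variable {n : ℕ} {K : Set (EuclideanSpace ℝ (Fin n))} {u x y : EuclideanSpace ℝ (Fin n)}

/-- The inverse Gauss map: the boundary point of `K` with outer unit normal `u`. It is arbitrary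
when there is no such point. -/
def contact (K : Set (EuclideanSpace ℝ (Fin n))) (u : EuclideanSpace ℝ (Fin n)) :
    EuclideanSpace ℝ (Fin n) :=
  Function.invFunOn (outerNormal K) (frontier K) u

namespace IsC2PlusBody

theorem exists_outerNormal_eq (hK : IsC2PlusBody K) (hu : ‖u‖ = 1) :
    ∃ x ∈ frontier K, outerNormal K x = u := by
  obtain ⟨x, hxK, hmax⟩ := hK.isCompact.exists_isMaxOn ⟨0, interior_subset hK.zero_mem_interior⟩
    (f := fun y => ⟪y, u⟫) (by fun_prop)
  have hx : x ∈ frontier K := by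
    refine ⟨subset_closure hxK, fun hint => ?_⟩
    have hline : Tendsto (fun t : ℝ => x + t • u) (𝓝[>] 0) (𝓝 x) :=
      ((by fun_prop : Continuous fun t : ℝ => x + t • u).tendsto' 0 x (by simp)).mono_left
        nhdsWithin_le_nhds
    obtain ⟨t, ht, ht0 : 0 < t⟩ := ((hline.eventually (mem_interior_iff_mem_nhds.1 hint)).and
      self_mem_nhdsWithin).exists
    have hle : ⟪x + t • u, u⟫ ≤ ⟪x, u⟫ := hmax ht
    rw [inner_add_left, real_inner_smul_left, real_inner_self_eq_norm_sq, hu] at hle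
    linarith
  obtain ⟨U, φ, hxU, hφ⟩ := hK.isC2Plus.c2.exists_isLocalDefiningFn hx
  refine ⟨x, hx, ?_⟩
  rw [hφ.outerNormal_eq hK.isClosed hK.convex hxU hx]
  exact (hφ.eq_unitGradient hK.isClosed hxU hx hu fun y hy => hmax hy).symm

theorem contact_mem_frontier (hK : IsC2PlusBody K) (hu : ‖u‖ = 1) : contact K u ∈ frontier K :=
  Function.invFunOn_mem (hK.exists_outerNormal_eq hu)

theorem contact_mem (hK : IsC2PlusBody K) (hu : ‖u‖ = 1) : contact K u ∈ K :=
  hK.frontier_subset (hK.contact_mem_frontier hu)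

theorem outerNormal_contact (hK : IsC2PlusBody K) (hu : ‖u‖ = 1) :
    outerNormal K (contact K u) = u :=
  Function.invFunOn_eq (hK.exists_outerNormal_eq hu)

theorem exists_pos_mul_dist_le_dist_outerNormal (hK : IsC2PlusBody K) :
    ∃ c > 0, ∀ x ∈ frontier K, ∀ y ∈ frontier K,
      c * dist x y ≤ dist (outerNormal K x) (outerNormal K y) := by
  obtain ⟨c, hc, hcK⟩ := hK.exists_forall_mul_norm_sq_le
  refine ⟨2 * c, by positivity, fun x hx y hy => ?_⟩
  rcases eq_or_ne x y with rfl | hxy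
  · simp
  have hmono : 2 * c * ‖x - y‖ ^ 2 ≤ ⟪x - y, outerNormal K x - outerNormal K y⟫ := by
    have hxy := hcK x hx y (hK.frontier_subset hy)
    have hyx := hcK y hy x (hK.frontier_subset hx)
    rw [norm_sub_rev] at hxy
    rw [← neg_sub x y, inner_neg_left] at hyx
    rw [inner_sub_right]
    linarith
  rw [dist_eq_norm, dist_eq_norm]
  refine le_of_mul_le_mul_left ?_ (norm_pos_iff.2 (sub_ne_zero.2 hxy))
  linarith [real_inner_le_norm (x - y) (outerNormal K x - outerNormal K y)]

theorem injOn_outerNormal (hK : IsC2PlusBody K) : InjOn (outerNormal K) (frontier K) := by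
  obtain ⟨c, hc, hcK⟩ := hK.exists_pos_mul_dist_le_dist_outerNormal
  intro x hx y hy hxy
  have hle := hcK x hx y hy
  rw [hxy, dist_self] at hle
  exact dist_le_zero.1 (nonpos_of_mul_nonpos_right hle hc)

theorem continuousOn_contact (hK : IsC2PlusBody K) :
    ContinuousOn (contact K) (Metric.sphere 0 1) := by
  obtain ⟨c, hc, hcK⟩ := hK.exists_pos_mul_dist_le_dist_outerNormal
  refine (LipschitzOnWith.of_dist_le_mul (K := c.toNNReal⁻¹) fun u hu v hv => ?_).continuousOn
  rw [mem_sphere_zero_iff_norm] at hu hv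
  have hle := hcK _ (hK.contact_mem_frontier hu) _ (hK.contact_mem_frontier hv)
  rw [hK.outerNormal_contact hu, hK.outerNormal_contact hv] at hle
  rwa [NNReal.coe_inv, Real.coe_toNNReal _ hc.le, le_inv_mul_iff₀ hc]

theorem norm_outerNormal (hK : IsC2PlusBody K) (hx : x ∈ frontier K) : ‖outerNormal K x‖ = 1 :=
  hK.isC2Plus.c2.norm_outerNormal hK.isClosed hK.convex hx

theorem contact_outerNormal (hK : IsC2PlusBody K) (hx : x ∈ frontier K) :
    contact K (outerNormal K x) = x :=
  have hu := hK.norm_outerNormal hx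
  hK.injOn_outerNormal (hK.contact_mem_frontier hu) hx (hK.outerNormal_contact hu)

theorem inner_le_inner_contact (hK : IsC2PlusBody K) (hu : ‖u‖ = 1) (hx : x ∈ K) :
    ⟪x, u⟫ ≤ ⟪contact K u, u⟫ := by
  have hle := hK.isC2Plus.c2.inner_outerNormal_le hK.isClosed hK.convex
    (hK.contact_mem_frontier hu) hx
  rwa [hK.outerNormal_contact hu] at hle

theorem supportFn_eq_inner_contact (hK : IsC2PlusBody K) (hu : ‖u‖ = 1) :
    supportFn K u = ⟪contact K u, u⟫ :=
  IsGreatest.csSup_eq ⟨⟨_, hK.contact_mem hu, rfl⟩,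
    forall_mem_image.2 fun _ hy => hK.inner_le_inner_contact hu hy⟩

theorem inner_le_supportFn (hK : IsC2PlusBody K) (hx : x ∈ K) : ⟪x, u⟫ ≤ supportFn K u :=
  le_csSup (hK.isCompact.image (by fun_prop)).bddAbove ⟨x, hx, rfl⟩

theorem supportFn_outerNormal (hK : IsC2PlusBody K) (hx : x ∈ frontier K) :
    supportFn K (outerNormal K x) = ⟪x, outerNormal K x⟫ := by
  rw [hK.supportFn_eq_inner_contact (hK.norm_outerNormal hx), hK.contact_outerNormal hx]

theorem exists_pos_le_supportFn (hK : IsC2PlusBody K) :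
    ∃ r > 0, ∀ u, ‖u‖ = 1 → r ≤ supportFn K u := by
  obtain ⟨r, hr, hball⟩ := Metric.isOpen_iff.1 isOpen_interior _ hK.zero_mem_interior
  refine ⟨r / 2, by positivity, fun u hu => ?_⟩
  have hmem : (r / 2) • u ∈ K :=
    interior_subset (hball (by simp [norm_smul, hu, abs_of_pos hr, hr]))
  have hle := hK.inner_le_supportFn hmem (u := u)
  rwa [real_inner_smul_left, real_inner_self_eq_norm_sq, hu, one_pow, mul_one] at hle

theorem supportFn_pos (hK : IsC2PlusBody K) (hu : ‖u‖ = 1) : 0 < supportFn K u :=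
  have ⟨_, hr, hle⟩ := hK.exists_pos_le_supportFn
  hr.trans_le (hle u hu)

theorem exists_supportFn_le (hK : IsC2PlusBody K) :
    ∃ R > 0, ∀ u, ‖u‖ = 1 → supportFn K u ≤ R := by
  obtain ⟨R, hR, hKR⟩ := hK.isCompact.isBounded.exists_pos_norm_le
  refine ⟨R, hR, fun u hu => ?_⟩
  rw [hK.supportFn_eq_inner_contact hu]
  refine (real_inner_le_norm _ _).trans ?_
  rw [hu, mul_one]
  exact hKR _ (hK.contact_mem hu)

theorem continuousOn_supportFn (hK : IsC2PlusBody K) :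
    ContinuousOn (supportFn K) (Metric.sphere 0 1) :=
  (hK.continuousOn_contact.inner continuousOn_id).congr fun _ hu =>
    hK.supportFn_eq_inner_contact (mem_sphere_zero_iff_norm.1 hu)

theorem curvatureFn_pos (hK : IsC2PlusBody K) (hu : ‖u‖ = 1) : 0 < curvatureFn K u :=
  inv_pos.2 (hK.isC2Plus.curvature_pos _ (hK.contact_mem_frontier hu))

theorem continuousOn_curvatureFn (hK : IsC2PlusBody K) :
    ContinuousOn (curvatureFn K) (Metric.sphere 0 1) := by
  have hmaps : MapsTo (contact K) (Metric.sphere 0 1) (frontier K) :=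
    fun u hu => hK.contact_mem_frontier (mem_sphere_zero_iff_norm.1 hu)
  exact ((hK.isC2Plus.c2.continuousOn_gaussCurvature hK.isClosed hK.convex).comp
    hK.continuousOn_contact hmaps).inv₀ fun u hu => (hK.isC2Plus.curvature_pos _ (hmaps hu)).ne'

theorem continuousOn_sphereIntegrand (hK : IsC2PlusBody K) :
    ContinuousOn (sphereIntegrand K) (Metric.sphere 0 1) := by
  have hpos : ∀ u ∈ Metric.sphere 0 1, 0 < supportFn K u ∧ 0 < curvatureFn K u := fun u hu =>
    have hu := mem_sphere_zero_iff_norm.1 hu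
    ⟨hK.supportFn_pos hu, hK.curvatureFn_pos hu⟩
  refine ((hK.continuousOn_supportFn.pow n).inv₀ fun u hu => (pow_pos (hpos u hu).1 n).ne').mul
    (((continuousOn_const.mul (hK.continuousOn_supportFn.pow _)).mul
      hK.continuousOn_curvatureFn).log fun u hu => ?_)
  obtain ⟨hh, hf⟩ := hpos u hu
  exact (mul_pos (mul_pos (by positivity) (pow_pos hh _)) hf).ne'

end IsC2PlusBody

end Contact

section Laplace

variable {F : Type*} [NormedAddCommGroup F] [InnerProductSpace ℝ F] [FiniteDimensional ℝ F]
  [MeasurableSpace F] [BorelSpace F]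

theorem integral_comp_smul_prod_mul (f : F × ℝ → ℝ) {a b : ℝ} (ha : 0 < a) (hb : 0 < b) :
    ∫ w : F × ℝ, f (a • w.1, b * w.2) = (a ^ Module.finrank ℝ F * b)⁻¹ * ∫ w, f w := by
  set T : (F × ℝ) →ₗ[ℝ] (F × ℝ) :=
    LinearMap.prodMap (a • LinearMap.id) (b • LinearMap.id) with hT
  have hdet : LinearMap.det T = a ^ Module.finrank ℝ F * b := by
    rw [hT, LinearMap.det_prodMap, LinearMap.det_smul, LinearMap.det_smul]
    simp
  have hpos : 0 < LinearMap.det T := by rw [hdet]; positivity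
  have : (volume : Measure (F × ℝ)).IsAddHaarMeasure :=
    Measure.prod.instIsAddHaarMeasure volume volume
  have hemb : MeasurableEmbedding T := (LinearMap.equivOfDetNeZero T
    hpos.ne').toContinuousLinearEquiv.toHomeomorph.measurableEmbedding
  calc ∫ w : F × ℝ, f (a • w.1, b * w.2) = ∫ w, f w ∂(Measure.map T volume) := by
        rw [hemb.integral_map]
        simp [hT]
    _ = (a ^ Module.finrank ℝ F * b)⁻¹ * ∫ w, f w := by
        rw [Measure.map_linearMap_addHaar_eq_smul_addHaar _ hpos.ne', integral_smul_measure,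
          ENNReal.toReal_ofReal (abs_nonneg _), abs_of_pos (inv_pos.2 hpos), hdet, smul_eq_mul]

theorem integrable_indicator_paraboloid {c h : ℝ} (hc : 0 < c) (hh : 0 < h) :
    Integrable (indicator {w : F × ℝ | c * ‖w.1‖ ^ 2 ≤ w.2} fun w => Real.exp (-(w.2 / h))) := by
  refine integrable_indicator_epigraph (q := fun z : F => c * ‖z‖ ^ 2) (by fun_prop) hh ?_
  simpa only [mul_div_right_comm] using integrable_exp_neg_mul_norm_sq (F := F) (div_pos hc hh)

theorem ae_ne_graph {q : F → ℝ} (hq : Measurable q) : ∀ᵐ w : F × ℝ, q w.1 ≠ w.2 := by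
  have hm : MeasurableSet {w : F × ℝ | q w.1 = w.2} :=
    measurableSet_eq_fun (hq.comp measurable_fst) measurable_snd
  simp only [ae_iff, not_not, Measure.volume_eq_prod]
  refine (Measure.measure_prod_null hm).2 (Eventually.of_forall fun z => ?_)
  exact measure_mono_null (fun s (hs : q z = s) => hs.symm) (Real.volume_singleton (a := q z))

theorem max_one_sub_div_rpow_le_exp {p : ℝ} (hp : 0 < p) (t : ℝ) :
    (max (1 - t / p) 0) ^ p ≤ Real.exp (-t) :=
  calc (max (1 - t / p) 0) ^ p ≤ Real.exp (-(t / p)) ^ p :=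
        Real.rpow_le_rpow (le_max_right _ _)
          (max_le (Real.one_sub_le_exp_neg _) (Real.exp_pos _).le) hp.le
    _ = Real.exp (-t) := by rw [← Real.exp_mul, neg_mul, div_mul_cancel₀ _ hp.ne']

theorem tendsto_max_one_sub_div_rpow (t : ℝ) :
    Tendsto (fun p : ℝ => (max (1 - t / p) 0) ^ p) atTop (𝓝 (Real.exp (-t))) := by
  refine (Real.tendsto_one_add_div_rpow_exp (-t)).congr' ?_
  filter_upwards [eventually_gt_atTop 0, eventually_gt_atTop t] with p hp hpt
  rw [max_eq_left (sub_nonneg.2 ((div_le_one hp).2 hpt.le)), neg_div, ← sub_eq_add_neg]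

variable {n : ℕ} {K : Set (EuclideanSpace ℝ (Fin n))} {u : EuclideanSpace ℝ (Fin n)} {p : ℝ}

/-- The `p`-th moment of `⟪x, u⟫ / h_K(u)`, rescaled to have a positive finite limit. -/
def scaledMoment (K : Set (EuclideanSpace ℝ (Fin n))) (u : EuclideanSpace ℝ (Fin n))
    (p : ℝ) : ℝ :=
  p ^ ((n + 1 : ℝ) / 2) * ∫ x in K, (|⟪x, u⟫| / supportFn K u) ^ p

/-- The parabolic rescaling of `(ℝ ∙ u)ᗮ × ℝ` around `x`: the pair `(z, s)` goes to the point
`x + z / √p - (s / p) • u`. -/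
def parabolicMap (u : EuclideanSpace ℝ (Fin n)) (hu : ‖u‖ = 1) (x : EuclideanSpace ℝ (Fin n))
    (p : ℝ) (w : (ℝ ∙ u)ᗮ × ℝ) : EuclideanSpace ℝ (Fin n) :=
  x + splitEquiv u hu ((√p)⁻¹ • w.1, p⁻¹ * w.2)

/-- The integrand of `scaledMoment`, restricted to `0 ≤ ⟪x, u⟫`, in the parabolic coordinates at
the contact point. -/
def rescaledIntegrand (K : Set (EuclideanSpace ℝ (Fin n))) (u : EuclideanSpace ℝ (Fin n))
    (hu : ‖u‖ = 1) (p : ℝ) : (ℝ ∙ u)ᗮ × ℝ → ℝ :=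
  indicator (parabolicMap u hu (contact K u) p ⁻¹' K)
    fun w => (max (1 - (w.2 / supportFn K u) / p) 0) ^ p

theorem continuous_parabolicMap (hu : ‖u‖ = 1) (x : EuclideanSpace ℝ (Fin n)) (p : ℝ) :
    Continuous (parabolicMap u hu x p) :=
  continuous_const.add ((continuous_splitEquiv u hu).comp (by fun_prop))

theorem parabolicMap_eq (hu : ‖u‖ = 1) (x : EuclideanSpace ℝ (Fin n)) (hp : 0 ≤ p)
    (w : (ℝ ∙ u)ᗮ × ℝ) :
    parabolicMap u hu x p w =
      x + (√p)⁻¹ • ((w.1 : EuclideanSpace ℝ (Fin n)) - ((√p)⁻¹ * w.2) • u) := by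
  have hsq : p⁻¹ = (√p)⁻¹ * (√p)⁻¹ := by rw [← mul_inv, Real.mul_self_sqrt hp]
  rw [parabolicMap, splitEquiv_apply, hsq]
  simp only [Submodule.coe_smul, smul_sub, smul_smul, mul_assoc]

theorem inner_parabolicMap_sub (hu : ‖u‖ = 1) (x : EuclideanSpace ℝ (Fin n)) (p : ℝ)
    (w : (ℝ ∙ u)ᗮ × ℝ) : ⟪x - parabolicMap u hu x p w, u⟫ = p⁻¹ * w.2 := by
  rw [parabolicMap, sub_add_cancel_left, inner_neg_left, inner_splitEquiv, neg_neg]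

theorem norm_sq_parabolicMap_sub (hu : ‖u‖ = 1) (x : EuclideanSpace ℝ (Fin n)) (hp : 0 ≤ p)
    (w : (ℝ ∙ u)ᗮ × ℝ) :
    ‖parabolicMap u hu x p w - x‖ ^ 2 = p⁻¹ * ‖w.1‖ ^ 2 + (p⁻¹ * w.2) ^ 2 := by
  rw [parabolicMap, add_sub_cancel_left, norm_sq_splitEquiv, norm_smul, norm_inv,
    Real.norm_of_nonneg (Real.sqrt_nonneg p), mul_pow, inv_pow, Real.sq_sqrt hp]

theorem rescaledIntegrand_nonneg (hu : ‖u‖ = 1) (p : ℝ) (w : (ℝ ∙ u)ᗮ × ℝ) :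
    0 ≤ rescaledIntegrand K u hu p w :=
  indicator_nonneg (fun _ _ => Real.rpow_nonneg (le_max_right _ _) _) w

theorem measurable_rescaledIntegrand (hK : MeasurableSet K) (hu : ‖u‖ = 1) (p : ℝ) :
    Measurable (rescaledIntegrand K u hu p) :=
  Measurable.indicator (by fun_prop) ((continuous_parabolicMap hu _ p).measurable hK)

theorem setIntegral_abs_inner_div_rpow (hK : IsCompact K) (hsymm : ∀ x ∈ K, -x ∈ K) (hp : 0 < p)
    (u : EuclideanSpace ℝ (Fin n)) (s : ℝ) :
    ∫ x in K, (|⟪x, u⟫| / s) ^ p = 2 * ∫ x in K, (max ⟪x, u⟫ 0 / s) ^ p := by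
  have hsplit : ∀ t : ℝ, (|t| / s) ^ p = (max t 0 / s) ^ p + (max (-t) 0 / s) ^ p := by
    intro t
    rcases le_total 0 t with ht | ht
    · rw [abs_of_nonneg ht, max_eq_left ht, max_eq_right (by linarith), zero_div,
        Real.zero_rpow hp.ne', add_zero]
    · rw [abs_of_nonpos ht, max_eq_right ht, max_eq_left (by linarith), zero_div,
        Real.zero_rpow hp.ne', zero_add]
  have hint : ∀ g : EuclideanSpace ℝ (Fin n) → ℝ, Continuous g →
      IntegrableOn (fun x => (max (g x) 0 / s) ^ p) K := fun g hg =>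
    (((hg.max continuous_const).div_const s).rpow_const
      fun _ => Or.inr hp.le).continuousOn.integrableOn_compact hK
  have hneg : ∫ x in K, (max (-⟪x, u⟫) 0 / s) ^ p = ∫ x in K, (max ⟪x, u⟫ 0 / s) ^ p := by
    have hpre : Neg.neg ⁻¹' K = K :=
      Subset.antisymm (fun x hx => neg_neg x ▸ hsymm _ hx) hsymm
    have := (Measure.measurePreserving_neg volume).setIntegral_preimage_emb
      (MeasurableEquiv.neg _).measurableEmbedding
      (fun x : EuclideanSpace ℝ (Fin n) => (max ⟪x, u⟫ 0 / s) ^ p) K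
    simpa only [hpre, inner_neg_left] using this
  simp_rw [hsplit]
  rw [integral_add (hint _ (by fun_prop)) (hint _ (by fun_prop)), hneg, two_mul]

theorem rpow_add_one_div_two_eq {d : ℕ} (hd : d + 1 = n) (hp : 0 < p) :
    p ^ ((n + 1 : ℝ) / 2) = ((√p)⁻¹ ^ d * p⁻¹)⁻¹ := by
  subst hd
  rw [mul_inv, inv_inv, inv_pow, inv_inv, Real.sqrt_eq_rpow, ← Real.rpow_natCast,
    ← Real.rpow_mul hp.le, ← Real.rpow_add_one hp.ne']
  push_cast
  ring_nf

namespace IsC2PlusBody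

theorem integral_rescaledIntegrand (hK : IsC2PlusBody K) (hu : ‖u‖ = 1) (hp : 0 < p) :
    ∫ w, rescaledIntegrand K u hu p w =
      p ^ ((n + 1 : ℝ) / 2) * ∫ x in K, (max ⟪x, u⟫ 0 / supportFn K u) ^ p := by
  have hh := hK.supportFn_pos hu
  have hfr : Module.finrank ℝ (ℝ ∙ u)ᗮ + 1 = n := by simpa using finrank_orthogonal_unit u hu
  set g : EuclideanSpace ℝ (Fin n) → ℝ :=
    indicator K fun x => (max ⟪x, u⟫ 0 / supportFn K u) ^ p
  have hcomp : rescaledIntegrand K u hu p = g ∘ parabolicMap u hu (contact K u) p := by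
    have hfun : (fun w : (ℝ ∙ u)ᗮ × ℝ => (max (1 - (w.2 / supportFn K u) / p) 0) ^ p) =
        (fun x => (max ⟪x, u⟫ 0 / supportFn K u) ^ p) ∘ parabolicMap u hu (contact K u) p := by
      funext w
      have hinner := inner_parabolicMap_sub hu (contact K u) p w
      rw [inner_sub_left, ← hK.supportFn_eq_inner_contact hu, sub_eq_iff_eq_add,
        ← sub_eq_iff_eq_add'] at hinner
      rw [Function.comp_apply, ← hinner, ← max_div_div_right hh.le, zero_div, sub_div,
        div_self hh.ne', div_right_comm, div_eq_inv_mul w.2, mul_div_assoc]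
    rw [rescaledIntegrand, hfun]
    exact funext fun w => indicator_comp_right _
  rw [hcomp]
  simp only [Function.comp_def, parabolicMap]
  rw [integral_comp_smul_prod_mul (fun w => g (contact K u + splitEquiv u hu w))
      (by positivity) (by positivity), ← rpow_add_one_div_two_eq hfr hp,
    (measurePreserving_splitEquiv u hu).integral_comp (measurableEmbedding_splitEquiv u hu)
      (fun y => g (contact K u + y)), integral_add_left_eq_self,
    integral_indicator hK.isClosed.measurableSet]

theorem scaledMoment_eq (hK : IsC2PlusBody K) (hsymm : ∀ x ∈ K, -x ∈ K) (hu : ‖u‖ = 1)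
    (hp : 0 < p) : scaledMoment K u p = 2 * ∫ w, rescaledIntegrand K u hu p w := by
  rw [hK.integral_rescaledIntegrand hu hp, scaledMoment,
    setIntegral_abs_inner_div_rpow hK.isCompact hsymm hp, mul_left_comm]

theorem rescaledIntegrand_le (hK : IsC2PlusBody K) (hu : ‖u‖ = 1) {c : ℝ} (hc : 0 < c)
    (hcK : ∀ y ∈ frontier K, ∀ z ∈ K, c * ‖z - y‖ ^ 2 ≤ ⟪y - z, outerNormal K y⟫)
    (hp : 0 < p) (w : (ℝ ∙ u)ᗮ × ℝ) :
    rescaledIntegrand K u hu p w ≤ indicator {w : (ℝ ∙ u)ᗮ × ℝ | c * ‖w.1‖ ^ 2 ≤ w.2}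
      (fun w => Real.exp (-(w.2 / supportFn K u))) w := by
  refine (indicator_le_indicator (max_one_sub_div_rpow_le_exp hp _)).trans
    (indicator_le_indicator_of_subset (fun w hw => ?_) (fun _ => (Real.exp_pos _).le) w)
  have hle := hcK _ (hK.contact_mem_frontier hu) _ hw
  rw [hK.outerNormal_contact hu, inner_parabolicMap_sub,
    norm_sq_parabolicMap_sub hu _ hp.le] at hle
  refine le_of_mul_le_mul_left (hle.trans' ?_) (inv_pos.2 hp)
  linarith [mul_nonneg hc.le (sq_nonneg (p⁻¹ * w.2))]

end IsC2PlusBody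

theorem tendsto_sqrt_inv_atTop : Tendsto (fun p : ℝ => (√p)⁻¹) atTop (𝓝 0) :=
  tendsto_inv_atTop_zero.comp Real.tendsto_sqrt_atTop

theorem tendsto_parabolicMap (hu : ‖u‖ = 1) (x : EuclideanSpace ℝ (Fin n))
    (w : (ℝ ∙ u)ᗮ × ℝ) : Tendsto (fun p => parabolicMap u hu x p w) atTop (𝓝 x) := by
  have hlim : Tendsto (fun p : ℝ => ((√p)⁻¹ • w.1, p⁻¹ * w.2)) atTop
      (𝓝 ((0 : ℝ) • w.1, 0 * w.2)) :=
    (tendsto_sqrt_inv_atTop.smul_const w.1).prodMk_nhds (tendsto_inv_atTop_zero.mul_const w.2)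
  have := (((continuous_splitEquiv u hu).tendsto _).comp hlim).const_add x
  simpa [parabolicMap, splitEquiv_apply] using this

theorem IsLocalDefiningFn.tendsto_mul_comp_parabolicMap {U : Set (EuclideanSpace ℝ (Fin n))}
    {φ : EuclideanSpace ℝ (Fin n) → ℝ} {x : EuclideanSpace ℝ (Fin n)}
    (h : IsLocalDefiningFn K U φ) (hc : IsClosed K) (hx : x ∈ U) (hxK : x ∈ frontier K)
    (hu : ‖u‖ = 1) (hxu : unitGradient φ x = u) (w : (ℝ ∙ u)ᗮ × ℝ) :
    Tendsto (fun p => p * φ (parabolicMap u hu x p w)) atTop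
      (𝓝 (1 / 2 * fderiv ℝ (fderiv ℝ φ) x w.1 w.1 - ‖gradient φ x‖ * w.2)) := by
  set B := fderiv ℝ (fderiv ℝ φ) x
  set y : ℝ → EuclideanSpace ℝ (Fin n) := fun p => w.1 - ((√p)⁻¹ * w.2) • u
  have hy : Tendsto y atTop (𝓝 w.1) := by
    simpa [y] using ((tendsto_sqrt_inv_atTop.mul_const w.2).smul_const u).const_sub
      (w.1 : EuclideanSpace ℝ (Fin n))
  have hP : ∀ p, 0 < p → parabolicMap u hu x p w - x = (√p)⁻¹ • y p := fun p hp => by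
    rw [parabolicMap_eq hu x hp.le, add_sub_cancel_left]
  have hO : (fun p => ‖parabolicMap u hu x p w - x‖ ^ 2) =O[atTop] fun p => p⁻¹ := by
    have hmul := (Asymptotics.isBigO_refl (fun p : ℝ => p⁻¹) atTop).mul
      ((hy.norm.pow 2).isBigO_one ℝ)
    simp only [mul_one] at hmul
    refine hmul.congr' ?_ .rfl
    filter_upwards [eventually_gt_atTop 0] with p hp
    rw [hP p hp, norm_smul, mul_pow, Real.norm_of_nonneg (by positivity), inv_pow,
      Real.sq_sqrt hp.le]
  have hpair : Tendsto (fun p => (parabolicMap u hu x p w, x)) atTop (𝓝 (x, x)) :=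
    (tendsto_parabolicMap hu x w).prodMk_nhds tendsto_const_nhds
  have hrem := (((h.isLittleO_taylor hx).comp_tendsto hpair).trans_isBigO hO).tendsto_div_nhds_zero
  have hquad : Tendsto (fun p => 1 / 2 * B (y p) (y p) - ‖gradient φ x‖ * w.2) atTop
      (𝓝 (1 / 2 * B w.1 w.1 - ‖gradient φ x‖ * w.2)) :=
    ((((by fun_prop : Continuous fun v => B v v).tendsto _).comp hy).const_mul _).sub_const _
  rw [← zero_add (1 / 2 * B w.1 w.1 - _)]
  refine (hrem.add hquad).congr' ?_
  filter_upwards [eventually_gt_atTop 0] with p hp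
  have hinner := inner_parabolicMap_sub hu x p w
  rw [← neg_sub, inner_neg_left, neg_eq_iff_eq_neg, real_inner_comm] at hinner
  have hB : B (parabolicMap u hu x p w - x) (parabolicMap u hu x p w - x) =
      p⁻¹ * B (y p) (y p) := by
    simp only [hP p hp, map_smul, smul_apply, smul_eq_mul, ← mul_assoc]
    rw [← mul_inv, Real.mul_self_sqrt hp.le]
  simp only [Function.comp_apply]
  rw [h.apply_eq_zero hc hx hxK, hxu, hinner, hB]
  field_simp
  ring

theorem IsC2PlusBody.exists_weingarten_compression (hK : IsC2PlusBody K) (hu : ‖u‖ = 1) :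
    ∃ T : (ℝ ∙ u)ᗮ →ₗ[ℝ] (ℝ ∙ u)ᗮ, T.IsPositive ∧
      LinearMap.det T = gaussCurvature K (contact K u) ∧
      ∃ U φ, contact K u ∈ U ∧ IsLocalDefiningFn K U φ ∧ unitGradient φ (contact K u) = u ∧
        ∀ v w : (ℝ ∙ u)ᗮ, fderiv ℝ (fderiv ℝ φ) (contact K u) v w =
          ‖gradient φ (contact K u)‖ * ⟪T v, w⟫ := by
  have hx := hK.contact_mem_frontier hu
  obtain ⟨U, φ, hxU, hφ⟩ := hK.isC2Plus.c2.exists_isLocalDefiningFn hx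
  have hN := hK.outerNormal_contact hu
  have hpos := hφ.isPositive_weingarten hK.isClosed hK.convex hxU hx
  have hinner := hφ.inner_weingarten hK.isClosed hK.convex hxU hx
  have hφu := (hφ.outerNormal_eq hK.isClosed hK.convex hxU hx).symm.trans hN
  have hdet : LinearMap.det (weingarten K (contact K u)) = gaussCurvature K (contact K u) := rfl
  -- `weingarten` acts on the orthogonal complement of the normal at `contact K u`, which equals
  -- `u` only propositionally.
  generalize weingarten K (contact K u) = T at hpos hinner hdet
  generalize outerNormal K (contact K u) = v at T hpos hinner hdet hN
  subst hN
  exact ⟨T, hpos, hdet, U, φ, hxU, hφ, hφu, hinner⟩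

theorem two_mul_mul_sqrt_eq {d : ℕ} (hd : d + 1 = n) {s κ : ℝ} (hs : 0 < s) :
    2 * (s * √(Real.pi ^ d / ((1 / (2 * s)) ^ d * κ))) =
      √(2 ^ (n + 1) * Real.pi ^ (n - 1) * s ^ (n + 1) * κ⁻¹) := by
  subst hd
  rw [Nat.add_sub_cancel, ← mul_assoc]
  nth_rw 1 [← Real.sqrt_sq (by positivity : 0 ≤ 2 * s)]
  rw [← Real.sqrt_mul (by positivity)]
  congr 1
  rw [one_div, inv_pow, mul_pow]
  field_simp
  ring

namespace IsC2PlusBody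

theorem tendsto_rescaledIntegrand {U : Set (EuclideanSpace ℝ (Fin n))}
    {φ : EuclideanSpace ℝ (Fin n) → ℝ} (hK : IsC2PlusBody K) (hu : ‖u‖ = 1)
    (hφ : IsLocalDefiningFn K U φ) (hxU : contact K u ∈ U) (hφu : unitGradient φ (contact K u) = u)
    {q : (ℝ ∙ u)ᗮ → ℝ}
    (hq : ∀ v : (ℝ ∙ u)ᗮ, 1 / 2 * fderiv ℝ (fderiv ℝ φ) (contact K u) v v =
      ‖gradient φ (contact K u)‖ * q v) {w : (ℝ ∙ u)ᗮ × ℝ} (hw : q w.1 ≠ w.2) :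
    Tendsto (fun p => rescaledIntegrand K u hu p w) atTop
      (𝓝 (indicator {w : (ℝ ∙ u)ᗮ × ℝ | q w.1 ≤ w.2}
        (fun w => Real.exp (-(w.2 / supportFn K u))) w)) := by
  have hg := hφ.norm_gradient_pos hxU
  have hlim := hφ.tendsto_mul_comp_parabolicMap hK.isClosed hxU (hK.contact_mem_frontier hu) hu
    hφu w
  rw [hq, ← mul_sub] at hlim
  have hU := (tendsto_parabolicMap hu (contact K u) w).eventually (hφ.isOpen.mem_nhds hxU)
  rcases hw.lt_or_gt with hlt | hlt
  · rw [indicator_of_mem (s := {w : (ℝ ∙ u)ᗮ × ℝ | q w.1 ≤ w.2}) hlt.le]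
    refine (tendsto_max_one_sub_div_rpow (w.2 / supportFn K u)).congr' ?_
    filter_upwards [hU, hlim.eventually_lt_const (mul_neg_of_pos_of_neg hg (sub_neg.2 hlt)),
      eventually_gt_atTop 0] with p hpU hneg hp
    rw [rescaledIntegrand, indicator_of_mem (mem_preimage.2 ((hφ.mem_iff hpU).2
      (neg_of_mul_neg_right hneg hp.le).le))]
  · rw [indicator_of_notMem (s := {w : (ℝ ∙ u)ᗮ × ℝ | q w.1 ≤ w.2}) hlt.not_ge]
    refine tendsto_const_nhds.congr' ?_
    filter_upwards [hU, hlim.eventually_const_lt (mul_pos hg (sub_pos.2 hlt)),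
      eventually_gt_atTop 0] with p hpU hpos hp
    rw [rescaledIntegrand, indicator_of_notMem fun hmem =>
      ((hφ.mem_iff hpU).1 (mem_preimage.1 hmem)).not_gt (pos_of_mul_pos_right hpos hp.le)]

theorem tendsto_scaledMoment (hK : IsC2PlusBody K) (hsymm : ∀ x ∈ K, -x ∈ K) (hu : ‖u‖ = 1) :
    Tendsto (scaledMoment K u) atTop (𝓝 √(2 ^ (n + 1) * Real.pi ^ (n - 1) *
      supportFn K u ^ (n + 1) * curvatureFn K u)) := by
  obtain ⟨c, hc, hcK⟩ := hK.exists_forall_mul_norm_sq_le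
  obtain ⟨T, hT, hdet, U, φ, hxU, hφ, hφu, hB⟩ := hK.exists_weingarten_compression hu
  have hh := hK.supportFn_pos hu
  set q : (ℝ ∙ u)ᗮ → ℝ := fun z => 1 / 2 * ⟪T z, z⟫ with hq
  have hqm : Measurable q :=
    have := LinearMap.continuous_of_finiteDimensional T
    (by fun_prop : Continuous q).measurable
  have hlim : Tendsto (fun p => ∫ w, rescaledIntegrand K u hu p w) atTop
      (𝓝 (supportFn K u * ∫ z, Real.exp (-(q z / supportFn K u)))) := by
    rw [← integral_indicator_epigraph hqm hh]
    refine tendsto_integral_filter_of_dominated_convergence _ (Eventually.of_forall fun p =>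
      (measurable_rescaledIntegrand hK.isClosed.measurableSet hu p).aestronglyMeasurable) ?_
      (integrable_indicator_paraboloid hc hh) ?_
    · filter_upwards [eventually_gt_atTop 0] with p hp
      refine Eventually.of_forall fun w => ?_
      rw [Real.norm_of_nonneg (rescaledIntegrand_nonneg hu p w)]
      exact hK.rescaledIntegrand_le hu hc hcK hp w
    · filter_upwards [ae_ne_graph hqm] with w hw
      exact hK.tendsto_rescaledIntegrand hu hφ hxU hφu
        (fun v => by rw [hB, mul_left_comm]) hw
  have hgauss : ∫ z, Real.exp (-(q z / supportFn K u)) = √(Real.pi ^ Module.finrank ℝ (ℝ ∙ u)ᗮ /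
      ((1 / (2 * supportFn K u)) ^ Module.finrank ℝ (ℝ ∙ u)ᗮ *
        gaussCurvature K (contact K u))) := by
    rw [← hdet, ← LinearMap.det_smul, ← integral_exp_neg_inner_apply_self
      (hT.smul_of_nonneg (by positivity))]
    congr with z
    rw [hq, LinearMap.smul_apply, real_inner_smul_left]
    field_simp
  have hfr : Module.finrank ℝ (ℝ ∙ u)ᗮ + 1 = n := by simpa using finrank_orthogonal_unit u hu
  rw [curvatureFn, ← contact, ← two_mul_mul_sqrt_eq hfr hh, ← hgauss]
  refine (hlim.const_mul 2).congr' ?_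
  filter_upwards [eventually_gt_atTop 0] with p hp
  rw [hK.scaledMoment_eq hsymm hu hp]

end IsC2PlusBody

end Laplace

section MomentBounds

variable {n : ℕ} {K : Set (EuclideanSpace ℝ (Fin n))} {u : EuclideanSpace ℝ (Fin n)} {p : ℝ}

theorem volume_closedBall_eq_of_finrank {F : Type*} [NormedAddCommGroup F] [InnerProductSpace ℝ F]
    [FiniteDimensional ℝ F] [MeasurableSpace F] [BorelSpace F] {d : ℕ}
    (hd : Module.finrank ℝ F = d) (ρ : ℝ) :
    volume (Metric.closedBall (0 : F) ρ) =
      volume (Metric.closedBall (0 : EuclideanSpace ℝ (Fin d)) ρ) := by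
  subst hd
  have e := (stdOrthonormalBasis ℝ F).repr
  rw [← e.measurePreserving.measure_preimage_equiv (f := e.toHomeomorph.toMeasurableEquiv)]
  congr 1
  ext z
  simp

theorem exp_neg_two_mul_le_max_rpow {t : ℝ} (ht : 0 ≤ t) (htp : 2 * t ≤ p) (hp : 0 < p) :
    Real.exp (-(2 * t)) ≤ (max (1 - t / p) 0) ^ p := by
  have hhalf : t / p ≤ 1 / 2 := by rw [div_le_iff₀ hp]; linarith
  have hpos : 0 < 1 - t / p := by linarith
  have hinv : (1 - t / p)⁻¹ ≤ 1 + 2 * (t / p) := by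
    rw [inv_le_iff_one_le_mul₀ hpos]
    nlinarith [div_nonneg ht hp.le]
  have hexp : Real.exp (-(2 * t) / p) ≤ 1 - t / p := by
    rw [neg_div, Real.exp_neg]
    refine inv_le_of_inv_le₀ hpos (hinv.trans ?_)
    rw [mul_div_assoc, add_comm]
    exact Real.add_one_le_exp _
  calc Real.exp (-(2 * t)) = Real.exp (-(2 * t) / p) ^ p := by
        rw [← Real.exp_mul, div_mul_cancel₀ _ hp.ne']
    _ ≤ _ := Real.rpow_le_rpow (Real.exp_pos _).le (hexp.trans (le_max_left _ _)) hp.le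

namespace IsC2PlusBody

theorem integrable_rescaledIntegrand (hK : IsC2PlusBody K) (hu : ‖u‖ = 1) (hp : 0 < p) :
    Integrable (rescaledIntegrand K u hu p) := by
  obtain ⟨c, hc, hcK⟩ := hK.exists_forall_mul_norm_sq_le
  refine (integrable_indicator_paraboloid hc (hK.supportFn_pos hu)).mono'
    (measurable_rescaledIntegrand hK.isClosed.measurableSet hu p).aestronglyMeasurable
    (Eventually.of_forall fun w => ?_)
  rw [Real.norm_of_nonneg (rescaledIntegrand_nonneg hu p w)]
  exact hK.rescaledIntegrand_le hu hc hcK hp w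

theorem exists_scaledMoment_le (hK : IsC2PlusBody K) (hsymm : ∀ x ∈ K, -x ∈ K) :
    ∃ M > 0, ∀ p > 0, ∀ u, ‖u‖ = 1 → scaledMoment K u p ≤ M := by
  obtain ⟨c, hc, hcK⟩ := hK.exists_forall_mul_norm_sq_le
  obtain ⟨R, hR, hRu⟩ := hK.exists_supportFn_le
  refine ⟨2 * (R * (Real.pi / (c / R)) ^ (((n : ℝ) - 1) / 2)), by positivity,
    fun p hp u hu => ?_⟩
  have hh := hK.supportFn_pos hu
  have hfr : (Module.finrank ℝ (ℝ ∙ u)ᗮ : ℝ) = n - 1 := by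
    rw [eq_sub_iff_add_eq]
    exact_mod_cast (finrank_orthogonal_unit u hu).trans finrank_euclideanSpace_fin
  have hexp : 0 ≤ ((n : ℝ) - 1) / 2 := by rw [← hfr]; positivity
  have hgauss : ∫ z : (ℝ ∙ u)ᗮ, Real.exp (-(c * ‖z‖ ^ 2 / supportFn K u)) =
      (Real.pi / (c / supportFn K u)) ^ (((n : ℝ) - 1) / 2) := by
    rw [← hfr, ← GaussianFourier.integral_rexp_neg_mul_sq_norm (V := (ℝ ∙ u)ᗮ) (div_pos hc hh)]
    simp only [neg_mul, div_mul_eq_mul_div]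
  rw [hK.scaledMoment_eq hsymm hu hp]
  gcongr
  calc ∫ w, rescaledIntegrand K u hu p w
      ≤ ∫ w, indicator {w : (ℝ ∙ u)ᗮ × ℝ | c * ‖w.1‖ ^ 2 ≤ w.2}
          (fun w => Real.exp (-(w.2 / supportFn K u))) w :=
        integral_mono (hK.integrable_rescaledIntegrand hu hp)
          (integrable_indicator_paraboloid hc hh) (hK.rescaledIntegrand_le hu hc hcK hp)
    _ = supportFn K u * (Real.pi / (c / supportFn K u)) ^ (((n : ℝ) - 1) / 2) := by
        rw [← hgauss]
        exact integral_indicator_epigraph (q := fun z => c * ‖z‖ ^ 2) (by fun_prop) hh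
    _ ≤ R * (Real.pi / (c / R)) ^ (((n : ℝ) - 1) / 2) := by
        have := hRu u hu
        gcongr

theorem parabolicMap_contact_mem (hK : IsC2PlusBody K) (hu : ‖u‖ = 1) {ρ : ℝ} (hρ : 0 < ρ)
    (hball : ∀ y ∈ frontier K, ∀ z, ‖z - y‖ ^ 2 ≤ ρ * ⟪y - z, outerNormal K y⟫ → z ∈ K)
    (hp : 8 / ρ ≤ p) {w : (ℝ ∙ u)ᗮ × ℝ} (hz : ‖w.1‖ ^ 2 ≤ ρ / 2) (hs : w.2 ∈ Icc 1 2) :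
    parabolicMap u hu (contact K u) p w ∈ K := by
  have hp0 : 0 < p := (by positivity : 0 < 8 / ρ).trans_le hp
  refine hball _ (hK.contact_mem_frontier hu) _ ?_
  rw [hK.outerNormal_contact hu, inner_parabolicMap_sub, norm_sq_parabolicMap_sub hu _ hp0.le]
  have hsq : p⁻¹ * w.2 ^ 2 ≤ ρ / 2 := by
    rw [div_le_iff₀ hρ] at hp
    rw [inv_mul_le_iff₀ hp0]
    nlinarith [hs.1, hs.2]
  calc p⁻¹ * ‖w.1‖ ^ 2 + (p⁻¹ * w.2) ^ 2 = p⁻¹ * (‖w.1‖ ^ 2 + p⁻¹ * w.2 ^ 2) := by ring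
    _ ≤ p⁻¹ * (ρ * w.2) := by gcongr; nlinarith [hs.1]
    _ = ρ * (p⁻¹ * w.2) := by ring

theorem exists_pos_eventually_le_scaledMoment (hK : IsC2PlusBody K) (hsymm : ∀ x ∈ K, -x ∈ K) :
    ∃ m > 0, ∀ᶠ p in atTop, ∀ u, ‖u‖ = 1 → m ≤ scaledMoment K u p := by
  obtain ⟨ρ, hρ, hball⟩ :=
    hK.isC2Plus.c2.exists_forall_mem_of_norm_sq_le hK.isCompact hK.convex
  obtain ⟨h₀, hh₀, hhu⟩ := hK.exists_pos_le_supportFn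
  set V := volume.real (Metric.closedBall (0 : EuclideanSpace ℝ (Fin (n - 1))) √(ρ / 2)) with hV
  have hV0 : 0 < V := ENNReal.toReal_pos
    (Metric.measure_closedBall_pos _ _ (by positivity)).ne' measure_closedBall_lt_top.ne
  refine ⟨2 * (V * Real.exp (-(2 * (2 / h₀)))), by positivity, ?_⟩
  filter_upwards [eventually_gt_atTop 0, eventually_ge_atTop (8 / ρ),
    eventually_ge_atTop (2 * (2 / h₀))] with p hp0 hpρ hph u hu
  have hfr : Module.finrank ℝ (ℝ ∙ u)ᗮ + 1 = n := by simpa using finrank_orthogonal_unit u hu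
  set S : Set ((ℝ ∙ u)ᗮ × ℝ) := Metric.closedBall 0 √(ρ / 2) ×ˢ Icc 1 2 with hS
  have hSm : MeasurableSet S := measurableSet_closedBall.prod measurableSet_Icc
  have hSv : volume.real S = V := by
    rw [measureReal_def, hS, Measure.volume_eq_prod, Measure.prod_prod,
      volume_closedBall_eq_of_finrank (d := n - 1) (by omega), hV, measureReal_def]
    norm_num
  have hle : ∀ w ∈ S, Real.exp (-(2 * (2 / h₀))) ≤ rescaledIntegrand K u hu p w := by
    rintro w ⟨hw, hs⟩
    have hz : ‖w.1‖ ^ 2 ≤ ρ / 2 := by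
      rw [← Real.sq_sqrt (half_pos hρ).le]
      exact pow_le_pow_left₀ (norm_nonneg _) (mem_closedBall_zero_iff.1 hw) 2
    have ht : w.2 / supportFn K u ≤ 2 / h₀ := div_le_div₀ two_pos.le hs.2 hh₀ (hhu u hu)
    have hmem := hK.parabolicMap_contact_mem hu hρ hball hpρ hz hs
    rw [rescaledIntegrand, indicator_of_mem (mem_preimage.2 hmem)]
    exact (Real.exp_le_exp.2 (by linarith)).trans (exp_neg_two_mul_le_max_rpow
      (div_nonneg (by linarith [hs.1]) (hK.supportFn_pos hu).le) (by linarith) hp0)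
  have hSfin : volume S ≠ ⊤ := fun htop => hV0.ne (by rw [← hSv, measureReal_def, htop]; rfl)
  have hint := hK.integrable_rescaledIntegrand hu hp0
  rw [hK.scaledMoment_eq hsymm hu hp0]
  gcongr
  calc V * Real.exp (-(2 * (2 / h₀))) = ∫ _ in S, Real.exp (-(2 * (2 / h₀))) := by
        rw [setIntegral_const, hSv, smul_eq_mul]
    _ ≤ ∫ w in S, rescaledIntegrand K u hu p w :=
        setIntegral_mono_on (integrableOn_const hSfin) hint.integrableOn hSm hle
    _ ≤ ∫ w, rescaledIntegrand K u hu p w :=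
        setIntegral_le_integral hint (Eventually.of_forall (rescaledIntegrand_nonneg hu p))

end IsC2PlusBody

end MomentBounds

section PolarVolume

variable {n : ℕ} {K : Set (EuclideanSpace ℝ (Fin n))} {u : EuclideanSpace ℝ (Fin n)} {p : ℝ}

theorem isFiniteMeasure_sphereMeasure (n : ℕ) : IsFiniteMeasure (sphereMeasure n) := by
  unfold sphereMeasure
  infer_instance

theorem integrable_sphere_of_continuousOn {f : EuclideanSpace ℝ (Fin n) → ℝ}
    (hf : ContinuousOn f (Metric.sphere 0 1)) :
    Integrable (fun u : Metric.sphere (0 : EuclideanSpace ℝ (Fin n)) 1 => f u)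
      (sphereMeasure n) := by
  have := isFiniteMeasure_sphereMeasure n
  exact (continuousOn_iff_continuous_domRestrict.1 hf).integrable_of_hasCompactSupport
    (HasCompactSupport.of_compactSpace _)

theorem volumeIoiPow_apply_Iic (k : ℕ) (x : Ioi (0 : ℝ)) :
    Measure.volumeIoiPow k (Iic x) = ENNReal.ofReal (x.1 ^ (k + 1) / (k + 1)) := by
  have hx : Measure.volumeIoiPow k {x} = 0 := by
    refine withDensity_absolutelyContinuous _ _ ?_
    rw [(MeasurableEmbedding.subtype_coe measurableSet_Ioi).comap_apply]
    simp
  rw [← Measure.volumeIoiPow_apply_Iio, ← Iio_union_right]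
  refine le_antisymm ((measure_union_le _ _).trans_eq ?_) (measure_mono subset_union_left)
  rw [hx, add_zero]

theorem volume_eq_prod_sphere (hn : 1 ≤ n) (S : Set (EuclideanSpace ℝ (Fin n))) :
    volume S = ((sphereMeasure n).prod (Measure.volumeIoiPow (n - 1)))
      {q : Metric.sphere (0 : EuclideanSpace ℝ (Fin n)) 1 × Ioi (0 : ℝ) | q.2.1 • q.1.1 ∈ S} := by
  have : NeZero n := ⟨by omega⟩
  have hmp :=
    (volume : Measure (EuclideanSpace ℝ (Fin n))).measurePreserving_homeomorphUnitSphereProd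
  rw [finrank_euclideanSpace_fin] at hmp
  set e := (homeomorphUnitSphereProd (EuclideanSpace ℝ (Fin n))).toMeasurableEquiv
  calc volume S = volume (S \ {0}) := (measure_sdiff_null (measure_singleton _)).symm
    _ = volume.comap Subtype.val (Subtype.val ⁻¹' S) := by
      rw [comap_subtype_coe_apply (measurableSet_singleton _).compl, Subtype.image_preimage_coe,
        inter_comm, sdiff_eq]
    _ = ((sphereMeasure n).prod (Measure.volumeIoiPow (n - 1))) (e.symm ⁻¹' (Subtype.val ⁻¹' S)) :=
      ((hmp.symm e).measure_preimage_equiv _).symm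

theorem volume_eq_lintegral_sphere (hn : 1 ≤ n) {S : Set (EuclideanSpace ℝ (Fin n))}
    (hS : MeasurableSet S) :
    volume S = ∫⁻ u : Metric.sphere (0 : EuclideanSpace ℝ (Fin n)) 1,
      Measure.volumeIoiPow (n - 1) {t | t.1 • u.1 ∈ S} ∂(sphereMeasure n) := by
  rw [volume_eq_prod_sphere hn S]
  refine Measure.prod_apply (hS.preimage ?_)
  exact ((continuous_subtype_val.comp continuous_snd).smul
    (continuous_subtype_val.comp continuous_fst)).measurable

theorem volume_sublevel_eq_lintegral (hn : 1 ≤ n) {g : EuclideanSpace ℝ (Fin n) → ℝ}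
    (hm : MeasurableSet {y | g y ≤ 1}) (hhom : ∀ t > 0, ∀ y, g (t • y) = t * g y)
    (hpos : ∀ u, ‖u‖ = 1 → 0 < g u) :
    volume {y | g y ≤ 1} = ∫⁻ u : Metric.sphere (0 : EuclideanSpace ℝ (Fin n)) 1,
      ENNReal.ofReal ((g u ^ n)⁻¹ / n) ∂(sphereMeasure n) := by
  rw [volume_eq_lintegral_sphere hn hm]
  refine lintegral_congr fun u => ?_
  have hgu := hpos u (by simp)
  have hIic : {t : Ioi (0 : ℝ) | t.1 • u.1 ∈ {y | g y ≤ 1}} = Iic ⟨(g u)⁻¹, inv_pos.2 hgu⟩ := by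
    ext t
    rw [mem_ofPred_eq, mem_ofPred_eq, hhom _ t.2, mem_Iic, ← Subtype.coe_le_coe,
      ← le_div_iff₀ hgu, one_div]
  rw [hIic, volumeIoiPow_apply_Iic, ← Nat.cast_add_one, Nat.sub_add_cancel hn, inv_pow]

theorem volume_sublevel_eq_integral (hn : 1 ≤ n) {g : EuclideanSpace ℝ (Fin n) → ℝ}
    (hm : MeasurableSet {y | g y ≤ 1}) (hhom : ∀ t > 0, ∀ y, g (t • y) = t * g y)
    (hc : ContinuousOn g (Metric.sphere 0 1)) (hpos : ∀ u, ‖u‖ = 1 → 0 < g u) :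
    volume {y | g y ≤ 1} ≠ ⊤ ∧ volume.real {y | g y ≤ 1} = 1 / n *
      ∫ u : Metric.sphere (0 : EuclideanSpace ℝ (Fin n)) 1, (g u ^ n)⁻¹ ∂(sphereMeasure n) := by
  have hint := integrable_sphere_of_continuousOn (f := fun u => (g u ^ n)⁻¹ / n)
    (((hc.pow n).inv₀ fun u hu => (pow_pos (hpos u (by simpa using hu)) n).ne').div_const _)
  have hnonneg : ∀ u : Metric.sphere (0 : EuclideanSpace ℝ (Fin n)) 1, 0 ≤ (g u ^ n)⁻¹ / n :=
    fun u => by have := hpos u (by simp); positivity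
  rw [measureReal_def, volume_sublevel_eq_lintegral hn hm hhom hpos,
    ← ofReal_integral_eq_lintegral_ofReal hint (Eventually.of_forall hnonneg)]
  refine ⟨ENNReal.ofReal_ne_top, ?_⟩
  rw [ENNReal.toReal_ofReal (integral_nonneg hnonneg), integral_div, div_eq_inv_mul, one_div]

theorem polarBody_eq_sublevel {C : Set (EuclideanSpace ℝ (Fin n))} (hne : C.Nonempty)
    (hb : ∀ u, BddAbove ((fun x => ⟪x, u⟫) '' C)) :
    polarBody C = {y | supportFn C y ≤ 1} := by
  ext y
  simp only [polarBody, supportFn, mem_ofPred_eq]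
  rw [csSup_le_iff (hb y) (hne.image _), forall_mem_image]

theorem isClosed_polarBody (C : Set (EuclideanSpace ℝ (Fin n))) : IsClosed (polarBody C) := by
  simp only [polarBody, ofPred_forall]
  exact isClosed_biInter fun x _ => isClosed_le (by fun_prop) continuous_const

theorem moment_nonneg (p : ℝ) (K : Set (EuclideanSpace ℝ (Fin n)))
    (θ : EuclideanSpace ℝ (Fin n)) : 0 ≤ moment p K θ := by
  unfold moment
  positivity

theorem polarBody_Zp (hp : 1 ≤ p) (hK : IsCompact K) :
    polarBody (Zp p K) = {y | moment p K y ≤ 1} := by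
  have hne : (Zp p K).Nonempty := ⟨0, fun θ => by simpa using moment_nonneg p K θ⟩
  have hb : ∀ θ, BddAbove ((fun x => ⟪x, θ⟫) '' Zp p K) := fun θ =>
    ⟨moment p K θ, forall_mem_image.2 fun _ hx => hx θ⟩
  rw [polarBody_eq_sublevel hne hb]
  ext y
  rw [mem_ofPred_eq, supportFn_Zp hp K hK]
  rfl

theorem continuous_moment (hp : 1 ≤ p) (hK : IsCompact K) : Continuous (moment p K) := by
  have hp0 : 0 ≤ p := by linarith
  refine Continuous.rpow_const (continuous_parametric_integral_of_continuous ?_ hK)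
    fun _ => Or.inr (by positivity)
  exact (by fun_prop : Continuous fun q : EuclideanSpace ℝ (Fin n) × EuclideanSpace ℝ (Fin n) =>
    |⟪q.2, q.1⟫|).rpow_const fun _ => Or.inr hp0

theorem supportFn_smul {t : ℝ} (ht : 0 < t) (y : EuclideanSpace ℝ (Fin n)) :
    supportFn K (t • y) = t * supportFn K y := by
  simp only [supportFn, inner_smul_right, ← smul_eq_mul]
  rw [← Real.sSup_smul_of_nonneg ht.le, ← image_smul, image_image]

theorem scaledMoment_eq_mul_div (hh : 0 ≤ supportFn K u) :
    scaledMoment K u p =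
      p ^ ((n + 1 : ℝ) / 2) * ((∫ x in K, |⟪x, u⟫| ^ p) / supportFn K u ^ p) := by
  simp only [scaledMoment, Real.div_rpow (abs_nonneg _) hh, integral_div]

namespace IsC2PlusBody

theorem integral_abs_inner_rpow_pos (hK : IsC2PlusBody K) (hp : 0 < p) (hu : ‖u‖ = 1) :
    0 < ∫ x in K, |⟪x, u⟫| ^ p := by
  have hc : Continuous fun x : EuclideanSpace ℝ (Fin n) => |⟪x, u⟫| ^ p :=
    (by fun_prop : Continuous fun x : EuclideanSpace ℝ (Fin n) => |⟪x, u⟫|).rpow_const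
      fun _ => Or.inr hp.le
  rw [setIntegral_pos_iff_support_of_nonneg_ae (Eventually.of_forall fun x => by positivity)
    (hc.continuousOn.integrableOn_compact hK.isCompact)]
  have hopen : IsOpen (interior K ∩ {x | ⟪x, u⟫ ≠ 0}) :=
    isOpen_interior.inter (isOpen_ne_fun (by fun_prop) continuous_const)
  have hne : (interior K ∩ {x | ⟪x, u⟫ ≠ 0}).Nonempty := by
    obtain ⟨r, hr, hb⟩ := Metric.isOpen_iff.1 isOpen_interior _ hK.zero_mem_interior
    refine ⟨(r / 2) • u, hb (by simp [norm_smul, hu, abs_of_pos hr, hr]), ?_⟩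
    simpa [inner_smul_left, real_inner_self_eq_norm_sq, hu] using hr.ne'
  exact (hopen.measure_pos volume hne).trans_le (measure_mono fun x hx =>
    ⟨(Real.rpow_pos_of_pos (abs_pos.2 hx.2) p).ne', interior_subset hx.1⟩)

theorem moment_pos (hK : IsC2PlusBody K) (hp : 0 < p) (hu : ‖u‖ = 1) : 0 < moment p K u :=
  Real.rpow_pos_of_pos (hK.integral_abs_inner_rpow_pos hp hu) _

theorem scaledMoment_pos (hK : IsC2PlusBody K) (hp : 0 < p) (hu : ‖u‖ = 1) :
    0 < scaledMoment K u p := by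
  have hh := hK.supportFn_pos hu
  have hI := hK.integral_abs_inner_rpow_pos hp hu
  rw [scaledMoment_eq_mul_div hh.le]
  positivity

theorem volume_polarBody (hK : IsC2PlusBody K) (hn : 1 ≤ n) :
    volume (polarBody K) ≠ ⊤ ∧ volume.real (polarBody K) = 1 / n *
      ∫ u : Metric.sphere (0 : EuclideanSpace ℝ (Fin n)) 1,
        (supportFn K u ^ n)⁻¹ ∂(sphereMeasure n) := by
  have hsub := polarBody_eq_sublevel ⟨0, interior_subset hK.zero_mem_interior⟩ fun u =>
    (hK.isCompact.image (by fun_prop : Continuous fun x => ⟪x, u⟫)).bddAbove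
  have hm := (isClosed_polarBody K).measurableSet
  rw [hsub] at hm ⊢
  exact volume_sublevel_eq_integral hn hm (fun t ht y => supportFn_smul ht y)
    hK.continuousOn_supportFn fun u hu => hK.supportFn_pos hu

theorem volume_polarBody_Zp (hK : IsC2PlusBody K) (hn : 1 ≤ n) (hp : 1 ≤ p) :
    volume (polarBody (Zp p K)) ≠ ⊤ ∧ volume.real (polarBody (Zp p K)) = 1 / n *
      ∫ u : Metric.sphere (0 : EuclideanSpace ℝ (Fin n)) 1,
        (moment p K u ^ n)⁻¹ ∂(sphereMeasure n) := by
  have hm := (isClosed_polarBody (Zp p K)).measurableSet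
  rw [polarBody_Zp hp hK.isCompact] at hm ⊢
  exact volume_sublevel_eq_integral hn hm
    (fun t ht y => by rw [moment_smul hp, abs_of_pos ht])
    (continuous_moment hp hK.isCompact).continuousOn fun u hu => hK.moment_pos (by linarith) hu

end IsC2PlusBody

end PolarVolume

section Limits

variable {n : ℕ} {K : Set (EuclideanSpace ℝ (Fin n))} {u : EuclideanSpace ℝ (Fin n)} {p : ℝ}

theorem tendsto_log_pow_div (k : ℕ) : Tendsto (fun p : ℝ => Real.log p ^ k / p) atTop (𝓝 0) := by
  simpa using Real.tendsto_pow_log_div_mul_add_atTop 1 0 k one_ne_zero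

theorem tendsto_mul_log_add_sq_div (a b : ℝ) :
    Tendsto (fun p : ℝ => (a * Real.log p + b) ^ 2 / p) atTop (𝓝 0) := by
  have hlim := (((tendsto_log_pow_div 2).const_mul (a ^ 2)).add
    ((tendsto_log_pow_div 1).const_mul (2 * a * b))).add
    ((tendsto_log_pow_div 0).const_mul (b ^ 2))
  simp only [mul_zero, add_zero] at hlim
  refine hlim.congr fun p => ?_
  ring

/-- The logarithm of `(h_K(u) / h_{Z_p(K)}(u)) ^ n`, in terms of the rescaled moment. -/
def momentExponent (K : Set (EuclideanSpace ℝ (Fin n))) (p : ℝ) (u : EuclideanSpace ℝ (Fin n)) :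
    ℝ :=
  n / p * ((n + 1) / 2 * Real.log p - Real.log (scaledMoment K u p))

/-- The pointwise counterpart of `p * (|Z_p°| - |K°| - n (n + 1) / (2 p) * log p * |K°|)`, obtained
by writing both volumes as integrals over the sphere. -/
def momentDeviation (K : Set (EuclideanSpace ℝ (Fin n))) (p : ℝ) (u : EuclideanSpace ℝ (Fin n)) :
    ℝ :=
  p * ((moment p K u ^ n)⁻¹ - (supportFn K u ^ n)⁻¹) -
    n * (n + 1) / 2 * Real.log p * (supportFn K u ^ n)⁻¹

namespace IsC2PlusBody

theorem inv_moment_pow (hK : IsC2PlusBody K) (hp : 0 < p) (hu : ‖u‖ = 1) :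
    (moment p K u ^ n)⁻¹ = (supportFn K u ^ n)⁻¹ * Real.exp (momentExponent K p u) := by
  have hh := hK.supportFn_pos hu
  have hI := hK.integral_abs_inner_rpow_pos hp hu
  have hmom := hK.moment_pos hp hu
  have hlog_scaled : Real.log (scaledMoment K u p) = (n + 1) / 2 * Real.log p +
      (Real.log (∫ x in K, |⟪x, u⟫| ^ p) - p * Real.log (supportFn K u)) := by
    rw [scaledMoment_eq_mul_div hh.le, Real.log_mul (by positivity) (by positivity),
      Real.log_div hI.ne' (by positivity), Real.log_rpow hp, Real.log_rpow hh]
  have hlog_moment : Real.log (moment p K u) = 1 / p * Real.log (∫ x in K, |⟪x, u⟫| ^ p) :=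
    Real.log_rpow hI _
  refine Real.log_injOn_pos (mem_Ioi.2 (by positivity)) (mem_Ioi.2 (by positivity)) ?_
  rw [Real.log_mul (by positivity) (Real.exp_pos _).ne', Real.log_exp, Real.log_inv, Real.log_inv,
    Real.log_pow, Real.log_pow, hlog_moment, momentExponent, hlog_scaled]
  field_simp
  ring

theorem momentDeviation_eq (hK : IsC2PlusBody K) (hp : 0 < p) (hu : ‖u‖ = 1) :
    momentDeviation K p u = (supportFn K u ^ n)⁻¹ *
      (p * (Real.exp (momentExponent K p u) - 1 - momentExponent K p u) -
        n * Real.log (scaledMoment K u p)) := by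
  have hexponent : p * momentExponent K p u =
      n * ((n + 1) / 2 * Real.log p - Real.log (scaledMoment K u p)) := by
    rw [momentExponent]
    field_simp
  rw [momentDeviation, hK.inv_moment_pow hp hu]
  linear_combination (supportFn K u ^ n)⁻¹ * hexponent

theorem exists_eventually_abs_log_scaledMoment_le (hK : IsC2PlusBody K)
    (hsymm : ∀ x ∈ K, -x ∈ K) :
    ∃ A, ∀ᶠ p in atTop, ∀ u, ‖u‖ = 1 → |Real.log (scaledMoment K u p)| ≤ A := by
  obtain ⟨M, -, hM⟩ := hK.exists_scaledMoment_le hsymm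
  obtain ⟨m, hm, hle⟩ := hK.exists_pos_eventually_le_scaledMoment hsymm
  refine ⟨max |Real.log m| |Real.log M|, ?_⟩
  filter_upwards [hle, eventually_gt_atTop 0] with p hmp hp u hu
  have hlow := Real.log_le_log hm (hmp u hu)
  have hup := Real.log_le_log (hK.scaledMoment_pos hp hu) (hM p hp u hu)
  exact abs_le_max_abs_abs hlow hup

theorem tendstoUniformlyOn_mul_exp_momentExponent_sub (hK : IsC2PlusBody K)
    (hsymm : ∀ x ∈ K, -x ∈ K) :
    TendstoUniformlyOn (fun p u =>
      p * (Real.exp (momentExponent K p u) - 1 - momentExponent K p u)) 0 atTop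
      (Metric.sphere 0 1) := by
  obtain ⟨A, hlog⟩ := hK.exists_eventually_abs_log_scaledMoment_le hsymm
  have hlim := tendsto_mul_log_add_sq_div (n * ((n + 1) / 2)) (n * A)
  rw [Metric.tendstoUniformlyOn_iff]
  intro δ hδ
  filter_upwards [hlog, eventually_ge_atTop 1, hlim.eventually (gt_mem_nhds hδ),
    hlim.eventually (gt_mem_nhds one_pos)] with p hlogp hp hlt_δ hlt_one u hu
  have hp0 : 0 < p := by linarith
  set E := n / p * ((n + 1) / 2 * Real.log p + A) with hE
  have hpE : p * E ^ 2 = (n * ((n + 1) / 2) * Real.log p + n * A) ^ 2 / p := by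
    rw [hE]
    field_simp
  have hlog_nonneg := Real.log_nonneg hp
  have hle : |momentExponent K p u| ≤ E := by
    rw [momentExponent, abs_mul, abs_of_nonneg (by positivity)]
    refine mul_le_mul_of_nonneg_left ((abs_sub _ _).trans (add_le_add ?_ ?_)) (by positivity)
    · exact (abs_of_nonneg (by positivity)).le
    · exact hlogp u (mem_sphere_zero_iff_norm.1 hu)
  have hE_le : |momentExponent K p u| ≤ 1 := hle.trans (by nlinarith [sq_nonneg E])
  rw [Pi.zero_apply, dist_zero_left, norm_mul, Real.norm_of_nonneg hp0.le]
  calc p * ‖Real.exp (momentExponent K p u) - 1 - momentExponent K p u‖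
      ≤ p * |momentExponent K p u| ^ 2 := by
        rw [sq_abs]
        exact mul_le_mul_of_nonneg_left (Real.abs_exp_sub_one_sub_id_le hE_le) hp0.le
    _ ≤ p * E ^ 2 := by gcongr
    _ < δ := hpE.trans_lt hlt_δ

theorem tendsto_momentDeviation (hK : IsC2PlusBody K) (hsymm : ∀ x ∈ K, -x ∈ K) (hu : ‖u‖ = 1) :
    Tendsto (fun p => momentDeviation K p u) atTop (𝓝 (-(n / 2) * sphereIntegrand K u)) := by
  have hh := hK.supportFn_pos hu
  have hf := hK.curvatureFn_pos hu
  set C := 2 ^ (n + 1) * Real.pi ^ (n - 1) * supportFn K u ^ (n + 1) * curvatureFn K u with hC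
  have hC0 : 0 < C := by positivity
  have hlog : Tendsto (fun p => Real.log (scaledMoment K u p)) atTop (𝓝 (Real.log C / 2)) := by
    rw [← Real.log_sqrt hC0.le]
    exact (hK.tendsto_scaledMoment hsymm hu).log (Real.sqrt_pos.2 hC0).ne'
  have hrem := (hK.tendstoUniformlyOn_mul_exp_momentExponent_sub hsymm).tendsto_at
    (mem_sphere_zero_iff_norm.2 hu)
  have hval : -((n : ℝ) / 2) * sphereIntegrand K u =
      (supportFn K u ^ n)⁻¹ * (0 - n * (Real.log C / 2)) := by
    rw [sphereIntegrand, ← hC]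
    ring
  rw [hval]
  refine ((hrem.sub (hlog.const_mul (n : ℝ))).const_mul _).congr' ?_
  filter_upwards [eventually_gt_atTop 0] with p hp
  rw [hK.momentDeviation_eq hp hu]

theorem exists_eventually_norm_momentDeviation_le (hK : IsC2PlusBody K)
    (hsymm : ∀ x ∈ K, -x ∈ K) :
    ∃ C, ∀ᶠ p in atTop, ∀ u, ‖u‖ = 1 → ‖momentDeviation K p u‖ ≤ C := by
  obtain ⟨A, hlog⟩ := hK.exists_eventually_abs_log_scaledMoment_le hsymm
  obtain ⟨r, hr, hru⟩ := hK.exists_pos_le_supportFn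
  have hrem := Metric.tendstoUniformlyOn_iff.1
    (hK.tendstoUniformlyOn_mul_exp_momentExponent_sub hsymm) 1 one_pos
  refine ⟨(r ^ n)⁻¹ * (1 + n * A), ?_⟩
  filter_upwards [hlog, hrem, eventually_gt_atTop 0] with p hlogp hremp hp u hu
  have hh := hK.supportFn_pos hu
  have hrle := hru u hu
  have hlt := hremp u (mem_sphere_zero_iff_norm.2 hu)
  rw [Pi.zero_apply, dist_zero_left] at hlt
  rw [hK.momentDeviation_eq hp hu, norm_mul, Real.norm_of_nonneg (by positivity)]
  gcongr
  refine (norm_sub_le _ _).trans (add_le_add hlt.le ?_)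
  rw [norm_mul, Real.norm_natCast]
  exact mul_le_mul_of_nonneg_left (hlogp u hu) n.cast_nonneg

theorem continuousOn_inv_supportFn_pow (hK : IsC2PlusBody K) :
    ContinuousOn (fun u => (supportFn K u ^ n)⁻¹) (Metric.sphere 0 1) :=
  (hK.continuousOn_supportFn.pow n).inv₀ fun u hu =>
    (pow_pos (hK.supportFn_pos (by simpa using hu)) n).ne'

theorem continuousOn_inv_moment_pow (hK : IsC2PlusBody K) (hp : 1 ≤ p) :
    ContinuousOn (fun u => (moment p K u ^ n)⁻¹) (Metric.sphere 0 1) :=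
  ((continuous_moment hp hK.isCompact).continuousOn.pow n).inv₀ fun u hu =>
    (pow_pos (hK.moment_pos (by linarith) (by simpa using hu)) n).ne'

theorem tendsto_integral_momentDeviation (hK : IsC2PlusBody K) (hsymm : ∀ x ∈ K, -x ∈ K) :
    Tendsto (fun p => ∫ u : Metric.sphere (0 : EuclideanSpace ℝ (Fin n)) 1,
      momentDeviation K p u ∂(sphereMeasure n)) atTop
      (𝓝 (-(n / 2) * ∫ u : Metric.sphere (0 : EuclideanSpace ℝ (Fin n)) 1,
        sphereIntegrand K u ∂(sphereMeasure n))) := by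
  have := isFiniteMeasure_sphereMeasure n
  obtain ⟨C, hC⟩ := hK.exists_eventually_norm_momentDeviation_le hsymm
  rw [← integral_const_mul]
  refine tendsto_integral_filter_of_dominated_convergence (fun _ => C) ?_ ?_
    (integrable_const _)
    (Eventually.of_forall fun u => hK.tendsto_momentDeviation hsymm (by simp))
  · filter_upwards [eventually_ge_atTop 1] with p hp
    exact (integrable_sphere_of_continuousOn (f := momentDeviation K p)
      ((continuousOn_const.mul ((hK.continuousOn_inv_moment_pow hp).sub
        hK.continuousOn_inv_supportFn_pow)).sub
        (continuousOn_const.mul hK.continuousOn_inv_supportFn_pow))).aestronglyMeasurable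
  · filter_upwards [hC] with p hCp
    exact Eventually.of_forall fun u => hCp u (by simp)

theorem integral_momentDeviation (hK : IsC2PlusBody K) (hn : 1 ≤ n) (hp : 1 ≤ p) :
    ∫ u : Metric.sphere (0 : EuclideanSpace ℝ (Fin n)) 1,
      momentDeviation K p u ∂(sphereMeasure n) =
    n * (p * (volume.real (polarBody (Zp p K)) - volume.real (polarBody K) -
      (n : ℝ) * (n + 1) / (2 * p) * Real.log p * volume.real (polarBody K))) := by
  have hmom := integrable_sphere_of_continuousOn (hK.continuousOn_inv_moment_pow hp)
  have hsupp := integrable_sphere_of_continuousOn hK.continuousOn_inv_supportFn_pow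
  have hdiff : Integrable (fun u : Metric.sphere (0 : EuclideanSpace ℝ (Fin n)) 1 =>
      p * ((moment p K u ^ n)⁻¹ - (supportFn K u ^ n)⁻¹)) (sphereMeasure n) :=
    (hmom.sub hsupp).const_mul p
  simp only [momentDeviation]
  rw [(hK.volume_polarBody hn).2, (hK.volume_polarBody_Zp hn hp).2,
    integral_sub hdiff (hsupp.const_mul _), integral_const_mul, integral_const_mul,
    integral_sub hmom hsupp]
  have hp0 : p ≠ 0 := by linarith
  have hn0 : (n : ℝ) ≠ 0 := by positivity
  field_simp

theorem tendsto_volume_deviation (hK : IsC2PlusBody K) (hsymm : ∀ x ∈ K, -x ∈ K) (hn : 1 ≤ n) :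
    Tendsto (fun p : ℝ => p * (volume.real (polarBody (Zp p K)) - volume.real (polarBody K) -
      (n : ℝ) * (n + 1) / (2 * p) * Real.log p * volume.real (polarBody K))) atTop
      (𝓝 (-(1 / 2) * ∫ u : Metric.sphere (0 : EuclideanSpace ℝ (Fin n)) 1,
        sphereIntegrand K u ∂(sphereMeasure n))) := by
  have hn0 : (n : ℝ) ≠ 0 := by positivity
  have hval (I : ℝ) : -(1 / 2) * I = (n : ℝ)⁻¹ * (-(n / 2) * I) := by field_simp
  rw [hval]
  refine ((hK.tendsto_integral_momentDeviation hsymm).const_mul (n : ℝ)⁻¹).congr' ?_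
  filter_upwards [eventually_ge_atTop 1] with p hp
  rw [hK.integral_momentDeviation hn hp, inv_mul_cancel_left₀ hn0]

theorem tendsto_volume_first_order (hK : IsC2PlusBody K) (hsymm : ∀ x ∈ K, -x ∈ K)
    (hn : 1 ≤ n) :
    Tendsto (fun p : ℝ => p / Real.log p *
        (volume.real (polarBody (Zp p K)) - volume.real (polarBody K))) atTop
      (𝓝 ((n : ℝ) * (n + 1) / 2 * volume.real (polarBody K))) := by
  have hlim := (Real.tendsto_log_atTop.inv_tendsto_atTop.mul
    (hK.tendsto_volume_deviation hsymm hn)).add_const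
    ((n : ℝ) * (n + 1) / 2 * volume.real (polarBody K))
  rw [zero_mul, zero_add] at hlim
  refine hlim.congr' ?_
  filter_upwards [eventually_gt_atTop 1] with p hp
  have hlog : Real.log p ≠ 0 := (Real.log_pos hp).ne'
  have hp0 : p ≠ 0 := by linarith
  simp only [Pi.inv_apply]
  field_simp
  ring

theorem tendsto_volume_deviation_Zp (hK : IsC2PlusBody K) (hsymm : ∀ x ∈ K, -x ∈ K)
    (hn : 1 ≤ n) :
    Tendsto (fun p : ℝ => p * (volume.real (polarBody (Zp p K)) - volume.real (polarBody K) -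
      (n : ℝ) * (n + 1) / (2 * p) * Real.log p * volume.real (polarBody (Zp p K)))) atTop
      (𝓝 (-(1 / 2) * ∫ u : Metric.sphere (0 : EuclideanSpace ℝ (Fin n)) 1,
        sphereIntegrand K u ∂(sphereMeasure n))) := by
  have hlim := (hK.tendsto_volume_deviation hsymm hn).sub (((tendsto_log_pow_div 2).mul
    (hK.tendsto_volume_first_order hsymm hn)).const_mul ((n : ℝ) * (n + 1) / 2))
  rw [zero_mul, mul_zero, sub_zero] at hlim
  refine hlim.congr' ?_
  filter_upwards [eventually_gt_atTop 1] with p hp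
  have := (Real.log_pos hp).ne'
  have hp0 : p ≠ 0 := by linarith
  field_simp
  ring

end IsC2PlusBody

end Limits

section ThinShells

open scoped Pointwise

theorem volumeIoiPow_apply_Ico (k : ℕ) {a b : Ioi (0 : ℝ)} (hab : a ≤ b) :
    Measure.volumeIoiPow k (Ico a b) =
      ENNReal.ofReal ((b.1 ^ (k + 1) - a.1 ^ (k + 1)) / (k + 1)) := by
  have ha : (0 : ℝ) < a := a.2
  have hfin : Measure.volumeIoiPow k (Iio a) ≠ ⊤ := by
    rw [Measure.volumeIoiPow_apply_Iio]
    exact ENNReal.ofReal_ne_top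
  rw [← Iio_sdiff_Iio, measure_sdiff (Iio_subset_Iio hab) measurableSet_Iio.nullMeasurableSet hfin,
    Measure.volumeIoiPow_apply_Iio, Measure.volumeIoiPow_apply_Iio,
    ← ENNReal.ofReal_sub _ (by positivity), sub_div]

theorem volume_Ico_smul {n : ℕ} (hn : 1 ≤ n)
    (B : Set (Metric.sphere (0 : EuclideanSpace ℝ (Fin n)) 1)) {a b : ℝ} (ha : 0 < a)
    (hab : a ≤ b) :
    volume (Ico a b • (Subtype.val '' B)) =
      sphereMeasure n B * ENNReal.ofReal ((b ^ n - a ^ n) / n) := by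
  have hset : {q : Metric.sphere (0 : EuclideanSpace ℝ (Fin n)) 1 × Ioi (0 : ℝ) |
      (q.2 : ℝ) • (q.1 : EuclideanSpace ℝ (Fin n)) ∈ Ico a b • (Subtype.val '' B)} =
      B ×ˢ Ico (⟨a, ha⟩ : Ioi (0 : ℝ)) ⟨b, ha.trans_le hab⟩ := by
    ext ⟨u, t⟩
    simp only [mem_ofPred_eq, Set.mem_smul, exists_mem_image, mem_prod]
    refine ⟨?_, fun ⟨hu, ht⟩ => ⟨t, ht, u, hu, rfl⟩⟩
    rintro ⟨s, hs, v, hv, hsv⟩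
    have hst : s = t := by
      simpa [norm_smul, abs_of_pos (ha.trans_le hs.1), abs_of_pos (mem_Ioi.1 t.2)] using
        congrArg norm hsv
    subst hst
    have hvu : v = u := Subtype.ext (smul_right_injective _ (ha.trans_le hs.1).ne' hsv)
    exact ⟨hvu ▸ hv, hs⟩
  rw [volume_eq_prod_sphere hn, hset, Measure.prod_prod, volumeIoiPow_apply_Ico _ hab,
    ← Nat.cast_add_one, Nat.sub_add_cancel hn]

theorem tendsto_one_sub_pow_div {n : ℕ} (hn : 1 ≤ n) :
    Tendsto (fun δ : ℝ => (1 - (1 - δ) ^ n) / n / δ) (𝓝[>] 0) (𝓝 1) := by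
  have hn0 : (n : ℝ) ≠ 0 := by positivity
  have hderiv : HasDerivAt (fun δ : ℝ => (1 - (1 - δ) ^ n) / n) 1 0 := by
    refine (((((hasDerivAt_id (0 : ℝ)).const_sub 1).pow n).const_sub 1).div_const
      (n : ℝ)).congr_deriv ?_
    simp [hn0]
  refine (hderiv.tendsto_slope.mono_left (nhdsGT_le_nhdsNE 0)).congr fun t => ?_
  simp [slope_def_field]

theorem tendsto_volume_Ico_smul_div {n : ℕ} (hn : 1 ≤ n)
    (B : Set (Metric.sphere (0 : EuclideanSpace ℝ (Fin n)) 1)) :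
    Tendsto (fun δ : ℝ => volume (Ico (1 - δ) 1 • (Subtype.val '' B)) / ENNReal.ofReal δ)
      (𝓝[>] 0) (𝓝 (sphereMeasure n B)) := by
  have hlim := ENNReal.Tendsto.const_mul (a := sphereMeasure n B)
    (ENNReal.tendsto_ofReal (tendsto_one_sub_pow_div hn)) (Or.inl (by simp))
  rw [ENNReal.ofReal_one, mul_one] at hlim
  refine hlim.congr' ?_
  filter_upwards [Ioo_mem_nhdsGT one_pos] with δ hδ
  rw [volume_Ico_smul hn B (sub_pos.2 hδ.2) (by linarith [hδ.1]), one_pow,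
    ENNReal.ofReal_div_of_pos hδ.1, mul_div_assoc]

variable {E : Type*} [NormedAddCommGroup E] [InnerProductSpace ℝ E]

/-- The map `(x, t) ↦ P x + t u`, where `P` is the orthogonal projection onto `uᗮ`. It replaces the
component of `x` along `u` by `t`, so it maps thin shells to cylinders. -/
def flatten (u : E) : E × ℝ →L[ℝ] E :=
  (ℝ ∙ u)ᗮ.starProjection ∘L .fst ℝ E ℝ + (ContinuousLinearMap.snd ℝ E ℝ).smulRight u

theorem flatten_apply (u : E) (q : E × ℝ) :
    flatten u q = (ℝ ∙ u)ᗮ.starProjection q.1 + q.2 • u := rfl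

theorem volume_flatten_image [FiniteDimensional ℝ E] [MeasurableSpace E] [BorelSpace E] {u : E}
    (hu : ‖u‖ = 1) (A : Set E) (I : Set ℝ) :
    volume (flatten u '' A ×ˢ I) =
      volume ((ℝ ∙ u)ᗮ.orthogonalProjectionOnto '' A) * volume I := by
  have himage : flatten u '' A ×ˢ I =
      splitEquiv u hu '' ((ℝ ∙ u)ᗮ.orthogonalProjectionOnto '' A) ×ˢ (-I) := by
    rw [← image_neg_eq_neg, prod_image_image_eq, image_image]
    refine image_congr fun q _ => ?_
    rw [splitEquiv_apply, flatten_apply, neg_smul, sub_neg_eq_add]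
    rfl
  rw [himage, ← (measurePreserving_splitEquiv u hu).measure_preimage_emb
    (measurableEmbedding_splitEquiv u hu), preimage_image_eq _ (splitEquiv u hu).injective,
    Measure.volume_eq_prod, Measure.prod_prod, Measure.measure_neg]

end ThinShells

section LinearizedGaussMap

open Asymptotics

variable {E : Type*} [NormedAddCommGroup E] [InnerProductSpace ℝ E] {u x₀ : E}

theorem eventually_smallSets_pairwise {X : Type*} {l : Filter X} {r : X → X → Prop} :
    (∀ᶠ s in l.smallSets, ∀ x ∈ s, ∀ y ∈ s, r x y) ↔ ∀ᶠ q in l ×ˢ l, r q.1 q.2 := by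
  rw [eventually_prod_self_iff, eventually_smallSets'
    fun s t hst ht x hx y hy => ht x (hst hx) y (hst hy)]

theorem sub_starProjection_orthogonal_unit (hu : ‖u‖ = 1) (v : E) :
    v - (ℝ ∙ u)ᗮ.starProjection v = ⟪u, v⟫ • u := by
  rw [← Submodule.starProjection_unit_singleton ℝ hu, sub_eq_iff_eq_add,
    Submodule.starProjection_add_starProjection_orthogonal]

theorem inner_flatten (hu : ‖u‖ = 1) (q : E × ℝ) : ⟪u, flatten u q⟫ = q.2 := by
  have horth : ⟪u, (ℝ ∙ u)ᗮ.starProjection q.1⟫ = 0 :=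
    Submodule.mem_orthogonal_singleton_iff_inner_right.1 (Submodule.starProjection_apply_mem _ _)
  rw [flatten_apply, inner_add_right, horth, inner_smul_right, real_inner_self_eq_norm_sq, hu]
  ring

theorem starProjection_flatten (hu : ‖u‖ = 1) (q : E × ℝ) :
    (ℝ ∙ u)ᗮ.starProjection (flatten u q) = (ℝ ∙ u)ᗮ.starProjection q.1 := by
  rw [← sub_sub_cancel (flatten u q) ((ℝ ∙ u)ᗮ.starProjection (flatten u q)),
    sub_starProjection_orthogonal_unit hu, inner_flatten hu, flatten_apply, add_sub_cancel_right]

theorem isLittleO_sub_starProjection (hu : ‖u‖ = 1) {X : Type*} {l : Filter X} {f : X → E}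
    (hf : (fun x => ⟪u, f x⟫) =o[l] f) :
    (fun x => f x - (ℝ ∙ u)ᗮ.starProjection (f x)) =o[l] f := by
  simp_rw [sub_starProjection_orthogonal_unit hu]
  refine (hf.norm_left.congr_left fun x => ?_).of_norm_left
  rw [norm_smul, hu, mul_one]

theorem isBigO_flatten (hu : ‖u‖ = 1) {X : Type*} {l : Filter X} {f : X → E × ℝ}
    (hf : (fun x => ⟪u, (f x).1⟫) =o[l] fun x => (f x).1) :
    f =O[l] fun x => flatten u (f x) := by
  have hfst : (fun x => (f x).1) =O[l] fun x => flatten u (f x) := by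
    have hproj : (fun x => (ℝ ∙ u)ᗮ.starProjection (f x).1) =O[l] fun x => flatten u (f x) := by
      simp_rw [← starProjection_flatten hu]
      exact ContinuousLinearMap.isBigO_comp _ _ _
    simpa only [sub_sub_cancel] using
      (isLittleO_sub_starProjection hu hf).right_isBigO_sub.trans (by simpa only [sub_sub_cancel])
  have hsnd : (fun x => (f x).2) =O[l] fun x => flatten u (f x) := by
    simp_rw [← inner_flatten hu]
    exact ContinuousLinearMap.isBigO_comp (innerSL ℝ u) _ _
  exact hfst.prod_left hsnd

namespace IsLocalDefiningFn

variable [CompleteSpace E] {K U : Set E} {φ : E → ℝ}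

theorem isLittleO_inner_sub (h : IsLocalDefiningFn K U φ) (hc : IsClosed K) (hx : x₀ ∈ U) :
    (fun p : E × E => ⟪unitGradient φ x₀, p.1 - p.2⟫)
      =o[𝓝[frontier K] x₀ ×ˢ 𝓝[frontier K] x₀] fun p => p.1 - p.2 := by
  have hzero : ∀ᶠ x in 𝓝[frontier K] x₀, φ x = 0 := by
    filter_upwards [nhdsWithin_le_nhds (h.isOpen.mem_nhds hx), eventually_mem_nhdsWithin]
      with x hxU hxK
    exact h.apply_eq_zero hc hxU hxK
  have hstrict := (h.hasStrictFDerivAt hx).isLittleO.mono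
    ((Filter.prod_mono nhdsWithin_le_nhds nhdsWithin_le_nhds).trans_eq nhds_prod_eq.symm :
      𝓝[frontier K] x₀ ×ˢ 𝓝[frontier K] x₀ ≤ 𝓝 (x₀, x₀))
  refine (isLittleO_const_mul_left_iff (h.norm_gradient_pos hx).ne').1
    (hstrict.neg_left.congr' ?_ .rfl)
  filter_upwards [hzero.prod_mk hzero] with p hp
  rw [hp.1, hp.2, h.fderiv_apply hx]
  ring

theorem eventually_dist_le_mul_dist_projection (h : IsLocalDefiningFn K U φ) (hc : IsClosed K)
    (hx : x₀ ∈ U) {c : ℝ} (hc1 : 1 < c) :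
    ∀ᶠ A in (𝓝[frontier K] x₀).smallSets, ∀ x ∈ A, ∀ y ∈ A,
      dist x y ≤ c * dist ((ℝ ∙ unitGradient φ x₀)ᗮ.orthogonalProjectionOnto x)
        ((ℝ ∙ unitGradient φ x₀)ᗮ.orthogonalProjectionOnto y) := by
  have hc0 : 0 < c := one_pos.trans hc1
  refine eventually_smallSets_pairwise.2 ?_
  filter_upwards [(isLittleO_sub_starProjection (h.norm_unitGradient hx)
    (h.isLittleO_inner_sub hc hx)).def (sub_pos.2 (inv_lt_one_of_one_lt₀ hc1))] with p hp
  rw [dist_eq_norm, dist_eq_norm, ← map_sub, ← div_le_iff₀' hc0]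
  have := norm_sub_norm_le (p.1 - p.2) ((ℝ ∙ unitGradient φ x₀)ᗮ.starProjection (p.1 - p.2))
  change _ ≤ ‖(ℝ ∙ unitGradient φ x₀)ᗮ.starProjection (p.1 - p.2)‖
  rw [div_eq_inv_mul]
  linarith

theorem isLittleO_smul_unitGradient_sub (h : IsLocalDefiningFn K U φ) (hc : IsClosed K)
    (hx : x₀ ∈ U) :
    (fun q : (E × ℝ) × (E × ℝ) =>
      q.1.2 • unitGradient φ q.1.1 - q.2.2 • unitGradient φ q.2.1 -
        shapeOperator φ x₀ (flatten (unitGradient φ x₀) q.1 - flatten (unitGradient φ x₀) q.2))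
      =o[(𝓝[frontier K] x₀ ×ˢ 𝓝 1) ×ˢ (𝓝[frontier K] x₀ ×ˢ 𝓝 1)]
        fun q => flatten (unitGradient φ x₀) q.1 - flatten (unitGradient φ x₀) q.2 := by
  set u := unitGradient φ x₀ with hu
  set D := fderiv ℝ (unitGradient φ) x₀
  have hu1 : ‖u‖ = 1 := h.norm_unitGradient hx
  set l := (𝓝[frontier K] x₀ ×ˢ 𝓝 (1 : ℝ)) ×ˢ (𝓝[frontier K] x₀ ×ˢ 𝓝 (1 : ℝ))
  have hinner : (fun q : (E × ℝ) × (E × ℝ) => ⟪u, (q.1 - q.2).1⟫) =o[l] fun q => (q.1 - q.2).1 :=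
    (h.isLittleO_inner_sub hc hx).comp_tendsto (tendsto_fst.prodMap tendsto_fst)
  have hderiv : HasStrictFDerivAt (fun q : E × ℝ => q.2 • unitGradient φ q.1)
      (D ∘L .fst ℝ E ℝ + (ContinuousLinearMap.snd ℝ E ℝ).smulRight u) (x₀, 1) := by
    refine (hasStrictFDerivAt_snd.smul (HasStrictFDerivAt.comp (f := Prod.fst) (x₀, (1 : ℝ))
      (h.hasStrictFDerivAt_unitGradient hx) hasStrictFDerivAt_fst)).congr_fderiv ?_
    simp [D, hu]
  have hl : l ≤ 𝓝 ((x₀, 1), (x₀, 1)) := by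
    rw [nhds_prod_eq, nhds_prod_eq]
    exact Filter.prod_mono (Filter.prod_mono nhdsWithin_le_nhds le_rfl)
      (Filter.prod_mono nhdsWithin_le_nhds le_rfl)
  have hflat := isBigO_flatten hu1 hinner
  have hnormal := ((D.isBigO_comp _ _).trans_isLittleO
    (isLittleO_sub_starProjection hu1 hinner)).trans_isBigO (isBigO_fst_prod.trans hflat)
  refine (((hderiv.isLittleO.mono hl).trans_isBigO hflat).add hnormal).congr (fun q => ?_)
    fun q => map_sub _ _ _
  rw [← map_sub, shapeOperator_apply, ← hu, inner_flatten hu1, flatten_apply,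
    add_sub_cancel_right, map_sub D]
  simp only [_root_.add_apply, ContinuousLinearMap.comp_apply,
    ContinuousLinearMap.coe_fst', ContinuousLinearMap.smulRight_apply,
    ContinuousLinearMap.coe_snd', D]
  abel

end IsLocalDefiningFn

end LinearizedGaussMap

section GaussMapMeasure

open scoped NNReal ENNReal Pointwise

theorem exists_pos_forall_addHaar_image_bounds {X E : Type*} [Nonempty X] [NormedAddCommGroup E]
    [NormedSpace ℝ E] [FiniteDimensional ℝ E] [MeasurableSpace E] [BorelSpace E] (μ : Measure E)
    [μ.IsAddHaarMeasure] (S : E →L[ℝ] E) {a b : ℝ≥0} (ha : (a : ℝ≥0∞) < ENNReal.ofReal |S.det|)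
    (hb : ENNReal.ofReal |S.det| < b) :
    ∃ τ > 0, ∀ (Q : Set X) (f ψ : X → E),
      (∀ x ∈ Q, ∀ y ∈ Q, ‖ψ x - ψ y - S (f x - f y)‖ ≤ τ * ‖f x - f y‖) →
        a * μ (f '' Q) ≤ μ (ψ '' Q) ∧ μ (ψ '' Q) ≤ b * μ (f '' Q) := by
  obtain ⟨τ, ⟨hlower, hupper⟩, hτ⟩ := (((mul_le_addHaar_image_of_lt_det μ S ha).and
    (addHaar_image_le_mul_of_det_lt μ S hb)).and eventually_mem_nhdsWithin).exists
  refine ⟨τ, hτ, fun Q f ψ hfψ => ?_⟩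
  set g := ψ ∘ Function.invFunOn f Q
  have hg : ∀ x ∈ Q, g (f x) = ψ x := fun x hx => by
    have hmem : f x ∈ f '' Q := mem_image_of_mem f hx
    have hle := hfψ _ (Function.invFunOn_mem hmem) x hx
    rw [Function.invFunOn_eq hmem, sub_self, map_zero, sub_zero, norm_zero, mul_zero] at hle
    exact sub_eq_zero.1 (norm_le_zero_iff.1 hle)
  have himage : g '' (f '' Q) = ψ '' Q := by
    rw [image_image]
    exact image_congr hg
  have happrox : ApproximatesLinearOn g S (f '' Q) τ := by
    rintro _ ⟨x, hx, rfl⟩ _ ⟨y, hy, rfl⟩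
    rw [hg x hx, hg y hy]
    exact hfψ x hx y hy
  rw [← himage]
  exact ⟨hlower _ _ happrox, hupper _ _ happrox⟩

theorem eventually_smallSets_eventually_prod_Ico {X : Type*} {l : Filter X}
    {r : (X × ℝ) × (X × ℝ) → Prop} {c : ℝ} (hr : ∀ᶠ q in (l ×ˢ 𝓝 c) ×ˢ (l ×ˢ 𝓝 c), r q) :
    ∀ᶠ A in l.smallSets, ∀ᶠ δ in 𝓝[>] (0 : ℝ),
      ∀ x ∈ A ×ˢ Ico (c - δ) c, ∀ y ∈ A ×ˢ Ico (c - δ) c, r (x, y) := by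
  obtain ⟨Q, hQ, hrQ⟩ := eventually_prod_self_iff'.1 hr
  obtain ⟨V, hV, W, hW, hVW⟩ := mem_prod_iff.1 hQ
  obtain ⟨ε, hε, hεW⟩ := Metric.mem_nhds_iff.1 hW
  filter_upwards [eventually_smallSets_subset.2 hV] with A hA
  filter_upwards [Ioo_mem_nhdsGT hε] with δ hδ
  have hsub : A ×ˢ Ico (c - δ) c ⊆ Q := (prod_mono hA fun t ht => hεW ?_).trans hVW
  · exact fun x hx y hy => hrQ x (hsub hx) y (hsub hy)
  · rw [Metric.mem_ball, Real.dist_eq, abs_sub_lt_iff]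
    constructor <;> linarith [ht.1, ht.2, hδ.2]

theorem IsLocalDefiningFn.eventually_volume_Ico_smul_bounds {E : Type*} [NormedAddCommGroup E]
    [InnerProductSpace ℝ E] [FiniteDimensional ℝ E] [MeasurableSpace E] [BorelSpace E]
    {K U : Set E} {φ : E → ℝ} {x₀ : E} (h : IsLocalDefiningFn K U φ) (hc : IsClosed K)
    (hx : x₀ ∈ U) {a b : ℝ≥0} (ha : (a : ℝ≥0∞) < ENNReal.ofReal |(shapeOperator φ x₀).det|)
    (hb : ENNReal.ofReal |(shapeOperator φ x₀).det| < b) :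
    ∀ᶠ A in (𝓝[frontier K] x₀).smallSets, ∀ᶠ δ in 𝓝[>] (0 : ℝ),
      a * (volume ((ℝ ∙ unitGradient φ x₀)ᗮ.orthogonalProjectionOnto '' A) * ENNReal.ofReal δ)
        ≤ volume (Ico (1 - δ) 1 • (unitGradient φ '' A)) ∧
      volume (Ico (1 - δ) 1 • (unitGradient φ '' A)) ≤
        b * (volume ((ℝ ∙ unitGradient φ x₀)ᗮ.orthogonalProjectionOnto '' A) *
          ENNReal.ofReal δ) := by
  obtain ⟨τ, hτ, hbounds⟩ := exists_pos_forall_addHaar_image_bounds (X := E × ℝ) volume _ ha hb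
  filter_upwards [eventually_smallSets_eventually_prod_Ico
    ((h.isLittleO_smul_unitGradient_sub hc hx).def hτ)] with A hA
  filter_upwards [hA] with δ hδ
  have himage : (fun q : E × ℝ => q.2 • unitGradient φ q.1) '' A ×ˢ Ico (1 - δ) 1 =
      Ico (1 - δ) 1 • (unitGradient φ '' A) := by
    rw [← image2_smul, image2_image_right, image2_swap]
    exact image_prod fun x (t : ℝ) => t • unitGradient φ x
  have hvol := hbounds _ (flatten (unitGradient φ x₀)) _ hδ
  rwa [himage, volume_flatten_image (h.norm_unitGradient hx), Real.volume_Ico, sub_sub_cancel]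
    at hvol

theorem euclideanHausdorffMeasure_image_le_of_lipschitzOnWith {X Y : Type*} [MetricSpace X]
    [MeasurableSpace X] [BorelSpace X] [MetricSpace Y] [MeasurableSpace Y] [BorelSpace Y]
    {C : ℝ≥0} {f : X → Y} {s : Set X} (hf : LipschitzOnWith C f s) (d : ℕ) :
    Measure.euclideanHausdorffMeasure d (f '' s) ≤
      (C : ℝ≥0∞) ^ d * Measure.euclideanHausdorffMeasure d s := by
  have hle := hf.hausdorffMeasure_image_le (Nat.cast_nonneg d)
  rw [ENNReal.rpow_natCast] at hle
  simp only [Measure.euclideanHausdorffMeasure_def, Measure.smul_apply]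
  rw [mul_smul_comm]
  gcongr

theorem euclideanHausdorffMeasure_le_of_dist_le {X Y : Type*} [MetricSpace X]
    [MeasurableSpace X] [BorelSpace X] [MetricSpace Y] [MeasurableSpace Y] [BorelSpace Y]
    {C : ℝ≥0} {f : X → Y} {s : Set X} (hf : ∀ x ∈ s, ∀ y ∈ s, dist x y ≤ C * dist (f x) (f y))
    (d : ℕ) :
    Measure.euclideanHausdorffMeasure d s ≤
      (C : ℝ≥0∞) ^ d * Measure.euclideanHausdorffMeasure d (f '' s) := by
  have hanti : AntilipschitzWith C (s.domRestrict f) :=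
    AntilipschitzWith.of_le_mul_dist fun x y => hf x x.2 y y.2
  have hle := hanti.le_hausdorffMeasure_image (Nat.cast_nonneg d) univ
  rw [← isometry_subtype_coe.hausdorffMeasure_image (.inl (Nat.cast_nonneg d)), image_univ,
    Subtype.range_coe, image_univ, range_domRestrict, ENNReal.rpow_natCast] at hle
  simp only [Measure.euclideanHausdorffMeasure_def, Measure.smul_apply]
  rw [mul_smul_comm]
  gcongr

section Hyperplane

variable {n : ℕ} {u : EuclideanSpace ℝ (Fin n)}

theorem volume_orthogonal_unit_eq_euclideanHausdorffMeasure (hu : ‖u‖ = 1) :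
    (volume : Measure (ℝ ∙ u)ᗮ) = Measure.euclideanHausdorffMeasure (n - 1) := by
  have hrank : Module.finrank ℝ (ℝ ∙ u)ᗮ = n - 1 := by
    have := finrank_orthogonal_unit u hu
    rw [finrank_euclideanSpace_fin] at this
    omega
  rw [← hrank, InnerProductSpace.euclideanHausdorffMeasure_eq_volume]

theorem volume_image_orthogonalProjectionOnto_le (hu : ‖u‖ = 1)
    (A : Set (EuclideanSpace ℝ (Fin n))) :
    volume ((ℝ ∙ u)ᗮ.orthogonalProjectionOnto '' A) ≤
      Measure.euclideanHausdorffMeasure (n - 1) A := by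
  have hP : LipschitzWith 1 (ℝ ∙ u)ᗮ.orthogonalProjectionOnto :=
    ContinuousLinearMap.lipschitzWith_of_opNorm_le
      (Submodule.orthogonalProjectionOnto_norm_le _)
  rw [volume_orthogonal_unit_eq_euclideanHausdorffMeasure hu]
  simpa using euclideanHausdorffMeasure_image_le_of_lipschitzOnWith hP.lipschitzOnWith (n - 1)

theorem euclideanHausdorffMeasure_le_volume_image_orthogonalProjectionOnto (hu : ‖u‖ = 1)
    {A : Set (EuclideanSpace ℝ (Fin n))} {c : ℝ≥0}
    (hA : ∀ x ∈ A, ∀ y ∈ A, dist x y ≤ c * dist ((ℝ ∙ u)ᗮ.orthogonalProjectionOnto x)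
      ((ℝ ∙ u)ᗮ.orthogonalProjectionOnto y)) :
    Measure.euclideanHausdorffMeasure (n - 1) A ≤
      (c : ℝ≥0∞) ^ (n - 1) * volume ((ℝ ∙ u)ᗮ.orthogonalProjectionOnto '' A) := by
  rw [volume_orthogonal_unit_eq_euclideanHausdorffMeasure hu]
  exact euclideanHausdorffMeasure_le_of_dist_le hA (n - 1)

end Hyperplane

/-- The measure `μ` has local density `k` with respect to `ν` on `S`: near each point of `S` the
ratio `μ A / ν A` is close to `k`. It replaces a Radon–Nikodym derivative where `μ ≪ ν` is not yet
known. -/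
def HasLocalDensityOn {X : Type*} [TopologicalSpace X] [MeasurableSpace X] (μ ν : Measure X)
    (S : Set X) (k : X → ℝ) : Prop :=
  ∀ x ∈ S, ∀ a b : ℝ≥0, a < k x → k x < b →
    ∀ᶠ A in (𝓝[S] x).smallSets, MeasurableSet A → a * ν A ≤ μ A ∧ μ A ≤ b * ν A

/-- The zeroth curvature measure of `K`: the measure of `A` is that of the set of unit vectors
which are outer normals of `K` at a point of `A`. -/
def gaussCurvatureMeasure {n : ℕ} (K : Set (EuclideanSpace ℝ (Fin n))) :
    Measure (EuclideanSpace ℝ (Fin n)) :=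
  (sphereMeasure n).map fun v : Metric.sphere (0 : EuclideanSpace ℝ (Fin n)) 1 => contact K v

namespace IsC2PlusBody

variable {n : ℕ} {K : Set (EuclideanSpace ℝ (Fin n))} {x₀ : EuclideanSpace ℝ (Fin n)}

theorem measurable_contact_sphere (h : IsC2PlusBody K) :
    Measurable fun v : Metric.sphere (0 : EuclideanSpace ℝ (Fin n)) 1 => contact K v :=
  (continuousOn_iff_continuous_domRestrict.1 h.continuousOn_contact).measurable

theorem image_val_preimage_contact (h : IsC2PlusBody K) {A : Set (EuclideanSpace ℝ (Fin n))}
    (hA : A ⊆ frontier K) :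
    Subtype.val '' ((fun v : Metric.sphere (0 : EuclideanSpace ℝ (Fin n)) 1 => contact K v) ⁻¹' A)
      = outerNormal K '' A := by
  ext u
  constructor
  · rintro ⟨v, hv, rfl⟩
    exact ⟨contact K v, hv, h.outerNormal_contact (by simp)⟩
  · rintro ⟨x, hx, rfl⟩
    refine ⟨⟨outerNormal K x, mem_sphere_zero_iff_norm.2 (h.norm_outerNormal (hA hx))⟩, ?_, rfl⟩
    rwa [mem_preimage, h.contact_outerNormal (hA hx)]

theorem tendsto_volume_Ico_smul_outerNormal (h : IsC2PlusBody K) (hn : 1 ≤ n)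
    {A : Set (EuclideanSpace ℝ (Fin n))} (hAm : MeasurableSet A) (hA : A ⊆ frontier K) :
    Tendsto (fun δ : ℝ => volume (Ico (1 - δ) 1 • (outerNormal K '' A)) / ENNReal.ofReal δ)
      (𝓝[>] 0) (𝓝 (gaussCurvatureMeasure K A)) := by
  rw [gaussCurvatureMeasure, Measure.map_apply h.measurable_contact_sphere hAm,
    ← h.image_val_preimage_contact hA]
  exact tendsto_volume_Ico_smul_div hn _

theorem eventually_gaussCurvatureMeasure_bounds {U : Set (EuclideanSpace ℝ (Fin n))}
    {φ : EuclideanSpace ℝ (Fin n) → ℝ} (h : IsC2PlusBody K) (hn : 1 ≤ n)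
    (hφ : IsLocalDefiningFn K U φ) (hxU : x₀ ∈ U) (hx₀ : x₀ ∈ frontier K) {a b : ℝ≥0}
    (ha : a < gaussCurvature K x₀) (hb : gaussCurvature K x₀ < b) :
    ∀ᶠ A in (𝓝[frontier K] x₀).smallSets, MeasurableSet A →
      a * volume ((ℝ ∙ unitGradient φ x₀)ᗮ.orthogonalProjectionOnto '' A) ≤
        gaussCurvatureMeasure K A ∧
      gaussCurvatureMeasure K A ≤
        b * volume ((ℝ ∙ unitGradient φ x₀)ᗮ.orthogonalProjectionOnto '' A) := by
  have hκ := h.isC2Plus.curvature_pos x₀ hx₀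
  have hdet : |(shapeOperator φ x₀).det| = gaussCurvature K x₀ := by
    rw [← hφ.gaussCurvature_eq_det h.isClosed h.convex hxU hx₀, abs_of_pos hκ]
  have hsub : ∀ᶠ A in (𝓝[frontier K] x₀).smallSets, A ⊆ frontier K ∩ U :=
    eventually_smallSets_subset.2 (inter_mem_nhdsWithin _ (hφ.isOpen.mem_nhds hxU))
  filter_upwards [hsub, hφ.eventually_volume_Ico_smul_bounds h.isClosed hxU
    (a := a) (b := b) (by rwa [hdet, ENNReal.lt_ofReal_iff_toReal_lt ENNReal.coe_ne_top])
    (by rwa [hdet, ENNReal.ofReal_lt_iff_lt_toReal hκ.le ENNReal.coe_ne_top])]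
    with A hA hbounds hAm
  have hnormal : unitGradient φ '' A = outerNormal K '' A := image_congr fun x hx =>
    (hφ.outerNormal_eq h.isClosed h.convex (hA hx).2 (hA hx).1).symm
  have hlim := h.tendsto_volume_Ico_smul_outerNormal hn hAm (hA.trans inter_subset_left)
  rw [hnormal] at hbounds
  constructor
  · refine ge_of_tendsto hlim ?_
    filter_upwards [hbounds, eventually_mem_nhdsWithin] with δ hδ hδ0
    rw [ENNReal.le_div_iff_mul_le (.inl (ENNReal.ofReal_pos.2 hδ0).ne')
      (.inl ENNReal.ofReal_ne_top), mul_assoc]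
    exact hδ.1
  · refine le_of_tendsto hlim ?_
    filter_upwards [hbounds] with δ hδ
    exact ENNReal.div_le_of_le_mul (hδ.2.trans_eq (mul_assoc _ _ _).symm)

theorem hasLocalDensityOn_gaussCurvatureMeasure (h : IsC2PlusBody K) (hn : 1 ≤ n) :
    HasLocalDensityOn (gaussCurvatureMeasure K) (Measure.euclideanHausdorffMeasure (n - 1))
      (frontier K) (gaussCurvature K) := by
  intro x₀ hx₀ a b ha hb
  obtain ⟨U, φ, hxU, hφ⟩ := h.isC2Plus.c2.exists_isLocalDefiningFn hx₀
  obtain ⟨a', haa', ha'⟩ := exists_between ha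
  lift a' to ℝ≥0 using a.2.trans haa'.le
  obtain ⟨c, hc, hc1⟩ : ∃ c : ℝ≥0, a * c ^ (n - 1) < a' ∧ 1 < c := by
    have hlim : ∀ᶠ c : ℝ≥0 in 𝓝 1, a * c ^ (n - 1) < a' :=
      (by fun_prop : Continuous fun c : ℝ≥0 => a * c ^ (n - 1)).tendsto 1
        |>.eventually_lt_const (by simpa using haa')
    exact ((hlim.filter_mono nhdsWithin_le_nhds).and
      (eventually_mem_nhdsWithin (s := Ioi 1))).exists
  have hu := hφ.norm_unitGradient hxU
  filter_upwards [hφ.eventually_dist_le_mul_dist_projection h.isClosed hxU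
      (NNReal.coe_lt_coe.2 hc1), h.eventually_gaussCurvatureMeasure_bounds hn hφ hxU hx₀ ha' hb]
    with A hdist hbounds hAm
  obtain ⟨hlower, hupper⟩ := hbounds hAm
  refine ⟨?_, hupper.trans (by gcongr; exact volume_image_orthogonalProjectionOnto_le hu A)⟩
  calc (a : ℝ≥0∞) * Measure.euclideanHausdorffMeasure (n - 1) A
      ≤ a * (c ^ (n - 1) * volume ((ℝ ∙ unitGradient φ x₀)ᗮ.orthogonalProjectionOnto '' A)) := by
        gcongr
        exact euclideanHausdorffMeasure_le_volume_image_orthogonalProjectionOnto hu hdist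
    _ ≤ a' * volume ((ℝ ∙ unitGradient φ x₀)ᗮ.orthogonalProjectionOnto '' A) := by
        rw [← mul_assoc]
        gcongr
        exact_mod_cast hc.le
    _ ≤ gaussCurvatureMeasure K A := hlower

end IsC2PlusBody

end GaussMapMeasure

section ChangeOfVariables

open scoped NNReal ENNReal

section LocalDensity

variable {X : Type*} [TopologicalSpace X] [MeasurableSpace X]
  {μ μ₁ μ₂ ν : Measure X} {S : Set X} {k : X → ℝ}

theorem hasLocalDensityOn_withDensity (hk : ContinuousOn k S) :
    HasLocalDensityOn ((ν.restrict S).withDensity fun x => ENNReal.ofReal (k x)) ν S k := by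
  intro x hx a b ha hb
  have hmem : S ∩ k ⁻¹' Ioo a b ∈ 𝓝[S] x :=
    inter_mem self_mem_nhdsWithin (hk x hx (Ioo_mem_nhds ha hb))
  filter_upwards [eventually_smallSets_subset.2 hmem] with A hA hAm
  rw [withDensity_apply _ hAm, Measure.restrict_restrict hAm,
    inter_eq_left.2 (hA.trans inter_subset_left), ← setLIntegral_const, ← setLIntegral_const]
  refine ⟨setLIntegral_mono' hAm fun y hy => ?_, setLIntegral_mono' hAm fun y hy => ?_⟩ <;>
    rw [← ENNReal.ofReal_coe_nnreal]
  · exact ENNReal.ofReal_le_ofReal (hA hy).2.1.le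
  · exact ENNReal.ofReal_le_ofReal (hA hy).2.2.le

variable [OpensMeasurableSpace X] [T2Space X]

theorem measure_le_mul_of_eventually_smallSets {c : ℝ≥0∞} (hS : IsCompact S)
    (hμ : μ Sᶜ = 0)
    (h : ∀ x ∈ S, ∀ᶠ A in (𝓝[S] x).smallSets, MeasurableSet A → μ A ≤ c * ν A) {A : Set X}
    (hA : MeasurableSet A) : μ A ≤ c * ν A := by
  obtain ⟨V, -, hSV, hV⟩ : ∃ V, IsOpen V ∧ S ⊆ V ∧
      ∀ A, MeasurableSet A → A ⊆ V ∩ S → μ A ≤ c * ν A := by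
    refine hS.induction_on
      (p := fun s => ∃ V, IsOpen V ∧ s ⊆ V ∧ ∀ A, MeasurableSet A → A ⊆ V ∩ S → μ A ≤ c * ν A)
      ⟨∅, isOpen_empty, Subset.rfl, fun A _ hA => ?_⟩
      (fun s t hst ⟨V, hV, htV, hVle⟩ => ⟨V, hV, hst.trans htV, hVle⟩)
      (fun s t ⟨V, hV, hsV, hVle⟩ ⟨W, hW, htW, hWle⟩ => ⟨V ∪ W, hV.union hW,
        union_subset_union hsV htW, fun A hAm hA => ?_⟩) fun x hx => ?_
    · rw [empty_inter, subset_empty_iff] at hA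
      simp [hA]
    · calc μ A = μ (A ∩ V) + μ (A \ V) := (measure_inter_add_sdiff A hV.measurableSet).symm
        _ ≤ c * ν (A ∩ V) + c * ν (A \ V) := add_le_add
          (hVle _ (hAm.inter hV.measurableSet) fun x hx => ⟨hx.2, (hA hx.1).2⟩)
          (hWle _ (hAm.diff hV.measurableSet) fun x hx =>
            ⟨(hA hx.1).1.resolve_left hx.2, (hA hx.1).2⟩)
        _ = c * ν A := by rw [← mul_add, measure_inter_add_sdiff A hV.measurableSet]
    · obtain ⟨s, hs, hsle⟩ := eventually_smallSets.1 (h x hx)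
      obtain ⟨V, hV, hxV, hVs⟩ := mem_nhdsWithin.1 hs
      exact ⟨V, mem_nhdsWithin_of_mem_nhds (hV.mem_nhds hxV), V, hV, Subset.rfl,
        fun A hAm hA => hsle A (hA.trans hVs) hAm⟩
  calc μ A = μ (A ∩ S) := (measure_inter_conull hμ).symm
    _ ≤ c * ν (A ∩ S) := hV _ (hA.inter hS.measurableSet) fun x hx => ⟨hSV hx.2, hx.2⟩
    _ ≤ c * ν A := by gcongr; exact inter_subset_left

theorem HasLocalDensityOn.le (h₁ : HasLocalDensityOn μ₁ ν S k)
    (h₂ : HasLocalDensityOn μ₂ ν S k) (hk : ∀ x ∈ S, 0 < k x) (hS : IsCompact S)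
    (hμ₁ : μ₁ Sᶜ = 0) : μ₁ ≤ μ₂ := by
  refine Measure.le_iff.2 fun A hA => ?_
  have hle : ∀ c : ℝ≥0, 1 < c → μ₁ A ≤ (c ^ 2 : ℝ≥0) * μ₂ A := fun c hc => by
    refine measure_le_mul_of_eventually_smallSets hS hμ₁ (fun x hx => ?_) hA
    lift k x to ℝ≥0 using (hk x hx).le with κ hκ
    have hκ0 : 0 < κ := NNReal.coe_pos.1 (hκ ▸ hk x hx)
    have hlower : ((κ / c : ℝ≥0) : ℝ) < k x := by
      rw [← hκ, NNReal.coe_lt_coe]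
      exact div_lt_self hκ0 hc
    have hupper : k x < ((κ * c : ℝ≥0) : ℝ) := by
      rw [← hκ, NNReal.coe_lt_coe]
      exact lt_mul_of_one_lt_right hκ0 hc
    filter_upwards [h₁ x hx _ _ hlower hupper, h₂ x hx _ _ hlower hupper] with A hA₁ hA₂ hA
    have hmul : κ * c = c ^ 2 * (κ / c) := by
      field_simp
    calc μ₁ A ≤ (κ * c : ℝ≥0) * ν A := (hA₁ hA).2
      _ = (c ^ 2 : ℝ≥0) * ((κ / c : ℝ≥0) * ν A) := by rw [hmul, ENNReal.coe_mul, mul_assoc]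
      _ ≤ (c ^ 2 : ℝ≥0) * μ₂ A := by gcongr; exact (hA₂ hA).1
  have hlim : Tendsto (fun c : ℝ≥0 => ((c ^ 2 : ℝ≥0) : ℝ≥0∞) * μ₂ A) (𝓝[>] 1) (𝓝 (μ₂ A)) := by
    have hsq : Tendsto (fun c : ℝ≥0 => ((c ^ 2 : ℝ≥0) : ℝ≥0∞)) (𝓝 1) (𝓝 1) := by
      simpa using (by fun_prop : Continuous fun c : ℝ≥0 => ((c ^ 2 : ℝ≥0) : ℝ≥0∞)).tendsto 1
    simpa using ENNReal.Tendsto.mul_const (hsq.mono_left nhdsWithin_le_nhds) (.inl one_ne_zero)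
  exact ge_of_tendsto hlim (eventually_mem_nhdsWithin.mono hle)

theorem HasLocalDensityOn.eq (h₁ : HasLocalDensityOn μ₁ ν S k)
    (h₂ : HasLocalDensityOn μ₂ ν S k) (hk : ∀ x ∈ S, 0 < k x) (hS : IsCompact S)
    (hμ₁ : μ₁ Sᶜ = 0) (hμ₂ : μ₂ Sᶜ = 0) : μ₁ = μ₂ :=
  (h₁.le h₂ hk hS hμ₁).antisymm (h₂.le h₁ hk hS hμ₂)

end LocalDensity

namespace IsC2PlusBody

variable {n : ℕ} {K : Set (EuclideanSpace ℝ (Fin n))} {f : EuclideanSpace ℝ (Fin n) → ℝ}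

theorem ae_gaussCurvatureMeasure_mem_frontier (h : IsC2PlusBody K) :
    ∀ᵐ x ∂gaussCurvatureMeasure K, x ∈ frontier K :=
  (ae_map_iff h.measurable_contact_sphere.aemeasurable
    isClosed_frontier.measurableSet).2 (.of_forall fun v => h.contact_mem_frontier (by simp))

theorem gaussCurvatureMeasure_eq_withDensity (h : IsC2PlusBody K) (hn : 1 ≤ n) :
    gaussCurvatureMeasure K =
      (surfaceMeasure K).withDensity fun x => ENNReal.ofReal (gaussCurvature K x) :=
  (h.hasLocalDensityOn_gaussCurvatureMeasure hn).eq
    (hasLocalDensityOn_withDensity (h.isC2Plus.c2.continuousOn_gaussCurvature h.isClosed h.convex))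
    h.isC2Plus.curvature_pos h.isCompact_frontier h.ae_gaussCurvatureMeasure_mem_frontier
    (withDensity_absolutelyContinuous _ _ (ae_restrict_mem isClosed_frontier.measurableSet))

theorem aestronglyMeasurable_comp_outerNormal (h : IsC2PlusBody K)
    (hf : ContinuousOn f (Metric.sphere 0 1)) :
    AEStronglyMeasurable (fun x => f (outerNormal K x)) (gaussCurvatureMeasure K) := by
  rw [← Measure.restrict_eq_self_of_ae_mem h.ae_gaussCurvatureMeasure_mem_frontier]
  exact (hf.comp (h.isC2Plus.c2.continuousOn_outerNormal h.isClosed h.convex) fun x hx =>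
    mem_sphere_zero_iff_norm.2 (h.norm_outerNormal hx)).aestronglyMeasurable
    isClosed_frontier.measurableSet

theorem aemeasurable_gaussCurvature (h : IsC2PlusBody K) :
    AEMeasurable (fun x => (gaussCurvature K x).toNNReal) (surfaceMeasure K) :=
  ((h.isC2Plus.c2.continuousOn_gaussCurvature h.isClosed h.convex).aemeasurable
    isClosed_frontier.measurableSet).real_toNNReal

theorem toNNReal_gaussCurvature_smul_ae_eq (h : IsC2PlusBody K)
    (f : EuclideanSpace ℝ (Fin n) → ℝ) :
    (fun x => (gaussCurvature K x).toNNReal • f x) =ᵐ[surfaceMeasure K]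
      fun x => gaussCurvature K x * f x := by
  filter_upwards [ae_restrict_mem isClosed_frontier.measurableSet] with x hx
  rw [NNReal.smul_def, Real.coe_toNNReal _ (h.isC2Plus.curvature_pos x hx).le, smul_eq_mul]

theorem integrable_gaussCurvature_mul_comp_outerNormal (h : IsC2PlusBody K) (hn : 1 ≤ n)
    (hf : ContinuousOn f (Metric.sphere 0 1)) :
    Integrable (fun x => gaussCurvature K x * f (outerNormal K x)) (surfaceMeasure K) := by
  have hint : Integrable (fun x => f (outerNormal K x)) (gaussCurvatureMeasure K) := by
    rw [gaussCurvatureMeasure, integrable_map_measure (h.aestronglyMeasurable_comp_outerNormal hf)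
      h.measurable_contact_sphere.aemeasurable]
    exact (integrable_sphere_of_continuousOn hf).congr
      (.of_forall fun v => congrArg f (h.outerNormal_contact (by simp)).symm)
  rw [h.gaussCurvatureMeasure_eq_withDensity hn] at hint
  exact ((integrable_withDensity_iff_integrable_smul₀ h.aemeasurable_gaussCurvature).1 hint).congr
    (h.toNNReal_gaussCurvature_smul_ae_eq _)

theorem integral_sphere_eq_integral_gaussCurvature_mul (h : IsC2PlusBody K) (hn : 1 ≤ n)
    (hf : ContinuousOn f (Metric.sphere 0 1)) :
    ∫ u : Metric.sphere (0 : EuclideanSpace ℝ (Fin n)) 1, f u ∂sphereMeasure n =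
      ∫ x, gaussCurvature K x * f (outerNormal K x) ∂surfaceMeasure K :=
  calc ∫ u : Metric.sphere (0 : EuclideanSpace ℝ (Fin n)) 1, f u ∂sphereMeasure n
      = ∫ u : Metric.sphere (0 : EuclideanSpace ℝ (Fin n)) 1,
          f (outerNormal K (contact K u)) ∂sphereMeasure n :=
        integral_congr_ae (.of_forall fun v => congrArg f (h.outerNormal_contact (by simp)).symm)
    _ = ∫ x, f (outerNormal K x) ∂gaussCurvatureMeasure K :=
        (integral_map h.measurable_contact_sphere.aemeasurable
          (h.aestronglyMeasurable_comp_outerNormal hf)).symm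
    _ = ∫ x, (gaussCurvature K x).toNNReal • f (outerNormal K x) ∂surfaceMeasure K := by
        rw [h.gaussCurvatureMeasure_eq_withDensity hn]
        exact integral_withDensity_eq_integral_smul₀ h.aemeasurable_gaussCurvature _
    _ = ∫ x, gaussCurvature K x * f (outerNormal K x) ∂surfaceMeasure K :=
        integral_congr_ae (h.toNNReal_gaussCurvature_smul_ae_eq _)

theorem gaussCurvature_mul_sphereIntegrand_outerNormal (h : IsC2PlusBody K)
    {x : EuclideanSpace ℝ (Fin n)} (hx : x ∈ frontier K) :
    gaussCurvature K x * sphereIntegrand K (outerNormal K x) = -boundaryIntegrand K x := by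
  have hcurv : curvatureFn K (outerNormal K x) = (gaussCurvature K x)⁻¹ :=
    congrArg (fun y => (gaussCurvature K y)⁻¹) (h.contact_outerNormal hx)
  rw [sphereIntegrand, hcurv, h.supportFn_outerNormal hx, boundaryIntegrand, ← mul_neg,
    ← Real.log_inv, inv_div, div_eq_mul_inv _ (gaussCurvature K x)]
  ring

theorem gaussCurvature_mul_sphereIntegrand_ae_eq (h : IsC2PlusBody K) :
    (fun x => gaussCurvature K x * sphereIntegrand K (outerNormal K x)) =ᵐ[surfaceMeasure K]
      fun x => -boundaryIntegrand K x := by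
  filter_upwards [ae_restrict_mem isClosed_frontier.measurableSet] with x hx
  exact h.gaussCurvature_mul_sphereIntegrand_outerNormal hx

theorem integrable_boundaryIntegrand (h : IsC2PlusBody K) (hn : 1 ≤ n) :
    Integrable (boundaryIntegrand K) (surfaceMeasure K) := by
  simpa using ((h.integrable_gaussCurvature_mul_comp_outerNormal hn
    h.continuousOn_sphereIntegrand).congr h.gaussCurvature_mul_sphereIntegrand_ae_eq).neg

theorem integral_sphereIntegrand (h : IsC2PlusBody K) (hn : 1 ≤ n) :
    ∫ u : Metric.sphere (0 : EuclideanSpace ℝ (Fin n)) 1, sphereIntegrand K u ∂sphereMeasure n =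
      -∫ x, boundaryIntegrand K x ∂surfaceMeasure K := by
  rw [h.integral_sphere_eq_integral_gaussCurvature_mul hn h.continuousOn_sphereIntegrand,
    integral_congr_ae h.gaussCurvature_mul_sphereIntegrand_ae_eq, integral_neg]

end IsC2PlusBody

end ChangeOfVariables

theorem zero_mem_interior_of_neg_mem {E : Type*} [AddCommGroup E] [Module ℝ E]
    [TopologicalSpace E] [IsTopologicalAddGroup E] [ContinuousConstSMul ℝ E] {s : Set E}
    (hs : Convex ℝ s) (hint : (interior s).Nonempty) (hneg : ∀ x ∈ s, -x ∈ s) :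
    (0 : E) ∈ interior s := by
  obtain ⟨x, hx⟩ := hint
  simpa using hs.combo_interior_self_mem_interior hx (hneg x (interior_subset hx))
    (by norm_num : (0 : ℝ) < 1 / 2) (by norm_num : (0 : ℝ) ≤ 1 / 2) (by norm_num)

end CentroidBody

end

theorem theorem4p1_general {n : ℕ} (hn : 1 ≤ n) {K : Set (EuclideanSpace ℝ (Fin n))}
    (hK : IsC2PlusBody K) (hsymm : ∀ x ∈ K, -x ∈ K) :
    (volume (polarBody K) ≠ ⊤ ∧ (∀ p : ℝ, 1 ≤ p → volume (polarBody (Zp p K)) ≠ ⊤) ∧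
      Integrable (fun u : Metric.sphere (0 : EuclideanSpace ℝ (Fin n)) 1 => sphereIntegrand K u)
        (sphereMeasure n) ∧
      Integrable (boundaryIntegrand K) (surfaceMeasure K)) ∧
    Tendsto (fun p : ℝ => p / Real.log p *
        (volume.real (polarBody (Zp p K)) - volume.real (polarBody K)))
      atTop (𝓝 ((n : ℝ) * (n + 1) / 2 * volume.real (polarBody K))) ∧
    Tendsto (fun p : ℝ => p * (volume.real (polarBody (Zp p K)) - volume.real (polarBody K) -
        (n : ℝ) * (n + 1) / (2 * p) * Real.log p * volume.real (polarBody (Zp p K))))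
      atTop (𝓝 (-(1 / 2) * ∫ u : Metric.sphere (0 : EuclideanSpace ℝ (Fin n)) 1,
        sphereIntegrand K u ∂(sphereMeasure n))) ∧
    Tendsto (fun p : ℝ => p * (volume.real (polarBody (Zp p K)) - volume.real (polarBody K) -
        (n : ℝ) * (n + 1) / (2 * p) * Real.log p * volume.real (polarBody K)))
      atTop (𝓝 (-(1 / 2) * ∫ u : Metric.sphere (0 : EuclideanSpace ℝ (Fin n)) 1,
        sphereIntegrand K u ∂(sphereMeasure n))) ∧
    -(1 / 2) * (∫ u : Metric.sphere (0 : EuclideanSpace ℝ (Fin n)) 1,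
        sphereIntegrand K u ∂(sphereMeasure n)) =
      1 / 2 * ∫ x, boundaryIntegrand K x ∂(surfaceMeasure K) := by
  refine ⟨⟨(hK.volume_polarBody hn).1, fun p hp => (hK.volume_polarBody_Zp hn hp).1,
    integrable_sphere_of_continuousOn hK.continuousOn_sphereIntegrand,
    hK.integrable_boundaryIntegrand hn⟩, hK.tendsto_volume_first_order hsymm hn,
    hK.tendsto_volume_deviation_Zp hsymm hn, hK.tendsto_volume_deviation hsymm hn, ?_⟩
  rw [hK.integral_sphereIntegrand hn, neg_mul_neg]

theorem theorem4p1 (n : ℕ) (hn : 1 ≤ n) (K : ConvexBody (EuclideanSpace ℝ (Fin n)))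
    (hint : (interior (K : Set (EuclideanSpace ℝ (Fin n)))).Nonempty)
    (hsymm : ∀ x ∈ K, -x ∈ K)
    (hvol : volume (K : Set (EuclideanSpace ℝ (Fin n))) = 1)
    (hC2 : IsC2Plus (K : Set (EuclideanSpace ℝ (Fin n)))) :
    -- the volumes and the integrals below are finite
    (volume (polarBody (K : Set (EuclideanSpace ℝ (Fin n)))) ≠ ⊤ ∧
      (∀ p : ℝ, 1 ≤ p → volume (polarBody (Zp p (K : Set (EuclideanSpace ℝ (Fin n))))) ≠ ⊤) ∧
      Integrable (fun u : Metric.sphere (0 : EuclideanSpace ℝ (Fin n)) 1 =>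
        sphereIntegrand (K : Set (EuclideanSpace ℝ (Fin n))) u) (sphereMeasure n) ∧
      Integrable (boundaryIntegrand (K : Set (EuclideanSpace ℝ (Fin n))))
        (surfaceMeasure (K : Set (EuclideanSpace ℝ (Fin n))))) ∧
    -- (i)
    Tendsto (fun p : ℝ => p / Real.log p *
        (volume.real (polarBody (Zp p (K : Set (EuclideanSpace ℝ (Fin n))))) -
          volume.real (polarBody (K : Set (EuclideanSpace ℝ (Fin n))))))
      atTop
      (𝓝 ((n : ℝ) * (n + 1) / 2 *
        volume.real (polarBody (K : Set (EuclideanSpace ℝ (Fin n)))))) ∧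
    -- (ii)
    Tendsto (fun p : ℝ => p *
        (volume.real (polarBody (Zp p (K : Set (EuclideanSpace ℝ (Fin n))))) -
          volume.real (polarBody (K : Set (EuclideanSpace ℝ (Fin n)))) -
          (n : ℝ) * (n + 1) / (2 * p) * Real.log p *
            volume.real (polarBody (Zp p (K : Set (EuclideanSpace ℝ (Fin n)))))))
      atTop
      (𝓝 (-(1 / 2) * ∫ u : Metric.sphere (0 : EuclideanSpace ℝ (Fin n)) 1,
        sphereIntegrand (K : Set (EuclideanSpace ℝ (Fin n))) u ∂(sphereMeasure n))) ∧
    Tendsto (fun p : ℝ => p *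
        (volume.real (polarBody (Zp p (K : Set (EuclideanSpace ℝ (Fin n))))) -
          volume.real (polarBody (K : Set (EuclideanSpace ℝ (Fin n)))) -
          (n : ℝ) * (n + 1) / (2 * p) * Real.log p *
            volume.real (polarBody (K : Set (EuclideanSpace ℝ (Fin n))))))
      atTop
      (𝓝 (-(1 / 2) * ∫ u : Metric.sphere (0 : EuclideanSpace ℝ (Fin n)) 1,
        sphereIntegrand (K : Set (EuclideanSpace ℝ (Fin n))) u ∂(sphereMeasure n))) ∧
    -(1 / 2) * (∫ u : Metric.sphere (0 : EuclideanSpace ℝ (Fin n)) 1,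
        sphereIntegrand (K : Set (EuclideanSpace ℝ (Fin n))) u ∂(sphereMeasure n)) =
      1 / 2 * ∫ x, boundaryIntegrand (K : Set (EuclideanSpace ℝ (Fin n))) x
        ∂(surfaceMeasure (K : Set (EuclideanSpace ℝ (Fin n)))) := by
  exact theorem4p1_general hn ⟨K.isCompact, K.convex,
    zero_mem_interior_of_neg_mem K.convex hint hsymm, hC2⟩ hsymm
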